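/- Let $n\ge 1$. Let $\mathrm{Conv}_{c,n}(\mathbb R^n)$ be the set of all functions $u:\mathbb R^n\to\mathbb R\cup\{+\infty\}$ that are proper ($u\not\equiv+\infty$), lower semicontinuous, convex and coercive ($\lim_{|x|\to\infty}u(x)=+\infty$) and whose domain $\{x : u(x)<+\infty\}$ has dimension $n$. Let $\zeta:\mathbb R\to(0,\infty)$ be continuous and strictly decreasing with $\int_0^\infty \zeta(t)\,t^{n-1}\,dt<\infty$, put $\zeta(+\infty):=0$, and for $u,v\in\mathrm{Conv}_{c,n}(\mathbb R^n)$ let $$\delta_{\zeta,1}(u,v)=\int_{\mathbb R^n}|\zeta(u(x))-\zeta(v(x))|\,dx .$$ Let $\Phi(\zeta)$ be the set of all $\phi\in \mathrm{GL}(n)$ such that the function $t\mapsto \zeta^{-1}(\zeta(t)/|\det\phi|)$ is well defined (that is, $\zeta(t)/|\det\phi|$ lies in the range of $\zeta$ for every $t\in\mathbb R$) and convex on $\mathbb R$. Then a map $I:\mathrm{Conv}_{c,n}(\mathbb R^n)\to\mathrm{Conv}_{c,n}(\mathbb R^n)$ (not assumed surjective) is an isometry, i.e. $\delta_{\zeta,1}(I(u),I(v))=\delta_{\zeta,1}(u,v)$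 for all $u,v\in\mathrm{Conv}_{c,n}(\mathbb R^n)$, if and only if there exist $\phi\in\Phi(\zeta)$ and $x_0\in\mathbb R^n$ such that $$I(u)=f(u\circ\alpha^{-1})\qquad\text{for every } u\in\mathrm{Conv}_{c,n}(\mathbb R^n),$$ where $\alpha(x)=\phi(x)+x_0$ for $x\in\mathbb R^n$, $f(t)=\zeta^{-1}(\zeta(t)/|\det\phi|)$ for $t\in\mathbb R$, and $f(+\infty):=+\infty$. -/

import Mathlib

open Set Filter Topology MeasureTheory

namespace ConvexIsometry

noncomputable section

/-- Euclidean space `ℝⁿ`. -/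
abbrev Rn (n : ℕ) : Type := EuclideanSpace ℝ (Fin n)

/-- The domain `{x | u x < +∞}` of an extended-real-valued function. -/
def dom {n : ℕ} (u : Rn n → EReal) : Set (Rn n) := {x | u x < ⊤}

/-- The epigraph `{(x, t) ∈ ℝⁿ × ℝ | u x ≤ t}`. -/
def epi {n : ℕ} (u : Rn n → EReal) : Set (Rn n × ℝ) := {p | u p.1 ≤ (p.2 : EReal)}

/-- `u : ℝⁿ → ℝ ∪ {+∞}` is proper, lower semicontinuous, coercive and convex, and its domain has
dimension `n` (the dimension of a set is that of its affine hull). -/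
structure IsCVcn {n : ℕ} (u : Rn n → EReal) : Prop where
  ne_bot : ∀ x, u x ≠ ⊥
  proper : ∃ x, u x ≠ ⊤
  lsc : LowerSemicontinuous u
  coercive : Tendsto u (Bornology.cobounded (Rn n)) (𝓝 ⊤)
  convex : Convex ℝ (epi u)
  full_dim : Module.finrank ℝ (vectorSpan ℝ (dom u)) = n

/-- The space of proper, lower semicontinuous, coercive, convex functions
`u : ℝⁿ → ℝ ∪ {+∞}` with `dim dom u = n`. -/
def CVcn (n : ℕ) : Set (Rn n → EReal) := {u | IsCVcn u}

/-- The class `M^{n-1}` of continuous, strictly decreasing functions `ζ : ℝ → (0, ∞)` with finite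
moment of order `n - 1`. -/
structure IsMoment (n : ℕ) (ζ : ℝ → ℝ) : Prop where
  pos : ∀ t, 0 < ζ t
  continuous : Continuous ζ
  strictAnti : StrictAnti ζ
  moment : IntegrableOn (fun t : ℝ => ζ t * t ^ (n - 1)) (Ioi 0)

/-- `ζ` on `ℝ ∪ {+∞}`, with the convention `ζ(+∞) = 0`. -/
def zetaExt (ζ : ℝ → ℝ) (t : EReal) : ℝ := if t = ⊤ then 0 else ζ t.toReal

/-- The distance `δ_{ζ,1}(u, v) = ∫ |ζ(u(x)) - ζ(v(x))| dx`, as an integral of a non-negative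
function with values in `[0, ∞]`. -/
def delta {n : ℕ} (ζ : ℝ → ℝ) (u v : Rn n → EReal) : ENNReal :=
  ∫⁻ x, ENNReal.ofReal |zetaExt ζ (u x) - zetaExt ζ (v x)|

/-- `I` is distance-preserving for `δ_{ζ,1}` (surjectivity is not required). -/
def IsIsometry {n : ℕ} (ζ : ℝ → ℝ) (I : CVcn n → CVcn n) : Prop :=
  ∀ u v : CVcn n, delta ζ (I u : Rn n → EReal) (I v) = delta ζ (u : Rn n → EReal) v

/-- `|det φ|` for an invertible linear map `φ` of `ℝⁿ`. -/
def absDet {n : ℕ} (φ : Rn n ≃ₗ[ℝ] Rn n) : ℝ := |LinearMap.det (φ : Rn n →ₗ[ℝ] Rn n)|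

/-- The function `f(t) = ζ⁻¹(ζ(t) / |det φ|)`. -/
def rescale {n : ℕ} (ζ : ℝ → ℝ) (φ : Rn n ≃ₗ[ℝ] Rn n) (t : ℝ) : ℝ :=
  Function.invFun ζ (ζ t / absDet φ)

/-- The set `Φ(ζ)` of all `φ ∈ GL(n)` such that `t ↦ ζ⁻¹(ζ(t) / |det φ|)` is well defined (each
`ζ(t) / |det φ|` is a value of `ζ`) and convex on `ℝ`. -/
def Phi {n : ℕ} (ζ : ℝ → ℝ) : Set (Rn n ≃ₗ[ℝ] Rn n) :=
  {φ | (∀ t, ζ t / absDet φ ∈ range ζ) ∧ ConvexOn ℝ univ (rescale ζ φ)}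

/-- A function `f : ℝ → ℝ` on `ℝ ∪ {+∞}`, with the convention `f(+∞) = +∞`. -/
def extendTop (f : ℝ → ℝ) (t : EReal) : EReal := if t = ⊤ then ⊤ else (f t.toReal : EReal)

/-- The affine bijection `α(x) = φ(x) + x₀` with its inverse. -/
def affinity {n : ℕ} (φ : Rn n ≃ₗ[ℝ] Rn n) (x₀ : Rn n) : Rn n ≃ Rn n where
  toFun x := φ x + x₀
  invFun y := φ.symm (y - x₀)
  left_inv x := by simp
  right_inv y := by simp

end

end ConvexIsometry

/-! Via `u ↦ ζ ∘ u` the space embeds in `L¹`, and `δ` becomes the `L¹` distance. The sufficiency of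
the formula is a change of variables: composing with `α⁻¹` multiplies integrals by `|det φ|`, and
`f` divides `ζ ∘ u` by it.

For necessity, the zero function is an `L¹` limit of elements, so its image `G` under the extended
isometry is defined. Splitting a body into two halves splits its image relative to `G`: almost
everywhere one half has image `G` and the other the image of the whole. Repeated halving forces `G =
0` (`image_zero`). Hence `I` preserves integrals, then integrals of minima, then order and
disjointness of supports.

Fix a level `t`, and consider the images of the functions equal to `t` on a convex body and `+∞` off
it. Disjoint ball coverings show that the image of a smaller body is a restriction of the image of a
larger one (`ae_of_cover`, `img_eq_of_subset`). All these images are therefore pieces of a single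
convex function `height` on an open convex set `reach`, and each point `y` of `reach` corresponds to
one point `back y`, which lies in every body whose image has `y` in the interior of its domain. The
map `back` sends segments onto segments and is a continuous bijection onto `ℝⁿ`.

Tubes around rays in `reach` contain the images of infinitely many disjoint balls of one radius,
hence have infinite weight for `ζ ∘ height`. A bounded tube has finite weight, so `reach` is the
whole space. A height increasing along a ray would make the weight summable, so `height` is a
constant `levelMap t`. It follows that `ζ (levelMap t)` is a fixed multiple of `ζ t` and that `back`
does not depend on `t`.

Order preservation and integrals of minima give `ζ ∘ I u = ratio · ζ ∘ u ∘ pointMap` on the interior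
of the domain. Convexity of the images of functions affine on large balls then makes `pointMap`
preserve midpoints, so it is affine. Volumes identify the ratio as `1 / |det φ|`, and limits along
segments settle the boundary points. -/

namespace ConvexIsometry
noncomputable section

/-! ### Regularity and integrability of `ζ ∘ u`, and convex bodies. -/

variable {n : ℕ} {ζ : ℝ → ℝ} {u v : Rn n → EReal}

/-- The interior of the domain. -/
def core (u : Rn n → EReal) : Set (Rn n) := interior (dom u)

/-- The composition `ζ ∘ u`, with `ζ(+∞) = 0`. -/
def comp (ζ : ℝ → ℝ) (u : Rn n → EReal) (x : Rn n) : ℝ := zetaExt ζ (u x)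

namespace IsCVcn

theorem coe_toReal (hu : IsCVcn u) {x : Rn n} (hx : x ∈ dom u) : ((u x).toReal : EReal) = u x :=
  EReal.coe_toReal (ne_of_lt hx) (hu.ne_bot x)

theorem convexOn (hu : IsCVcn u) : ConvexOn ℝ (dom u) (fun x => (u x).toReal) := by
  have key : ∀ x ∈ dom u, ∀ y ∈ dom u, ∀ a b : ℝ, 0 ≤ a → 0 ≤ b → a + b = 1 →
      u (a • x + b • y) ≤ ((a * (u x).toReal + b * (u y).toReal : ℝ) : EReal) := by
    intro x hx y hy a b ha hb hab
    have h1 : (x, (u x).toReal) ∈ epi u := (hu.coe_toReal hx).symm.le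
    have h2 : (y, (u y).toReal) ∈ epi u := (hu.coe_toReal hy).symm.le
    exact hu.convex h1 h2 ha hb hab
  have hc : Convex ℝ (dom u) := fun x hx y hy a b ha hb hab =>
    lt_of_le_of_lt (key x hx y hy a b ha hb hab) (EReal.coe_lt_top _)
  refine ⟨hc, fun x hx y hy a b ha hb hab => ?_⟩
  have h := key x hx y hy a b ha hb hab
  rw [← hu.coe_toReal (hc hx hy ha hb hab)] at h
  exact_mod_cast h

theorem convex_dom (hu : IsCVcn u) : Convex ℝ (dom u) := hu.convexOn.1

theorem convex_core (hu : IsCVcn u) : Convex ℝ (core u) := hu.convex_dom.interior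

theorem core_nonempty (hu : IsCVcn u) : (core u).Nonempty := by
  rw [core, hu.convex_dom.interior_nonempty_iff_affineSpan_eq_top]
  obtain ⟨x, hx⟩ := hu.proper
  have hne : (dom u).Nonempty := ⟨x, lt_top_iff_ne_top.2 hx⟩
  rw [AffineSubspace.affineSpan_eq_top_iff_vectorSpan_eq_top_of_nonempty ℝ _ _ hne]
  apply Submodule.eq_top_of_finrank_eq
  rw [hu.full_dim]; simp

end IsCVcn

theorem isOpen_core : IsOpen (core u) := isOpen_interior

theorem core_subset_dom : core u ⊆ dom u := interior_subset

namespace IsCVcn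

theorem dom_subset_closure_core (hu : IsCVcn u) : dom u ⊆ closure (core u) := by
  rw [core, hu.convex_dom.closure_interior_eq_closure_of_nonempty_interior hu.core_nonempty]
  exact subset_closure

theorem interior_closure_core (hu : IsCVcn u) : interior (closure (core u)) = core u := by
  rw [core, hu.convex_dom.closure_interior_eq_closure_of_nonempty_interior hu.core_nonempty]
  exact hu.convex_dom.interior_closure_eq_interior_of_nonempty_interior hu.core_nonempty

theorem null_frontier (hu : IsCVcn u) : volume (frontier (dom u)) = 0 :=
  hu.convex_dom.addHaar_frontier volume

/-- Almost every point lies in the interior of the domain or in its exterior. -/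
theorem ae_mem_core_or (hu : IsCVcn u) : ∀ᵐ x, x ∈ core u ∨ x ∉ closure (dom u) := by
  filter_upwards [measure_eq_zero_iff_ae_notMem.1 hu.null_frontier] with x hx
  by_contra! h
  exact hx ⟨h.2, h.1⟩

theorem combo_mem_core (hu : IsCVcn u) {p b : Rn n} (hp : p ∈ closure (dom u)) (hb : b ∈ core u)
    {ε : ℝ} (h0 : 0 < ε) (h1 : ε ≤ 1) : (1 - ε) • p + ε • b ∈ core u := by
  rw [add_comm]
  exact hu.convex_dom.combo_interior_closure_mem_interior hb hp h0 (by linarith) (by ring)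

theorem continuousOn_toReal (hu : IsCVcn u) : ContinuousOn (fun x => (u x).toReal) (core u) :=
  hu.convexOn.continuousOn_interior

theorem measurable (hu : IsCVcn u) : Measurable u := hu.lsc.measurable

/-- An open set almost all of which lies in the domain lies in its interior. -/
theorem subset_core_of_ae (hu : IsCVcn u) {O : Set (Rn n)} (hO : IsOpen O)
    (h : ∀ᵐ x, x ∈ O → x ∈ dom u) : O ⊆ core u := by
  rw [← hu.interior_closure_core]
  refine interior_maximal ?_ hO
  intro x hx
  by_contra hxc
  have hW : IsOpen (O ∩ (closure (core u))ᶜ) := hO.inter isClosed_closure.isOpen_compl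
  have h0 : volume (O ∩ (closure (core u))ᶜ) = 0 := by
    refine measure_mono_null ?_ (ae_iff.1 h)
    intro y hy hyd
    exact hy.2 (hu.dom_subset_closure_core (hyd hy.1))
  exact (hW.measure_pos volume ⟨x, hx, hxc⟩).ne' h0

end IsCVcn

theorem comp_of_not_mem {x : Rn n} (hx : x ∉ dom u) : comp ζ u x = 0 := by
  have : u x = ⊤ := by simpa [dom] using hx
  simp [comp, zetaExt, this]

theorem comp_of_mem {x : Rn n} (hx : x ∈ dom u) : comp ζ u x = ζ (u x).toReal := by
  simp [comp, zetaExt, LT.lt.ne (show u x < ⊤ from hx)]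

/-- A coercive convex function grows at least linearly. -/
theorem IsCVcn.linear_growth (hu : IsCVcn u) :
    ∃ a > 0, ∃ R > 0, ∀ x, R < ‖x‖ → ((a * ‖x‖ : ℝ) : EReal) ≤ u x := by
  obtain ⟨x₀, hx₀⟩ := hu.proper
  have hx₀ : x₀ ∈ dom u := lt_top_iff_ne_top.2 hx₀
  set m := (u x₀).toReal
  have h1 := hu.coercive.eventually (lt_mem_nhds (EReal.coe_lt_top (m + 1)))
  obtain ⟨R₁, hR₁⟩ : ∃ R₁ : ℝ, ∀ x, R₁ ≤ ‖x‖ → ((m + 1 : ℝ) : EReal) < u x := by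
    have h2 := (hasBasis_cobounded_norm (E := Rn n)).eventually_iff.1 h1
    obtain ⟨r, -, hr⟩ := h2
    exact ⟨r, fun x hx => hr hx⟩
  set R₀ := max R₁ 0 + ‖x₀‖ + 1 with hR₀
  have hR₀p : 0 < R₀ := by positivity
  have hout : ∀ x, R₀ ≤ ‖x - x₀‖ → ((m + 1 : ℝ) : EReal) < u x := by
    intro x hx
    refine hR₁ x ?_
    have := norm_sub_le x x₀
    have := le_max_left R₁ 0
    linarith
  -- The segment from `x₀` to `x` crosses the sphere of radius `R₀`, where `u` exceeds `m + 1`, so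
  -- convexity gives slope at least `1 / R₀` beyond it. Half that slope suffices once `‖x‖` is large
  -- enough to absorb `‖x₀‖` and `m`.
  refine ⟨1 / (2 * R₀), by positivity, ‖x₀‖ + R₀ + 2 * (‖x₀‖ + R₀ * |m|), by positivity, ?_⟩
  intro x hx
  by_cases hxd : x ∈ dom u
  swap
  · have : u x = ⊤ := by simpa [dom] using hxd
    rw [this]; exact le_top
  rw [← hu.coe_toReal hxd]
  set d := ‖x - x₀‖ with hd
  have hdx : ‖x‖ - ‖x₀‖ ≤ d := norm_sub_norm_le x x₀
  have hRm : 0 ≤ R₀ * |m| := by positivity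
  have hn0 := norm_nonneg x₀
  have hdR : R₀ ≤ d := by linarith
  have hdp : 0 < d := hR₀p.trans_le hdR
  have hz := hu.convexOn.2 hx₀ hxd (show 0 ≤ 1 - R₀ / d by
    rw [sub_nonneg, div_le_one hdp]; exact hdR) (show 0 ≤ R₀ / d by positivity) (by ring)
  have hzd := hu.convex_dom hx₀ hxd (show 0 ≤ 1 - R₀ / d by
    rw [sub_nonneg, div_le_one hdp]; exact hdR) (show 0 ≤ R₀ / d by positivity) (by ring)
  have hzn : ‖((1 - R₀ / d) • x₀ + (R₀ / d) • x) - x₀‖ = R₀ := by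
    have : ((1 - R₀ / d) • x₀ + (R₀ / d) • x) - x₀ = (R₀ / d) • (x - x₀) := by
      rw [sub_smul, smul_sub, one_smul]; abel
    rw [this, norm_smul, Real.norm_of_nonneg (by positivity), ← hd]
    field_simp
  have hz2 := hout _ hzn.ge
  rw [← hu.coe_toReal hzd, EReal.coe_lt_coe_iff] at hz2
  simp only [smul_eq_mul] at hz
  have h3 : 1 < R₀ / d * ((u x).toReal - m) := by
    have : (1 - R₀ / d) * m + R₀ / d * (u x).toReal = m + R₀ / d * ((u x).toReal - m) := by ring
    linarith
  have h4 : d < R₀ * ((u x).toReal - m) := by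
    rw [div_mul_eq_mul_div, lt_div_iff₀ hdp] at h3; linarith
  rw [EReal.coe_le_coe_iff, one_div, inv_mul_le_iff₀ (by positivity)]
  have h5 : -(R₀ * |m|) ≤ R₀ * m := by
    rw [← mul_neg]; exact mul_le_mul_of_nonneg_left (neg_abs_le m) hR₀p.le
  nlinarith

/-- A positive limit would be integrable on `(1, ∞)`, since `t ^ (n - 1) ≥ 1` there. -/
theorem tendsto_zeta_atTop (hζ : IsMoment n ζ) : Tendsto ζ atTop (𝓝 0) := by
  have hbdd : BddBelow (range ζ) := ⟨0, by rintro _ ⟨t, rfl⟩; exact (hζ.pos t).le⟩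
  have h := tendsto_atTop_ciInf hζ.strictAnti.antitone hbdd
  set s := ⨅ i, ζ i with hs_def
  have hs0 : 0 ≤ s := le_ciInf fun t => (hζ.pos t).le
  rcases hs0.eq_or_lt with h0 | hs
  · rwa [← h0] at h
  exfalso
  have : IntegrableOn (fun _ : ℝ => s) (Ioi 1) := by
    refine Integrable.mono' (hζ.moment.mono_set (Ioi_subset_Ioi zero_le_one))
      aestronglyMeasurable_const ?_
    filter_upwards [ae_restrict_mem measurableSet_Ioi] with t ht
    rw [Real.norm_of_nonneg hs.le]
    calc s ≤ ζ t := ciInf_le hbdd t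
      _ = ζ t * 1 := (mul_one _).symm
      _ ≤ ζ t * t ^ (n - 1) :=
        mul_le_mul_of_nonneg_left (one_le_pow₀ (le_of_lt ht)) (hζ.pos t).le
  rw [integrableOn_const_iff] at this
  simp [hs.ne'] at this

theorem comp_nonneg (hζ : IsMoment n ζ) (x : Rn n) : 0 ≤ comp ζ u x := by
  unfold comp zetaExt; split_ifs
  · exact le_rfl
  · exact (hζ.pos _).le

theorem comp_pos_iff (hζ : IsMoment n ζ) {x : Rn n} : 0 < comp ζ u x ↔ x ∈ dom u := by
  constructor
  · intro h; by_contra hx; rw [comp_of_not_mem hx] at h; exact lt_irrefl _ h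
  · intro h; rw [comp_of_mem h]; exact hζ.pos _

theorem IsCVcn.measurable_comp (hζ : IsMoment n ζ) (hu : IsCVcn u) : Measurable (comp ζ u) := by
  have : Measurable (zetaExt ζ) := by
    unfold zetaExt
    exact Measurable.ite (measurableSet_singleton _) measurable_const
      (hζ.continuous.measurable.comp measurable_ereal_toReal)
  exact this.comp hu.measurable

theorem comp_le_of_le (hζ : IsMoment n ζ) (hu : IsCVcn u) (hv : IsCVcn v) {x : Rn n}
    (h : v x ≤ u x) :
    comp ζ u x ≤ comp ζ v x := by
  by_cases hx : x ∈ dom u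
  · have hxv : x ∈ dom v := h.trans_lt hx
    rw [comp_of_mem hx, comp_of_mem hxv, hζ.strictAnti.le_iff_ge]
    rw [← hu.coe_toReal hx, ← hv.coe_toReal hxv] at h
    exact_mod_cast h
  · rw [comp_of_not_mem hx]; exact comp_nonneg hζ x

theorem IsCVcn.continuousAt_comp (hζ : IsMoment n ζ) (hu : IsCVcn u) {x : Rn n}
    (hx : x ∈ core u) : ContinuousAt (comp ζ u) x := by
  have h1 : ContinuousAt (fun x => ζ (u x).toReal) x :=
    hζ.continuous.continuousAt.comp (hu.continuousOn_toReal.continuousAt (isOpen_core.mem_nhds hx))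
  refine h1.congr ?_
  filter_upwards [isOpen_core.mem_nhds hx] with y hy
  exact (comp_of_mem (core_subset_dom hy)).symm

theorem IsCVcn.ae_continuousAt_comp (hζ : IsMoment n ζ) (hu : IsCVcn u) :
    ∀ᵐ x, ContinuousAt (comp ζ u) x := by
  filter_upwards [hu.ae_mem_core_or] with x hx
  rcases hx with hx | hx
  · exact hu.continuousAt_comp hζ hx
  · refine (continuousAt_const (y := (0 : ℝ))).congr ?_
    filter_upwards [isClosed_closure.isOpen_compl.mem_nhds hx] with y hy
    exact (comp_of_not_mem fun h => hy (subset_closure h)).symm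

/-- Superlevel sets of `ζ ∘ u` are closed. -/
theorem IsCVcn.isClosed_superlevel (hζ : IsMoment n ζ) (hu : IsCVcn u) {s : ℝ} :
    IsClosed {x | s ≤ comp ζ u x} := by
  rcases le_or_gt s 0 with hs | hs
  · convert isClosed_univ
    exact eq_univ_of_forall fun x => hs.trans (comp_nonneg hζ x)
  refine isClosed_of_closure_subset ?_
  intro x hx
  by_contra hlt
  simp only [mem_ofPred_eq, not_le] at hlt
  -- A real `r` strictly below `u x` with `ζ r < s`: lower semicontinuity keeps `u` above `r`, hence
  -- `ζ ∘ u` below `s`, near `x`.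
  obtain ⟨r, hr1, hr2⟩ : ∃ r : ℝ, (r : EReal) < u x ∧ ζ r < s := by
    by_cases hxd : x ∈ dom u
    · rw [comp_of_mem hxd] at hlt
      have := (hζ.continuous.continuousAt (x := (u x).toReal)).eventually (gt_mem_nhds hlt)
      have h2 : ∃ᶠ r in 𝓝[<] (u x).toReal, ζ r < s :=
        (this.filter_mono nhdsWithin_le_nhds).frequently
      obtain ⟨r, h3, h4⟩ := (h2.and_eventually self_mem_nhdsWithin).exists
      refine ⟨r, ?_, h3⟩
      rw [← hu.coe_toReal hxd]; exact_mod_cast h4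
    · have hxt : u x = ⊤ := by simpa [dom] using hxd
      obtain ⟨r, hr⟩ := ((tendsto_zeta_atTop hζ).eventually (gt_mem_nhds hs)).exists
      exact ⟨r, by rw [hxt]; exact EReal.coe_lt_top r, hr⟩
  have hev : ∀ᶠ y in 𝓝 x, (r : EReal) < u y := hu.lsc x _ hr1
  obtain ⟨y, hy1, hy2⟩ := ((mem_closure_iff_frequently.1 hx).and_eventually hev).exists
  have hy1 : s ≤ comp ζ u y := hy1
  have hyd : y ∈ dom u := (comp_pos_iff hζ).1 (hs.trans_le hy1)
  rw [comp_of_mem hyd] at hy1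
  rw [← hu.coe_toReal hyd] at hy2
  have := hζ.strictAnti (EReal.coe_lt_coe_iff.1 hy2)
  linarith

theorem zetaExt_anti (hζ : IsMoment n ζ) {a b : EReal} (ha : a ≠ ⊥) (hab : a ≤ b) :
    zetaExt ζ b ≤ zetaExt ζ a := by
  unfold zetaExt
  split_ifs with h1 h2 h2
  · exact le_rfl
  · exact (hζ.pos _).le
  · exact absurd (top_le_iff.1 (h2 ▸ hab)) h1
  · exact hζ.strictAnti.antitone (EReal.toReal_le_toReal hab ha h1)

theorem IsCVcn.comp_bounded (hζ : IsMoment n ζ) (hu : IsCVcn u) (R : ℝ) :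
    ∃ M, ∀ x, ‖x‖ ≤ R → comp ζ u x ≤ M := by
  by_cases hR : 0 ≤ R
  · obtain ⟨x₁, -, hx₁⟩ := LowerSemicontinuousOn.exists_isMinOn
      (s := Metric.closedBall (0 : Rn n) R)
      ⟨0, by simpa using hR⟩ (isCompact_closedBall 0 R) (hu.lsc.lowerSemicontinuousOn _)
    exact ⟨comp ζ u x₁, fun x hx => zetaExt_anti hζ (hu.ne_bot _) (hx₁ (by simpa using hx))⟩
  · exact ⟨0, fun x hx => absurd ((norm_nonneg x).trans hx) hR⟩

/-- Off a ball, linear growth bounds `ζ ∘ u` by `ζ (a ‖x‖)`, whose integral in polar coordinates is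
the moment of order `n - 1`. -/
theorem IsCVcn.integrable_comp (hζ : IsMoment n ζ) (hn : 1 ≤ n) (hu : IsCVcn u) :
    Integrable (comp ζ u) := by
  obtain ⟨a, ha, R, hR, hgrow⟩ := hu.linear_growth
  obtain ⟨M, hM⟩ := hu.comp_bounded hζ R
  have : Nonempty (Fin n) := ⟨⟨0, hn⟩⟩
  have h1 : Integrable (fun x : Rn n => ζ (a * ‖x‖)) := by
    rw [integrable_fun_norm_addHaar volume (f := fun r => ζ (a * r))]
    have h2 := (integrableOn_Ioi_comp_mul_left_iff (fun t : ℝ => ζ t * t ^ (n - 1)) 0 ha).2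
      (by simpa using hζ.moment)
    have h3 := h2.const_mul ((a ^ (n - 1))⁻¹)
    refine (integrable_congr ?_).1 h3
    refine Eventually.of_forall fun y => ?_
    simp only [finrank_euclideanSpace, Fintype.card_fin, smul_eq_mul]
    rw [mul_pow]
    field_simp
  have h2 : Integrable ((Metric.closedBall (0 : Rn n) R).indicator fun _ => M) :=
    (integrable_indicator_iff Metric.isClosed_closedBall.measurableSet).2
      (integrableOn_const (isCompact_closedBall _ _).measure_lt_top.ne)
  refine Integrable.mono' (h1.add h2) (hu.measurable_comp hζ).aestronglyMeasurable
    (Eventually.of_forall fun x => ?_)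
  rw [Real.norm_of_nonneg (comp_nonneg hζ x)]
  simp only [Pi.add_apply]
  rcases le_or_gt ‖x‖ R with hx | hx
  · rw [indicator_of_mem (by simpa using hx)]
    have := hM x hx; have := hζ.pos (a * ‖x‖); linarith
  · rw [indicator_of_notMem (by simpa using hx), add_zero]
    have := zetaExt_anti hζ (EReal.coe_ne_bot _) (hgrow x hx)
    have h3 : zetaExt ζ ((a * ‖x‖ : ℝ) : EReal) = ζ (a * ‖x‖) := by
      rw [zetaExt, if_neg (EReal.coe_ne_top _), EReal.toReal_coe]
    exact h3 ▸ this

/-- A convex body: a compact convex set with nonempty interior. -/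
structure IsBody (K : Set (Rn n)) : Prop where
  convex : Convex ℝ K
  compact : IsCompact K
  nonempty : (interior K).Nonempty

open Classical in
/-- The function equal to `g` on `K` and to `+∞` off `K`. -/
def bodyFun (K : Set (Rn n)) (g : Rn n → ℝ) (x : Rn n) : EReal :=
  if x ∈ K then (g x : EReal) else ⊤

variable {K : Set (Rn n)} {g : Rn n → ℝ}

theorem bodyFun_of_mem {x : Rn n} (hx : x ∈ K) : bodyFun K g x = g x := by simp [bodyFun, hx]

theorem bodyFun_of_not_mem {x : Rn n} (hx : x ∉ K) : bodyFun K g x = ⊤ := by simp [bodyFun, hx]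

theorem dom_bodyFun : dom (bodyFun K g) = K := by
  ext x
  by_cases hx : x ∈ K <;> simp [dom, bodyFun, hx]

theorem IsBody.isCVcn (hK : IsBody K) (hg : ConvexOn ℝ univ g) (hc : Continuous g) :
    IsCVcn (bodyFun K g) where
  ne_bot x := by by_cases hx : x ∈ K <;> simp [bodyFun, hx]
  proper := by
    obtain ⟨x, hx⟩ := hK.nonempty
    exact ⟨x, by simp [bodyFun, interior_subset hx]⟩
  lsc := by
    intro x y hy
    by_cases hx : x ∈ K
    · rw [bodyFun_of_mem hx] at hy
      have hcc : Continuous fun x => (g x : EReal) := continuous_coe_real_ereal.comp hc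
      filter_upwards [hcc.continuousAt.eventually (lt_mem_nhds hy)] with z hz
      by_cases hzK : z ∈ K
      · rwa [bodyFun_of_mem hzK]
      · rw [bodyFun_of_not_mem hzK]; exact hz.trans (EReal.coe_lt_top _)
    · filter_upwards [hK.compact.isClosed.isOpen_compl.mem_nhds hx] with z hz
      rw [bodyFun_of_not_mem hx] at hy
      rwa [bodyFun_of_not_mem hz]
  coercive := by
    refine (tendsto_const_nhds (x := (⊤ : EReal))).congr' ?_
    have : Kᶜ ∈ Bornology.cobounded (Rn n) := hK.compact.isBounded
    filter_upwards [this] with z hz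
    rw [bodyFun_of_not_mem hz]
  convex := by
    have hepi : epi (bodyFun K g) = {p | p.1 ∈ K ∧ g p.1 ≤ p.2} := by
      ext ⟨x, t⟩
      by_cases hx : x ∈ K <;> simp [epi, bodyFun, hx]
    rw [hepi]
    exact (hg.subset (subset_univ K) hK.convex).convex_epigraph
  full_dim := by
    rw [dom_bodyFun]
    have h1 := (hK.convex.interior_nonempty_iff_affineSpan_eq_top).1 hK.nonempty
    have hne : K.Nonempty := hK.nonempty.mono interior_subset
    rw [AffineSubspace.affineSpan_eq_top_iff_vectorSpan_eq_top_of_nonempty ℝ _ _ hne] at h1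
    rw [h1]; simp

/-- The element of the space that equals `t` on the body `K`. -/
def IsBody.level (hK : IsBody K) (t : ℝ) : CVcn n :=
  ⟨bodyFun K fun _ => t, hK.isCVcn (convexOn_const t convex_univ) continuous_const⟩

theorem comp_bodyFun_of_mem {x : Rn n} (hx : x ∈ K) : comp ζ (bodyFun K g) x = ζ (g x) := by
  simp [comp, zetaExt, bodyFun, hx]

theorem comp_level (hK : IsBody K) (t : ℝ) :
    comp ζ (hK.level t : Rn n → EReal) = K.indicator fun _ => ζ t := by
  ext x
  by_cases hx : x ∈ K <;> simp [comp, zetaExt, IsBody.level, bodyFun, hx]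

theorem IsBody.measurableSet (hK : IsBody K) : MeasurableSet K := hK.compact.isClosed.measurableSet

theorem IsBody.volume_pos (hK : IsBody K) : 0 < volume.real K := by
  rw [measureReal_def, ENNReal.toReal_pos_iff]
  refine ⟨?_, hK.compact.measure_lt_top⟩
  exact (isOpen_interior.measure_pos volume hK.nonempty).trans_le (measure_mono interior_subset)

theorem integral_comp_level (hK : IsBody K) (t : ℝ) :
    ∫ x, comp ζ (hK.level t : Rn n → EReal) x = ζ t * volume.real K := by
  rw [comp_level, integral_indicator hK.measurableSet, setIntegral_const, smul_eq_mul, mul_comm]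

theorem isBody_closedBall (x : Rn n) {r : ℝ} (hr : 0 < r) : IsBody (Metric.closedBall x r) :=
  ⟨convex_closedBall x r, isCompact_closedBall x r,
    ⟨x, Metric.ball_subset_interior_closedBall (Metric.mem_ball_self hr)⟩⟩

end
end ConvexIsometry

/-! ### Metric splitting in `L¹` and the image of the zero function. -/

namespace ConvexIsometry
noncomputable section

variable {n : ℕ} {ζ : ℝ → ℝ} {u v : Rn n → EReal} {K K₁ K₂ : Set (Rn n)}
  {I : CVcn n → CVcn n} {G : Rn n → ℝ}

section L1

variable {α : Type*} [MeasurableSpace α] {μ : Measure α} {a b c : α → ℝ}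

theorem ae_eq_of_le_of_integral_eq (ha : Integrable a μ) (hb : Integrable b μ)
    (h : ∀ᵐ x ∂μ, a x ≤ b x) (hi : ∫ x, b x ∂μ ≤ ∫ x, a x ∂μ) : ∀ᵐ x ∂μ, a x = b x := by
  have h0 : ∫ x, (b x - a x) ∂μ = 0 := by
    have h1 : 0 ≤ ∫ x, (b x - a x) ∂μ :=
      integral_nonneg_of_ae (h.mono fun x hx => sub_nonneg.2 hx)
    rw [integral_sub hb ha] at h1 ⊢
    linarith
  rw [integral_eq_zero_iff_of_nonneg_ae (h.mono fun x hx => sub_nonneg.2 hx) (hb.sub ha)] at h0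
  filter_upwards [h0] with x hx
  have : b x - a x = 0 := hx
  linarith

/-- If `c` splits metrically into `a` and `b` in `L¹`, then pointwise one part vanishes and the
other one is `c`. -/
theorem ae_split_of_integral (ha : Integrable a μ) (hb : Integrable b μ) (hc : Integrable c μ)
    (h1 : ∫ x, |c x| ∂μ = ∫ x, |a x| ∂μ + ∫ x, |b x| ∂μ)
    (h2 : ∫ x, |c x - a x| ∂μ = ∫ x, |b x| ∂μ) (h3 : ∫ x, |c x - b x| ∂μ = ∫ x, |a x| ∂μ)
    (h4 : ∫ x, |a x - b x| ∂μ = ∫ x, |a x| ∂μ + ∫ x, |b x| ∂μ) :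
    ∀ᵐ x ∂μ, (a x = 0 ∧ b x = c x) ∨ (b x = 0 ∧ a x = c x) := by
  have hca : Integrable (fun x => |c x - a x|) μ := (hc.sub ha).abs
  have hcb : Integrable (fun x => |c x - b x|) μ := (hc.sub hb).abs
  -- Each hypothesis is an integrated triangle inequality with equality, so equality holds almost
  -- everywhere.
  have e1 : ∀ᵐ x ∂μ, |c x| = |a x| + |c x - a x| := by
    refine ae_eq_of_le_of_integral_eq hc.abs (ha.abs.add hca)
      (Eventually.of_forall fun x => ?_) ?_
    · have := abs_add_le (a x) (c x - a x); simpa using this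
    · rw [integral_add ha.abs hca, h1, h2]
  have e2 : ∀ᵐ x ∂μ, |c x| = |b x| + |c x - b x| := by
    refine ae_eq_of_le_of_integral_eq hc.abs (hb.abs.add hcb)
      (Eventually.of_forall fun x => ?_) ?_
    · have := abs_add_le (b x) (c x - b x); simpa using this
    · rw [integral_add hb.abs hcb, h1, h3, add_comm]
  have e3 : ∀ᵐ x ∂μ, |a x - b x| = |a x| + |b x| := by
    refine ae_eq_of_le_of_integral_eq (ha.sub hb).abs (ha.abs.add hb.abs)
      (Eventually.of_forall fun x => abs_sub _ _) ?_
    rw [integral_add ha.abs hb.abs]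
    exact h4.ge
  -- If both were nonzero, `e1` and `e2` would give `a` and `b` the sign of `c`, while `e3` gives
  -- them opposite signs.
  have e4 : ∀ᵐ x ∂μ, a x = 0 ∨ b x = 0 := by
    filter_upwards [e1, e2, e3] with x h1 h2 h3
    by_contra! h
    rcases lt_or_gt_of_ne h.1 with ha | ha <;> rcases lt_or_gt_of_ne h.2 with hb | hb <;>
      rcases abs_cases (a x) with hA | hA <;> rcases abs_cases (b x) with hB | hB <;>
      rcases abs_cases (c x) with hC | hC <;> rcases abs_cases (c x - a x) with hD | hD <;>
      rcases abs_cases (c x - b x) with hE | hE <;> rcases abs_cases (a x - b x) with hF | hF <;>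
      linarith
  have e5 : ∀ᵐ x ∂μ, |a x| + |b x| = |c x| := by
    refine ae_eq_of_le_of_integral_eq (ha.abs.add hb.abs) hc.abs ?_ ?_
    · filter_upwards [e1, e2, e4] with x h1 h2 h4
      have := abs_nonneg (c x - a x); have := abs_nonneg (c x - b x)
      rcases h4 with h | h <;> simp only [h, abs_zero] at * <;> linarith
    · rw [integral_add ha.abs hb.abs, h1]
  filter_upwards [e1, e2, e4, e5] with x h1 h2 h4 h5
  rcases h4 with h | h
  · left
    refine ⟨h, ?_⟩
    rw [h, abs_zero, zero_add] at h5
    have : |c x - b x| = 0 := by linarith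
    linarith [abs_eq_zero.1 this]
  · right
    refine ⟨h, ?_⟩
    rw [h, abs_zero, add_zero] at h5
    have : |c x - a x| = 0 := by linarith
    linarith [abs_eq_zero.1 this]

end L1

theorem integrable_comp_coe (hζ : IsMoment n ζ) (hn : 1 ≤ n) (u : CVcn n) :
    Integrable (comp ζ (u : Rn n → EReal)) := IsCVcn.integrable_comp hζ hn u.2

theorem delta_eq (hζ : IsMoment n ζ) (hn : 1 ≤ n) (u v : CVcn n) :
    delta ζ (u : Rn n → EReal) v
      = ENNReal.ofReal (∫ x, |comp ζ (u : Rn n → EReal) x - comp ζ v x|) := by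
  rw [ofReal_integral_eq_lintegral_ofReal]
  · rfl
  · exact ((integrable_comp_coe hζ hn u).sub (integrable_comp_coe hζ hn v)).abs
  · exact Eventually.of_forall fun x => abs_nonneg _

theorem IsIsometry.integral_eq (hI : IsIsometry ζ I) (hζ : IsMoment n ζ) (hn : 1 ≤ n)
    (u v : CVcn n) :
    ∫ x, |comp ζ (I u : Rn n → EReal) x - comp ζ (I v) x|
      = ∫ x, |comp ζ (u : Rn n → EReal) x - comp ζ v x| := by
  have h := hI u v
  rw [delta_eq hζ hn, delta_eq hζ hn] at h
  rwa [ENNReal.ofReal_eq_ofReal_iff (integral_nonneg fun x => abs_nonneg _)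
    (integral_nonneg fun x => abs_nonneg _)] at h

/-- The image of the zero function under the extension of the isometry to the closure in `L¹`. -/
theorem IsIsometry.exists_image_zero (hI : IsIsometry ζ I) (hζ : IsMoment n ζ) (hn : 1 ≤ n) :
    ∃ G : Rn n → ℝ, Integrable G ∧
      ∀ u : CVcn n, ∫ x, |comp ζ (I u : Rn n → EReal) x - G x|
        = ∫ x, comp ζ (u : Rn n → EReal) x := by
  have hB : IsBody (Metric.closedBall (0 : Rn n) 1) := isBody_closedBall 0 one_pos
  set V := volume.real (Metric.closedBall (0 : Rn n) 1)
  have hVp : 0 ≤ V := hB.volume_pos.le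
  -- The functions of height `k` on a fixed ball tend to zero in `L¹`, because `ζ k → 0`.
  let w : ℕ → CVcn n := fun k => hB.level k
  have hw : ∀ k, ∫ x, comp ζ (w k : Rn n → EReal) x = ζ k * V := fun k => integral_comp_level hB k
  have hint := integrable_comp_coe hζ hn
  have hdiff : ∀ u v : CVcn n, ‖(hint u).toL1 _ - (hint v).toL1 _‖
      = ∫ x, |comp ζ (u : Rn n → EReal) x - comp ζ v x| := by
    intro u v
    rw [← Integrable.toL1_sub, L1.norm_of_fun_eq_integral_norm]
    rfl
  have hζ0 : Tendsto (fun k : ℕ => ζ k * V) atTop (𝓝 0) := by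
    have := ((tendsto_zeta_atTop hζ).comp tendsto_natCast_atTop_atTop).mul_const V
    simpa using this
  have hc : CauchySeq fun k => (hint (I (w k))).toL1 _ := by
    refine cauchySeq_of_le_tendsto_0 (fun N : ℕ => 2 * (ζ N * V)) ?_
      (by simpa using hζ0.const_mul 2)
    intro k l N hk hl
    rw [dist_eq_norm, hdiff, hI.integral_eq hζ hn]
    calc ∫ x, |comp ζ (w k : Rn n → EReal) x - comp ζ (w l) x|
        ≤ ∫ x, (comp ζ (w k : Rn n → EReal) x + comp ζ (w l) x) := by
          refine integral_mono ((hint _).sub (hint _)).abs ((hint _).add (hint _)) fun x => ?_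
          have h1 := comp_nonneg hζ (u := (w k : Rn n → EReal)) x
          have h2 := comp_nonneg hζ (u := (w l : Rn n → EReal)) x
          simp only [abs_le]
          constructor <;> linarith
      _ = ζ k * V + ζ l * V := by rw [integral_add (hint _) (hint _), hw, hw]
      _ ≤ 2 * (ζ N * V) := by
          have h1 : ζ k ≤ ζ N := hζ.strictAnti.antitone (by exact_mod_cast hk)
          have h2 : ζ l ≤ ζ N := hζ.strictAnti.antitone (by exact_mod_cast hl)
          nlinarith
  obtain ⟨g, hg⟩ := cauchySeq_tendsto_of_complete hc
  refine ⟨g, L1.integrable_coeFn g, fun u => ?_⟩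
  have e1 : ∫ x, |comp ζ (I u : Rn n → EReal) x - g x| = ‖(hint (I u)).toL1 _ - g‖ := by
    rw [L1.norm_eq_integral_norm]
    refine integral_congr_ae ?_
    filter_upwards [Lp.coeFn_sub ((hint (I u)).toL1 _) g, (hint (I u)).coeFn_toL1] with x h1 h2
    rw [h1, Pi.sub_apply, h2, Real.norm_eq_abs]
  rw [e1]
  have t1 : Tendsto (fun k => ‖(hint (I u)).toL1 _ - (hint (I (w k))).toL1 _‖) atTop
      (𝓝 ‖(hint (I u)).toL1 _ - g‖) := (hg.const_sub _).norm
  refine tendsto_nhds_unique t1 ?_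
  have hb : ∀ k, |‖(hint (I u)).toL1 _ - (hint (I (w k))).toL1 _‖
      - ∫ x, comp ζ (u : Rn n → EReal) x| ≤ ζ k * V := by
    intro k
    have hd : Integrable fun x => |comp ζ (u : Rn n → EReal) x - comp ζ (w k) x| :=
      ((hint _).sub (hint _)).abs
    rw [hdiff, hI.integral_eq hζ hn, ← hw, ← integral_sub hd (hint _)]
    refine (abs_integral_le_integral_abs).trans ?_
    refine integral_mono (hd.sub (hint _)).abs (hint _) fun x => ?_
    have h1 := comp_nonneg hζ (u := (u : Rn n → EReal)) x
    have h2 := comp_nonneg hζ (u := (w k : Rn n → EReal)) x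
    simp only
    rcases abs_cases (comp ζ (u : Rn n → EReal) x - comp ζ (w k) x) with h | h <;>
      rw [h.1, abs_le] <;> constructor <;> linarith
  rw [tendsto_iff_dist_tendsto_zero]
  exact squeeze_zero (fun _ => dist_nonneg) hb hζ0

/-- The body `K` is the union of the two bodies `K₁` and `K₂`, which overlap in a null set. -/
structure Splits (K K₁ K₂ : Set (Rn n)) : Prop where
  body : IsBody K
  body_left : IsBody K₁
  body_right : IsBody K₂
  union : K₁ ∪ K₂ = K
  null : volume (K₁ ∩ K₂) = 0

theorem Splits.volume_eq (h : Splits K K₁ K₂) :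
    volume.real K = volume.real K₁ + volume.real K₂ := by
  rw [← h.union, measureReal_union₀' h.body_left.measurableSet.nullMeasurableSet h.null
    h.body_left.compact.measure_lt_top.ne h.body_right.compact.measure_lt_top.ne]

theorem integral_abs_sub_level {K L : Set (Rn n)} (hζ : IsMoment n ζ) (hn : 1 ≤ n)
    (hK : IsBody K) (hL : IsBody L) (hKL : K ⊆ L) (t : ℝ) :
    ∫ x, |comp ζ (hL.level t : Rn n → EReal) x - comp ζ (hK.level t) x|
      = ζ t * (volume.real L - volume.real K) := by
  have : ∀ x, |comp ζ (hL.level t : Rn n → EReal) x - comp ζ (hK.level t) x|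
      = comp ζ (hL.level t : Rn n → EReal) x - comp ζ (hK.level t) x := by
    intro x
    refine abs_of_nonneg (sub_nonneg.2 ?_)
    rw [comp_level, comp_level]
    exact indicator_le_indicator_of_subset hKL (fun _ => (hζ.pos t).le) x
  simp_rw [this]
  rw [integral_sub (integrable_comp_coe hζ hn _) (integrable_comp_coe hζ hn _),
    integral_comp_level, integral_comp_level]
  ring

theorem integral_abs_sub_level_of_null {K L : Set (Rn n)} (hζ : IsMoment n ζ) (hn : 1 ≤ n)
    (hK : IsBody K) (hL : IsBody L)
    (hKL : volume (K ∩ L) = 0) (s t : ℝ) :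
    ∫ x, |comp ζ (hK.level s : Rn n → EReal) x - comp ζ (hL.level t) x|
      = ζ s * volume.real K + ζ t * volume.real L := by
  rw [← integral_comp_level hK, ← integral_comp_level hL,
    ← integral_add (integrable_comp_coe hζ hn _) (integrable_comp_coe hζ hn _)]
  refine integral_congr_ae ?_
  filter_upwards [measure_eq_zero_iff_ae_notMem.1 hKL] with x hx
  rw [comp_level, comp_level]
  by_cases h1 : x ∈ K <;> by_cases h2 : x ∈ L <;>
    simp [h1, h2, abs_of_pos (hζ.pos _)]
  exact absurd ⟨h1, h2⟩ hx

/-- The differences of the three images with `G` satisfy the hypotheses of `ae_split_of_integral`: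
each integral is transported by `I` to an integral over bodies, where volume is additive. -/
theorem IsIsometry.ae_split (hI : IsIsometry ζ I) (hζ : IsMoment n ζ) (hn : 1 ≤ n)
    (hG : Integrable G) (hG2 : ∀ u : CVcn n, ∫ x, |comp ζ (I u : Rn n → EReal) x - G x|
        = ∫ x, comp ζ (u : Rn n → EReal) x) (h : Splits K K₁ K₂) (t : ℝ) :
    ∀ᵐ x, (comp ζ (I (h.body_left.level t) : Rn n → EReal) x = G x ∧
        comp ζ (I (h.body_right.level t) : Rn n → EReal) x
          = comp ζ (I (h.body.level t) : Rn n → EReal) x) ∨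
      (comp ζ (I (h.body_right.level t) : Rn n → EReal) x = G x ∧
        comp ζ (I (h.body_left.level t) : Rn n → EReal) x
          = comp ζ (I (h.body.level t) : Rn n → EReal) x) := by
  have hint := fun u => integrable_comp_coe hζ hn (I u)
  have key := ae_split_of_integral ((hint (h.body_left.level t)).sub hG)
    ((hint (h.body_right.level t)).sub hG) ((hint (h.body.level t)).sub hG)
    ?_ ?_ ?_ ?_
  · filter_upwards [key] with x hx
    simp only [Pi.sub_apply, sub_eq_zero, sub_left_inj] at hx
    exact hx
  all_goals simp only [Pi.sub_apply, sub_sub_sub_cancel_right, hG2, hI.integral_eq hζ hn,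
    integral_comp_level]
  · rw [h.volume_eq]; ring
  · rw [integral_abs_sub_level hζ hn _ _ (h.union ▸ subset_union_left), h.volume_eq]; ring
  · rw [integral_abs_sub_level hζ hn _ _ (h.union ▸ subset_union_right), h.volume_eq]; ring
  · exact integral_abs_sub_level_of_null hζ hn _ _ h.null t t

end
end ConvexIsometry

/-! ### Halving boxes, and the vanishing of the image of zero. -/

namespace ConvexIsometry
noncomputable section

variable {n : ℕ} {ζ : ℝ → ℝ} {u v : Rn n → EReal} {K K₁ K₂ : Set (Rn n)}
  {I : CVcn n → CVcn n} {G : Rn n → ℝ}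

/-- The closed coordinate box with corners `a` and `b`. -/
def box (a b : Fin n → ℝ) : Set (Rn n) := WithLp.ofLp ⁻¹' Icc a b

theorem volume_real_box {a b : Fin n → ℝ} (hab : a ≤ b) :
    volume.real (box a b) = ∏ i, (b i - a i) := by
  rw [measureReal_def, box, (PiLp.volume_preserving_ofLp (Fin n)).measure_preimage
    measurableSet_Icc.nullMeasurableSet, Real.volume_Icc_pi_toReal hab]

theorem isBody_box {a b : Fin n → ℝ} (hab : ∀ i, a i < b i) : IsBody (box a b) where
  convex := (convex_Icc a b).is_linear_preimage (EuclideanSpace.equiv (Fin n) ℝ).isLinear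
  compact := by
    have := (isCompact_Icc (a := a) (b := b)).image (EuclideanSpace.equiv (Fin n) ℝ).symm.continuous
    convert this using 1
    ext x
    constructor
    · intro hx; exact ⟨WithLp.ofLp x, hx, rfl⟩
    · rintro ⟨y, hy, rfl⟩; exact hy
  nonempty := by
    refine ⟨WithLp.toLp 2 fun i => (a i + b i) / 2, ?_⟩
    refine interior_maximal (s := box a b)
      (t := WithLp.ofLp ⁻¹' (pi univ fun i => Ioo (a i) (b i))) ?_
      ((isOpen_set_pi finite_univ fun i _ => isOpen_Ioo).preimage (PiLp.continuous_ofLp 2 _)) ?_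
    · intro x hx
      exact ⟨fun i => (hx i (mem_univ i)).1.le, fun i => (hx i (mem_univ i)).2.le⟩
    · intro i _
      have := hab i
      constructor <;> simp only <;> linarith

theorem splits_box {a b : Fin n → ℝ} (hab : ∀ i, a i < b i) (i : Fin n) :
    Splits (box a b) (box a (Function.update b i ((a i + b i) / 2)))
      (box (Function.update a i ((a i + b i) / 2)) b) := by
  set m := (a i + b i) / 2 with hm
  have hi := hab i
  have h1 : ∀ j, a j < Function.update b i m j := by
    intro j; by_cases hj : j = i
    · subst hj; simp only [Function.update_self]; linarith
    · rw [Function.update_of_ne hj]; exact hab j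
  have h2 : ∀ j, Function.update a i m j < b j := by
    intro j; by_cases hj : j = i
    · subst hj; simp only [Function.update_self]; linarith
    · rw [Function.update_of_ne hj]; exact hab j
  refine ⟨isBody_box hab, isBody_box h1, isBody_box h2, ?_, ?_⟩
  · ext x
    simp only [box, ← preimage_union, mem_preimage]
    generalize WithLp.ofLp x = y
    constructor
    · rintro (⟨p, q⟩ | ⟨p, q⟩)
      · refine ⟨p, fun j => (q j).trans ?_⟩
        by_cases hj : j = i
        · subst hj; simp only [Function.update_self]; linarith
        · rw [Function.update_of_ne hj]
      · refine ⟨fun j => le_trans ?_ (p j), q⟩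
        by_cases hj : j = i
        · subst hj; simp only [Function.update_self]; linarith
        · rw [Function.update_of_ne hj]
    · rintro ⟨p, q⟩
      rcases le_total (y i) m with h | h
      · exact Or.inl ⟨p, le_update_iff.2 ⟨h, fun j _ => q j⟩⟩
      · exact Or.inr ⟨update_le_iff.2 ⟨h, fun j _ => p j⟩, q⟩
  · have hsub : box a (Function.update b i m) ∩ box (Function.update a i m) b
        ⊆ box (Function.update a i m) (Function.update b i m) := fun x hx => ⟨hx.2.1, hx.1.2⟩
    refine measure_mono_null hsub ?_
    rw [box, (PiLp.volume_preserving_ofLp (Fin n)).measure_preimage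
      measurableSet_Icc.nullMeasurableSet, Real.volume_Icc_pi]
    exact Finset.prod_eq_zero (Finset.mem_univ i) (by simp)

theorem volume_real_half_box {a b : Fin n → ℝ} (hab : ∀ i, a i < b i) (i : Fin n) :
    volume.real (box a (Function.update b i ((a i + b i) / 2))) = volume.real (box a b) / 2 ∧
    volume.real (box (Function.update a i ((a i + b i) / 2)) b) = volume.real (box a b) / 2 := by
  have hi := hab i
  have hle : a ≤ b := fun j => (hab j).le
  have h1 : a ≤ Function.update b i ((a i + b i) / 2) :=
    le_update_iff.2 ⟨by linarith, fun j _ => hle j⟩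
  have h2 : Function.update a i ((a i + b i) / 2) ≤ b :=
    update_le_iff.2 ⟨by linarith, fun j _ => hle j⟩
  rw [volume_real_box h1, volume_real_box h2, volume_real_box hle]
  have e1 := Fintype.prod_eq_mul_prod_compl i
    fun j => (Function.update b i ((a i + b i) / 2) j - a j)
  have e2 := Fintype.prod_eq_mul_prod_compl i
    fun j => (b j - Function.update a i ((a i + b i) / 2) j)
  have e3 := Fintype.prod_eq_mul_prod_compl i fun j => (b j - a j)
  have c1 : ∏ j ∈ ({i} : Finset (Fin n))ᶜ, (Function.update b i ((a i + b i) / 2) j - a j)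
      = ∏ j ∈ ({i} : Finset (Fin n))ᶜ, (b j - a j) := by
    refine Finset.prod_congr rfl fun j hj => ?_
    rw [Function.update_of_ne (by simpa using hj)]
  have c2 : ∏ j ∈ ({i} : Finset (Fin n))ᶜ, (b j - Function.update a i ((a i + b i) / 2) j)
      = ∏ j ∈ ({i} : Finset (Fin n))ᶜ, (b j - a j) := by
    refine Finset.prod_congr rfl fun j hj => ?_
    rw [Function.update_of_ne (by simpa using hj)]
  rw [e1, e2, e3, c1, c2]
  simp only [Function.update_self]
  constructor <;> ring

/-- A property of bodies inherited by one of the two parts of each split holds for small boxes if it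
holds for some box. -/
theorem exists_small_box (hn : 1 ≤ n) {P : ∀ K : Set (Rn n), IsBody K → Prop}
    (hP : ∀ K K₁ K₂ : Set (Rn n), ∀ h : Splits K K₁ K₂, P K h.body →
      P K₁ h.body_left ∨ P K₂ h.body_right)
    {a b : Fin n → ℝ} (hab : ∀ i, a i < b i) (h0 : P (box a b) (isBody_box hab)) {ε : ℝ}
    (hε : 0 < ε) : ∃ (a' b' : Fin n → ℝ) (hab' : ∀ i, a' i < b' i),
      P (box a' b') (isBody_box hab') ∧ volume.real (box a' b') < ε := by
  have step : ∀ k : ℕ, ∃ (a' b' : Fin n → ℝ) (hab' : ∀ i, a' i < b' i),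
      P (box a' b') (isBody_box hab') ∧
      volume.real (box a' b') = volume.real (box a b) / 2 ^ k := by
    intro k
    induction k with
    | zero => exact ⟨a, b, hab, h0, by simp⟩
    | succ k ih =>
      obtain ⟨a', b', hab', hp, hv⟩ := ih
      let i : Fin n := ⟨0, hn⟩
      have hs := splits_box hab' i
      have hv2 := volume_real_half_box hab' i
      have hi := hab' i
      rcases hP _ _ _ hs hp with h | h
      · refine ⟨_, _, ?_, h, ?_⟩
        · intro j; by_cases hj : j = i
          · subst hj; simp only [Function.update_self]; linarith
          · rw [Function.update_of_ne hj]; exact hab' j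
        · rw [hv2.1, hv, pow_succ]; field_simp
      · refine ⟨_, _, ?_, h, ?_⟩
        · intro j; by_cases hj : j = i
          · subst hj; simp only [Function.update_self]; linarith
          · rw [Function.update_of_ne hj]; exact hab' j
        · rw [hv2.2, hv, pow_succ]; field_simp
  have hlim : Tendsto (fun k : ℕ => volume.real (box a b) / 2 ^ k) atTop (𝓝 0) := by
    have := (tendsto_pow_atTop_nhds_zero_of_lt_one (r := (1 / 2 : ℝ)) (by norm_num)
      (by norm_num)).const_mul (volume.real (box a b))
    simpa [div_eq_mul_inv] using this
  obtain ⟨k, hk⟩ := (hlim.eventually (gt_mem_nhds hε)).exists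
  obtain ⟨a', b', hab', hp, hv⟩ := step k
  exact ⟨a', b', hab', hp, hv ▸ hk⟩

/-- Convexity bounds `u` along the segment by linear interpolation. This gives one-sided control at
boundary points of the domain, where `ζ ∘ u` need not be continuous. -/
theorem IsCVcn.eventually_lt_comp (hζ : IsMoment n ζ) (hu : IsCVcn u) {p b : Rn n} {s : ℝ}
    (hp : p ∈ dom u) (hb : b ∈ dom u) (hs : s < comp ζ u p) :
    ∀ᶠ ε : ℝ in 𝓝[>] 0, s < comp ζ u ((1 - ε) • p + ε • b) := by
  rw [comp_of_mem hp] at hs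
  have hc : Continuous fun ε : ℝ => ζ ((1 - ε) * (u p).toReal + ε * (u b).toReal) :=
    hζ.continuous.comp (by fun_prop)
  have h1 : ∀ᶠ ε : ℝ in 𝓝 0, s < ζ ((1 - ε) * (u p).toReal + ε * (u b).toReal) :=
    hc.continuousAt.eventually (lt_mem_nhds (by simpa using hs))
  filter_upwards [h1.filter_mono nhdsWithin_le_nhds, self_mem_nhdsWithin,
    nhdsWithin_le_nhds (gt_mem_nhds (zero_lt_one' ℝ))] with ε h2 h3 h4
  have h3 : 0 < ε := h3
  have h4 : ε < 1 := h4
  have hd := hu.convex_dom hp hb (show 0 ≤ 1 - ε by linarith) h3.le (by ring)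
  rw [comp_of_mem hd]
  refine h2.trans_le (hζ.strictAnti.antitone ?_)
  exact hu.convexOn.2 hp hb (show 0 ≤ 1 - ε by linarith) h3.le (by ring)

/-- If the superlevel sets of two functions meet inside an open set, and their domains have a common
interior point, then both functions are large on a nonempty open subset. -/
theorem exists_open_of_mem_superlevel (hζ : IsMoment n ζ) (hu : IsCVcn u) (hv : IsCVcn v)
    {B : Set (Rn n)} (hB : IsOpen B) {s s₁ : ℝ} (hs₁ : 0 ≤ s₁) (hs : s₁ < s) {p : Rn n}
    (hpB : p ∈ B)
    (hpu : s ≤ comp ζ u p) (hpv : s ≤ comp ζ v p) (hc : (core u ∩ core v).Nonempty) :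
    ∃ N, IsOpen N ∧ N.Nonempty ∧ N ⊆ B ∧ ∀ x ∈ N, s₁ < comp ζ u x ∧ s₁ < comp ζ v x := by
  obtain ⟨b, hbu, hbv⟩ := hc
  have hpdu : p ∈ dom u := (comp_pos_iff hζ).1 (by linarith)
  have hpdv : p ∈ dom v := (comp_pos_iff hζ).1 (by linarith)
  have hcont : Continuous fun ε : ℝ => (1 - ε) • p + ε • b := by fun_prop
  have hBe : ∀ᶠ ε : ℝ in 𝓝 0, (1 - ε) • p + ε • b ∈ B :=
    hcont.continuousAt.eventually (hB.mem_nhds (by simpa using hpB))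
  have hIoo : ∀ᶠ ε : ℝ in 𝓝[>] 0, ε ∈ Ioo (0 : ℝ) 1 := Ioo_mem_nhdsGT zero_lt_one
  obtain ⟨ε, h1, h2, h3, h4, h5⟩ := ((hu.eventually_lt_comp hζ hpdu (core_subset_dom hbu)
    (hs.trans_le hpu)).and ((hv.eventually_lt_comp hζ hpdv (core_subset_dom hbv)
    (hs.trans_le hpv)).and ((hBe.filter_mono nhdsWithin_le_nhds).and
    hIoo))).exists
  have qu := hu.combo_mem_core (subset_closure hpdu) hbu h4 h5.le
  have qv := hv.combo_mem_core (subset_closure hpdv) hbv h4 h5.le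
  set q := (1 - ε) • p + ε • b
  have hN : {x | x ∈ B ∧ s₁ < comp ζ u x ∧ s₁ < comp ζ v x} ∈ 𝓝 q :=
    Eventually.and (hB.mem_nhds h3)
      (((hu.continuousAt_comp hζ qu).eventually (lt_mem_nhds h1)).and
      ((hv.continuousAt_comp hζ qv).eventually (lt_mem_nhds h2)))
  obtain ⟨N, hN1, hN2, hN3⟩ := mem_nhds_iff.1 hN
  exact ⟨N, hN2, ⟨q, hN3⟩, fun x hx => (hN1 hx).1, fun x hx => (hN1 hx).2⟩

/-- Boundaries of convex domains are null and cores are open, so almost everywhere disjointness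
becomes genuine disjointness. -/
theorem core_disjoint_iff_ae (hζ : IsMoment n ζ) (hu : IsCVcn u) (hv : IsCVcn v) :
    Disjoint (core u) (core v) ↔ ∀ᵐ x, comp ζ u x = 0 ∨ comp ζ v x = 0 := by
  constructor
  · intro hd
    filter_upwards [hu.ae_mem_core_or, hv.ae_mem_core_or] with x h1 h2
    by_contra! h
    have hxu : x ∈ dom u := (comp_pos_iff hζ).1 (lt_of_le_of_ne (comp_nonneg hζ x) h.1.symm)
    have hxv : x ∈ dom v := (comp_pos_iff hζ).1 (lt_of_le_of_ne (comp_nonneg hζ x) h.2.symm)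
    exact disjoint_left.1 hd (h1.resolve_right fun h => h (subset_closure hxu))
      (h2.resolve_right fun h => h (subset_closure hxv))
  · intro h
    by_contra hd
    rw [not_disjoint_iff_nonempty_inter] at hd
    refine ((isOpen_core.inter isOpen_core).measure_pos volume hd).ne' ?_
    refine measure_mono_null ?_ (ae_iff.1 h)
    rintro x ⟨h1, h2⟩ (h | h)
    · exact ((comp_pos_iff hζ).2 (core_subset_dom h1)).ne' h
    · exact ((comp_pos_iff hζ).2 (core_subset_dom h2)).ne h.symm

/-- The extension of the isometry to the closure in `L¹` fixes the zero function. -/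
theorem IsIsometry.image_zero (hI : IsIsometry ζ I) (hζ : IsMoment n ζ) (hn : 1 ≤ n)
    (hG : Integrable G) (hG2 : ∀ u : CVcn n, ∫ x, |comp ζ (I u : Rn n → EReal) x - G x|
        = ∫ x, comp ζ (u : Rn n → EReal) x) : ∀ᵐ x, G x = 0 := by
  set f : ∀ K : Set (Rn n), IsBody K → Rn n → ℝ := fun K hK => comp ζ (I (hK.level 0)) with hf
  have hint : ∀ K (hK : IsBody K), Integrable (f K hK) := fun K hK => integrable_comp_coe hζ hn _
  have hnorm : ∀ K (hK : IsBody K), ∫ x, |f K hK x - G x| = ζ 0 * volume.real K := fun K hK => by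
    rw [hf, hG2, integral_comp_level]
  have hnn : ∀ K (hK : IsBody K) x, 0 ≤ f K hK x := fun K hK x => comp_nonneg hζ x
  have hsplit : ∀ K K₁ K₂ (h : Splits K K₁ K₂), ∀ᵐ x,
      (f K₁ h.body_left x = G x ∧ f K₂ h.body_right x = f K h.body x) ∨
      (f K₂ h.body_right x = G x ∧ f K₁ h.body_left x = f K h.body x) :=
    fun K K₁ K₂ h => hI.ae_split hζ hn hG hG2 h 0
  -- At almost every point `G` agrees with the image of one half of any split.
  have hG0 : ∀ᵐ x, 0 ≤ G x := by
    have hab : ∀ i : Fin n, (fun _ => (0 : ℝ)) i < (fun _ => (1 : ℝ)) i := fun _ => one_pos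
    filter_upwards [hsplit _ _ _ (splits_box hab ⟨0, hn⟩)] with x hx
    rcases hx with hx | hx <;> rw [← hx.1] <;> exact hnn _ _ x
  by_contra hne
  have hGint : 0 < ∫ x, G x := by
    refine lt_of_le_of_ne (integral_nonneg_of_ae hG0) fun h => hne ?_
    exact (integral_eq_zero_iff_of_nonneg_ae hG0 hG).1 h.symm
  have hζ0 := hζ.pos 0
  -- A large box whose image exceeds `G` somewhere.
  obtain ⟨R, hRp, hR⟩ : ∃ R : ℝ, 1 ≤ R ∧ ∫ x, G x < ζ 0 * R := by
    refine ⟨max 1 ((∫ x, G x) / ζ 0 + 1), le_max_left _ _, ?_⟩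
    rw [← div_lt_iff₀' hζ0]
    exact (lt_add_one _).trans_le (le_max_right _ _)
  have hab : ∀ i : Fin n, (fun _ => (0 : ℝ)) i < (fun _ => R) i := fun _ => by
    simp only; linarith
  have hvol : R ≤ volume.real (box (fun _ : Fin n => (0 : ℝ)) fun _ => R) := by
    rw [volume_real_box fun i => (hab i).le]
    simp only [sub_zero, Finset.prod_const, Finset.card_univ, Fintype.card_fin]
    exact le_self_pow₀ hRp (by omega)
  -- If the image `f` were at most `G`, then `|f - G| ≤ G`, whereas the integral of `|f - G|` is at
  -- least `ζ 0 * R`, which exceeds that of `G`.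
  have hbig : ¬ ∀ᵐ x, f _ (isBody_box hab) x ≤ G x := by
    intro h
    have h1 := hnorm _ (isBody_box hab)
    have h2 : ∫ x, |f _ (isBody_box hab) x - G x| ≤ ∫ x, G x := by
      refine integral_mono_ae ((hint _ _).sub hG).abs hG ?_
      filter_upwards [h] with x hx
      have := hnn _ (isBody_box hab) x
      rw [abs_of_nonpos (by linarith)]; linarith
    have h3 := mul_le_mul_of_nonneg_left hvol hζ0.le
    linarith
  -- A small box with the same property.
  obtain ⟨a, b, hab, hK, hKv⟩ := exists_small_box hn
    (P := fun K hK => ¬ ∀ᵐ x, f K hK x ≤ G x) (by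
      intro K K₁ K₂ h hK
      by_contra! hcon
      refine hK ?_
      filter_upwards [hcon.1, hcon.2, hsplit _ _ _ h] with x h1 h2 h3
      rcases h3 with h3 | h3
      · rw [← h3.2]; exact h2
      · rw [← h3.2]; exact h1) hab hbig (show 0 < (∫ x, G x) / ζ 0 by positivity)
  rw [lt_div_iff₀' hζ0] at hKv
  have hs := splits_box hab ⟨0, hn⟩
  set K := box a b
  set K₁ := box a (Function.update b ⟨0, hn⟩ ((a ⟨0, hn⟩ + b ⟨0, hn⟩) / 2))
  set K₂ := box (Function.update a ⟨0, hn⟩ ((a ⟨0, hn⟩ + b ⟨0, hn⟩) / 2)) b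
  -- Either alternative of the split gives `G = f₁ + f₂ - f`. At a point where the right side is
  -- continuous, the strict inequality `G < f` spreads with a gap to a ball.
  obtain ⟨x, hx1, hx2, hx3, hx4, hx5, hx6⟩ : ∃ x, G x < f K hs.body x ∧ 0 ≤ G x ∧
      G x = f K₁ hs.body_left x + f K₂ hs.body_right x - f K hs.body x ∧
      ContinuousAt (f K hs.body) x ∧ ContinuousAt (f K₁ hs.body_left) x ∧
      ContinuousAt (f K₂ hs.body_right) x := by
    by_contra! hcon
    refine hK ?_
    filter_upwards [hG0, hsplit _ _ _ hs, IsCVcn.ae_continuousAt_comp hζ (I (hs.body.level 0)).2,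
      IsCVcn.ae_continuousAt_comp hζ (I (hs.body_left.level 0)).2,
      IsCVcn.ae_continuousAt_comp hζ (I (hs.body_right.level 0)).2] with x h1 h2 h3 h4 h5
    by_contra! hlt
    refine hcon x hlt h1 ?_ h3 h4 h5
    rcases h2 with h2 | h2 <;> linarith [h2.1, h2.2]
  obtain ⟨s₁, hs1, hs2⟩ := exists_between hx1
  obtain ⟨s, hs3, hs4⟩ := exists_between hs2
  have hev : ∀ᶠ y in 𝓝 x, s < f K hs.body y ∧
      f K₁ hs.body_left y + f K₂ hs.body_right y - f K hs.body y < s₁ :=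
    (hx4.eventually (lt_mem_nhds hs4)).and
      (((hx5.add hx6).sub hx4).eventually (gt_mem_nhds (by simpa [← hx3] using hs1)))
  obtain ⟨r, hr, hball⟩ := Metric.eventually_nhds_iff_ball.1 hev
  set B := Metric.ball x r
  have hGB : ∀ᵐ y, y ∈ B → G y < s₁ := by
    filter_upwards [hsplit _ _ _ hs] with y hy hyB
    have h1 := (hball y hyB).2
    rcases hy with h2 | h2 <;> linarith [h2.1, h2.2]
  have hBpre : IsPreconnected B := (convex_ball x r).isPreconnected
  have hs1' : 0 ≤ s₁ := by linarith
  have hBv : 0 < volume.real B := by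
    rw [measureReal_def, ENNReal.toReal_pos_iff]
    exact ⟨Metric.measure_ball_pos volume x hr, measure_ball_lt_top⟩
  -- The image of one half of a box is large on the whole of `B` if that of the box is.
  obtain ⟨a', b', hab', hK', hKv'⟩ := exists_small_box hn
    (P := fun K hK => ζ 0 * volume.real K < ∫ x, G x ∧ ∀ y ∈ B, s ≤ f K hK y) (by
      rintro K K₁ K₂ h ⟨hv, hKB⟩
      have hv1 : ζ 0 * volume.real K₁ ≤ ζ 0 * volume.real K := by
        rw [h.volume_eq]; have := h.body_right.volume_pos; nlinarith
      have hv2 : ζ 0 * volume.real K₂ ≤ ζ 0 * volume.real K := by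
        rw [h.volume_eq]; have := h.body_left.volume_pos; nlinarith
      have hc1 : IsClosed {y | s ≤ f K₁ h.body_left y} :=
        IsCVcn.isClosed_superlevel hζ (I (h.body_left.level 0)).2
      have hc2 : IsClosed {y | s ≤ f K₂ h.body_right y} :=
        IsCVcn.isClosed_superlevel hζ (I (h.body_right.level 0)).2
      have hcover : B ⊆ {y | s ≤ f K₁ h.body_left y} ∪ {y | s ≤ f K₂ h.body_right y} := by
        by_contra hcon
        obtain ⟨y, hyB, hy⟩ := not_subset.1 hcon
        have hO : IsOpen (B ∩ ({y | s ≤ f K₁ h.body_left y} ∪ {y | s ≤ f K₂ h.body_right y})ᶜ) :=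
          Metric.isOpen_ball.inter (hc1.union hc2).isOpen_compl
        refine (hO.measure_pos volume ⟨y, hyB, hy⟩).ne' ?_
        refine measure_mono_null ?_ (ae_iff.1 (hsplit _ _ _ h))
        rintro z ⟨hzB, hz⟩ hz2
        have h3 := hKB z hzB
        simp only [mem_compl_iff, mem_union, mem_ofPred_eq, not_or, not_le] at hz
        rcases hz2 with hz2 | hz2 <;> linarith [hz2.2, hz.1, hz.2]
      by_cases hn1 : (B ∩ {y | s ≤ f K₁ h.body_left y}).Nonempty
      swap
      · right
        refine ⟨by linarith, fun y hy => (hcover hy).resolve_left fun h => hn1 ⟨y, hy, h⟩⟩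
      by_cases hn2 : (B ∩ {y | s ≤ f K₂ h.body_right y}).Nonempty
      swap
      · left
        refine ⟨by linarith, fun y hy => (hcover hy).resolve_right fun h => hn2 ⟨y, hy, h⟩⟩
      exfalso
      -- The two closed superlevel sets cover the connected ball `B`; if both meet it, they meet
      -- each other in it.
      obtain ⟨p, hpB, hp1, hp2⟩ := isPreconnected_closed_iff.1 hBpre _ _ hc1 hc2 hcover hn1 hn2
      have hcore : (core (I (h.body_left.level 0) : Rn n → EReal) ∩
          core (I (h.body_right.level 0))).Nonempty := by
        rw [← not_disjoint_iff_nonempty_inter,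
          core_disjoint_iff_ae hζ (I (h.body_left.level 0)).2 (I (h.body_right.level 0)).2]
        -- Were the two images disjoint, `G` would be bounded by the sum of their distances to `G`,
        -- of integral `ζ 0 * volume K`, which is less than the integral of `G`.
        intro hd
        have h1 : ∫ x, G x ≤ ∫ x, (|f K₁ h.body_left x - G x| + |f K₂ h.body_right x - G x|) := by
          refine integral_mono_ae hG (((hint _ _).sub hG).abs.add ((hint _ _).sub hG).abs) ?_
          filter_upwards [hd, hG0] with z hz hz0
          rcases hz with hz | hz
          · have hz : f K₁ h.body_left z = 0 := hz
            simp only [hz, zero_sub, abs_neg, abs_of_nonneg hz0]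
            have := abs_nonneg (f K₂ h.body_right z - G z)
            linarith
          · have hz : f K₂ h.body_right z = 0 := hz
            simp only [hz, zero_sub, abs_neg, abs_of_nonneg hz0]
            have := abs_nonneg (f K₁ h.body_left z - G z)
            linarith
        have i1 : Integrable fun x => |f K₁ h.body_left x - G x| := ((hint _ _).sub hG).abs
        have i2 : Integrable fun x => |f K₂ h.body_right x - G x| := ((hint _ _).sub hG).abs
        rw [integral_add i1 i2, hnorm, hnorm, ← mul_add, ← h.volume_eq] at h1
        linarith
      obtain ⟨N, hN, hNne, hNB, hNs⟩ := exists_open_of_mem_superlevel hζ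
        (I (h.body_left.level 0)).2 (I (h.body_right.level 0)).2 Metric.isOpen_ball hs1' hs3 hpB
        hp1 hp2 hcore
      -- On `N` both images exceed `s₁`, but almost everywhere one of them equals `G < s₁`.
      refine (hN.measure_pos volume hNne).ne' ?_
      refine measure_mono_null ?_ (ae_iff.1 (hGB.and (hsplit _ _ _ h)))
      rintro z hz ⟨hz1, hz2⟩
      have h1 := hz1 (hNB hz)
      have h2 : s₁ < f K₁ h.body_left z ∧ s₁ < f K₂ h.body_right z := hNs z hz
      rcases hz2 with hz2 | hz2 <;> linarith [hz2.1, h2.1, h2.2])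
    hab ⟨hKv, fun y hy => (hball y hy).1.le⟩
    (show 0 < (s - s₁) * volume.real B / ζ 0 from
      div_pos (mul_pos (by linarith) hBv) hζ0)
  rw [lt_div_iff₀' hζ0, ← hnorm _ (isBody_box hab')] at hKv'
  -- The gap `s - s₁` persists on all of `B` although the volume of the box, hence the distance of
  -- its image to `G`, is arbitrarily small.
  refine absurd hKv' (not_lt.2 ?_)
  calc (s - s₁) * volume.real B = ∫ _ in B, (s - s₁) := by
        rw [setIntegral_const, smul_eq_mul, mul_comm]
    _ ≤ ∫ x in B, |f _ (isBody_box hab') x - G x| := by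
        refine setIntegral_mono_on_ae (integrableOn_const measure_ball_lt_top.ne)
          ((hint _ _).sub hG).abs.integrableOn Metric.isOpen_ball.measurableSet ?_
        filter_upwards [hGB] with y hy hyB
        refine le_trans ?_ (le_abs_self _)
        have := hK'.2 y hyB; have := hy hyB
        linarith
    _ ≤ ∫ x, |f _ (isBody_box hab') x - G x| :=
        setIntegral_le_integral ((hint _ _).sub hG).abs (Eventually.of_forall fun _ => abs_nonneg _)

end
end ConvexIsometry

/-! ### Preservation of integrals, order and disjointness; coverings by balls. -/

namespace ConvexIsometry
noncomputable section

variable {n : ℕ} {ζ : ℝ → ℝ} {u v : Rn n → EReal} {K L : Set (Rn n)}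
  {I : CVcn n → CVcn n} {t s : ℝ} {x y : Rn n}

/-- An isometry for the distance of a function in the moment class, in positive dimension. -/
structure Setting (n : ℕ) (ζ : ℝ → ℝ) (I : CVcn n → CVcn n) : Prop where
  moment : IsMoment n ζ
  one_le : 1 ≤ n
  isometry : IsIsometry ζ I

theorem exists_of_ae_of_eventually {p q : Rn n → Prop} (hp : ∀ᵐ x, p x) (hq : ∀ᶠ x in 𝓝 y, q x) :
    ∃ x, p x ∧ q x := by
  by_contra! h
  have h0 : volume {x | q x} = 0 :=
    measure_mono_null (fun x hx hpx => h x hpx hx) (ae_iff.1 hp)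
  exact (Measure.measure_pos_of_mem_nhds volume hq).ne h0.symm

/-- The interior of the domain of the image of the function that equals `t` on the body `K`. -/
def reg (I : CVcn n → CVcn n) (t : ℝ) (hK : IsBody K) : Set (Rn n) :=
  core (I (hK.level t) : Rn n → EReal)

/-- The composition of `ζ` with the image of the function that equals `t` on the body `K`. -/
def img (ζ : ℝ → ℝ) (I : CVcn n → CVcn n) (t : ℝ) (hK : IsBody K) : Rn n → ℝ :=
  comp ζ (I (hK.level t) : Rn n → EReal)

theorem isOpen_reg (hK : IsBody K) : IsOpen (reg I t hK) := isOpen_core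

theorem convex_reg (hK : IsBody K) : Convex ℝ (reg I t hK) := IsCVcn.convex_core (I _).2

theorem reg_nonempty (hK : IsBody K) : (reg I t hK).Nonempty := IsCVcn.core_nonempty (I _).2

namespace Setting

theorem integrable (H : Setting n ζ I) (u : CVcn n) : Integrable (comp ζ (u : Rn n → EReal)) :=
  integrable_comp_coe H.moment H.one_le u

theorem integral_comp (H : Setting n ζ I) (u : CVcn n) :
    ∫ x, comp ζ (I u : Rn n → EReal) x = ∫ x, comp ζ (u : Rn n → EReal) x := by
  obtain ⟨G, hG, hG2⟩ := H.isometry.exists_image_zero H.moment H.one_le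
  have h0 := H.isometry.image_zero H.moment H.one_le hG hG2
  rw [← hG2 u]
  refine integral_congr_ae ?_
  filter_upwards [h0] with x hx
  rw [hx, sub_zero, abs_of_nonneg (comp_nonneg H.moment x)]

/-- Since `min a b = (a + b - |a - b|) / 2`, it is enough that `I` preserves integrals and
distances. -/
theorem integral_min (H : Setting n ζ I) (u v : CVcn n) :
    ∫ x, min (comp ζ (I u : Rn n → EReal) x) (comp ζ (I v : Rn n → EReal) x)
      = ∫ x, min (comp ζ (u : Rn n → EReal) x) (comp ζ (v : Rn n → EReal) x) := by
  have key : ∀ u v : CVcn n, ∫ x, min (comp ζ (u : Rn n → EReal) x) (comp ζ (v : Rn n → EReal) x)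
      = ((∫ x, comp ζ (u : Rn n → EReal) x) + (∫ x, comp ζ (v : Rn n → EReal) x)
        - ∫ x, |comp ζ (u : Rn n → EReal) x - comp ζ (v : Rn n → EReal) x|) / 2 := by
    intro u v
    have h1 : Integrable fun x => comp ζ (u : Rn n → EReal) x + comp ζ (v : Rn n → EReal) x :=
      (H.integrable u).add (H.integrable v)
    have h2 : Integrable fun x => |comp ζ (u : Rn n → EReal) x - comp ζ (v : Rn n → EReal) x| :=
      ((H.integrable u).sub (H.integrable v)).abs
    rw [← integral_add (H.integrable u) (H.integrable v), ← integral_sub h1 h2, ← integral_div]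
    refine integral_congr_ae (Eventually.of_forall fun x => ?_)
    simp only
    rcases le_total (comp ζ (u : Rn n → EReal) x) (comp ζ (v : Rn n → EReal) x) with h | h
    · rw [min_eq_left h, abs_of_nonpos (by linarith)]; ring
    · rw [min_eq_right h, abs_of_nonneg (by linarith)]; ring
  rw [key, key, H.integral_comp, H.integral_comp, H.isometry.integral_eq H.moment H.one_le]

theorem integrable_min (H : Setting n ζ I) (u v : CVcn n) :
    Integrable fun x => min (comp ζ (u : Rn n → EReal) x) (comp ζ (v : Rn n → EReal) x) :=
  (H.integrable u).inf (H.integrable v)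

/-- Isometries preserve the order. -/
theorem ae_le (H : Setting n ζ I) {u v : CVcn n}
    (h : ∀ᵐ x, comp ζ (u : Rn n → EReal) x ≤ comp ζ (v : Rn n → EReal) x) :
    ∀ᵐ x, comp ζ (I u : Rn n → EReal) x ≤ comp ζ (I v : Rn n → EReal) x := by
  have h1 := ae_eq_of_le_of_integral_eq (H.integrable_min (I u) (I v)) (H.integrable (I u))
    (Eventually.of_forall fun x => min_le_left _ _) (by
      rw [H.integral_min, H.integral_comp]
      refine le_of_eq (integral_congr_ae ?_)
      filter_upwards [h] with x hx
      rw [min_eq_left hx])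
  filter_upwards [h1] with x hx
  exact min_eq_left_iff.1 hx

theorem ae_le_of_le (H : Setting n ζ I) {u v : CVcn n}
    (h : ∀ x, (v : Rn n → EReal) x ≤ (u : Rn n → EReal) x) :
    ∀ᵐ x, comp ζ (I u : Rn n → EReal) x ≤ comp ζ (I v : Rn n → EReal) x :=
  H.ae_le (Eventually.of_forall fun x => comp_le_of_le H.moment u.2 v.2 (h x))

/-- Isometries preserve disjointness of supports. -/
theorem ae_disjoint (H : Setting n ζ I) {u v : CVcn n}
    (h : ∀ᵐ x, comp ζ (u : Rn n → EReal) x = 0 ∨ comp ζ (v : Rn n → EReal) x = 0) :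
    ∀ᵐ x, comp ζ (I u : Rn n → EReal) x = 0 ∨ comp ζ (I v : Rn n → EReal) x = 0 := by
  have h0 : ∀ (u v : CVcn n) x,
      0 ≤ min (comp ζ (u : Rn n → EReal) x) (comp ζ (v : Rn n → EReal) x) :=
    fun u v x => le_min (comp_nonneg H.moment x) (comp_nonneg H.moment x)
  have h1 : ∫ x, min (comp ζ (I u : Rn n → EReal) x) (comp ζ (I v : Rn n → EReal) x) = 0 := by
    rw [H.integral_min]
    refine integral_eq_zero_of_ae ?_
    filter_upwards [h] with x hx
    rcases hx with hx | hx <;> rw [hx]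
    · exact min_eq_left (comp_nonneg H.moment x)
    · exact min_eq_right (comp_nonneg H.moment x)
  rw [integral_eq_zero_iff_of_nonneg (h0 _ _) (H.integrable_min _ _)] at h1
  filter_upwards [h1] with x hx
  rcases min_choice (comp ζ (I u : Rn n → EReal) x) (comp ζ (I v : Rn n → EReal) x) with h | h
  · exact Or.inl (h ▸ hx)
  · exact Or.inr (h ▸ hx)

theorem img_nonneg (H : Setting n ζ I) (hK : IsBody K) (y : Rn n) : 0 ≤ img ζ I t hK y :=
  comp_nonneg H.moment y

theorem img_pos (H : Setting n ζ I) (hK : IsBody K) (hy : y ∈ reg I t hK) : 0 < img ζ I t hK y :=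
  (comp_pos_iff H.moment).2 (core_subset_dom hy)

theorem integrable_img (H : Setting n ζ I) (hK : IsBody K) : Integrable (img ζ I t hK) :=
  H.integrable _

theorem integral_img (H : Setting n ζ I) (hK : IsBody K) :
    ∫ y, img ζ I t hK y = ζ t * volume.real K := by
  rw [img, H.integral_comp, integral_comp_level]

theorem lintegral_img (H : Setting n ζ I) (hK : IsBody K) :
    ∫⁻ y, ENNReal.ofReal (img ζ I t hK y) = ENNReal.ofReal (ζ t) * volume K := by
  rw [← ofReal_integral_eq_lintegral_ofReal (H.integrable_img hK)
    (Eventually.of_forall (H.img_nonneg hK)), H.integral_img,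
    ENNReal.ofReal_mul (H.moment.pos t).le, ofReal_measureReal hK.compact.measure_lt_top.ne]

theorem ae_mem_reg (H : Setting n ζ I) (hK : IsBody K) :
    ∀ᵐ y, 0 < img ζ I t hK y → y ∈ reg I t hK := by
  filter_upwards [IsCVcn.ae_mem_core_or (I (hK.level t)).2] with y hy hpos
  exact hy.resolve_right fun h => h (subset_closure ((comp_pos_iff H.moment).1 hpos))

theorem img_le (H : Setting n ζ I) (hK : IsBody K) (hL : IsBody L) (hKL : K ⊆ L) (hst : s ≤ t) :
    ∀ᵐ y, img ζ I t hK y ≤ img ζ I s hL y := by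
  refine H.ae_le_of_le fun x => ?_
  by_cases hx : x ∈ K
  · simp only [IsBody.level, bodyFun_of_mem hx, bodyFun_of_mem (hKL hx)]
    exact_mod_cast hst
  · simp [IsBody.level, bodyFun_of_not_mem hx]

theorem subset_reg (H : Setting n ζ I) (hK : IsBody K) {O : Set (Rn n)} (hO : IsOpen O)
    (h : ∀ᵐ y, y ∈ O → 0 < img ζ I t hK y) : O ⊆ reg I t hK :=
  IsCVcn.subset_core_of_ae (I _).2 hO (h.mono fun _ hy hyO => (comp_pos_iff H.moment).1 (hy hyO))

theorem reg_mono (H : Setting n ζ I) (hK : IsBody K) (hL : IsBody L) (hKL : K ⊆ L) (hst : s ≤ t) :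
    reg I t hK ⊆ reg I s hL := by
  refine H.subset_reg hL (isOpen_reg hK) ?_
  filter_upwards [H.img_le hK hL hKL hst] with y hy hyK
  exact (H.img_pos hK hyK).trans_le hy

theorem img_disjoint (H : Setting n ζ I) (hK : IsBody K) (hL : IsBody L)
    (hKL : volume (K ∩ L) = 0) : ∀ᵐ y, img ζ I s hK y = 0 ∨ img ζ I t hL y = 0 := by
  refine H.ae_disjoint ?_
  filter_upwards [measure_eq_zero_iff_ae_notMem.1 hKL] with x hx
  rw [comp_level, comp_level]
  by_cases h1 : x ∈ K
  · right; exact indicator_of_notMem (fun h => hx ⟨h1, h⟩) _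
  · left; exact indicator_of_notMem h1 _

theorem reg_disjoint (H : Setting n ζ I) (hK : IsBody K) (hL : IsBody L)
    (hKL : volume (K ∩ L) = 0) : Disjoint (reg I s hK) (reg I t hL) :=
  (core_disjoint_iff_ae H.moment (I _).2 (I _).2).2 (H.img_disjoint hK hL hKL)

theorem img_split (H : Setting n ζ I) {K₁ K₂ : Set (Rn n)} (h : Splits K K₁ K₂) :
    ∀ᵐ y, (img ζ I t h.body_left y = 0 ∧ img ζ I t h.body_right y = img ζ I t h.body y) ∨
      (img ζ I t h.body_right y = 0 ∧ img ζ I t h.body_left y = img ζ I t h.body y) := by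
  refine H.isometry.ae_split H.moment H.one_le (G := fun _ => 0) (integrable_zero _ _ _)
    (fun u => ?_) h t
  simp only [sub_zero]
  rw [← H.integral_comp]
  exact integral_congr_ae (Eventually.of_forall fun x => abs_of_nonneg (comp_nonneg H.moment x))

/-- A property that holds almost everywhere on the images of all small balls in a conull part of
a body holds almost everywhere on the image of the body. -/
theorem ae_of_cover (H : Setting n ζ I) (hL : IsBody L) {O : Set (Rn n)} (hO : O ⊆ interior L)
    (hOL : volume (L \ O) = 0) {good : Set (Rn n) → Prop}
    (hgood : ∀ x ∈ O, ∃ S ∈ 𝓝 x, ∀ C ⊆ S, good C) {Q : Rn n → Prop}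
    (hQ : ∀ (C : Set (Rn n)) (hC : IsBody C), C ⊆ L → good C →
      ∀ᵐ y, 0 < img ζ I t hC y → img ζ I t hC y = img ζ I t hL y → Q y) :
    ∀ᵐ y, 0 < img ζ I t hL y → Q y := by
  obtain ⟨T, r, hT, hTO, hr, hcov, hdisj⟩ := Besicovitch.exists_disjoint_closedBall_covering_ae
    volume (fun x => {r | 0 < r ∧ Metric.closedBall x r ⊆ L ∧ good (Metric.closedBall x r)}) O
    (by
      intro x hx δ hδ
      obtain ⟨S, hS, hSg⟩ := hgood x hx
      obtain ⟨ρ, hρ, hρS⟩ := Metric.nhds_basis_closedBall.mem_iff.1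
        (inter_mem hS (mem_interior_iff_mem_nhds.1 (hO hx)))
      have hsub : Metric.closedBall x (min ρ (δ / 2)) ⊆ Metric.closedBall x ρ :=
        Metric.closedBall_subset_closedBall (min_le_left _ _)
      refine ⟨min ρ (δ / 2), ⟨by positivity, fun z hz => (hρS (hsub hz)).2,
        hSg _ fun z hz => (hρS (hsub hz)).1⟩, by positivity, ?_⟩
      exact (min_le_right _ _).trans_lt (by linarith))
    (fun _ => 1) (fun _ _ => one_pos)
  have hrp : ∀ x : T, 0 < r x := fun x => (hr x x.2).1.1
  have hrL : ∀ x : T, Metric.closedBall (x : Rn n) (r x) ⊆ L := fun x => (hr x x.2).1.2.1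
  have : Countable T := hT.to_subtype
  set f : T → Rn n → ℝ := fun x => img ζ I t (isBody_closedBall (x : Rn n) (hrp x)) with hf
  have hle : ∀ᵐ y, ∀ x, f x y ≤ img ζ I t hL y :=
    ae_all_iff.2 fun x => H.img_le _ _ (hrL x) le_rfl
  have hdis : ∀ᵐ y, ∀ x x', x ≠ x' → f x y = 0 ∨ f x' y = 0 := by
    refine ae_all_iff.2 fun x => ae_all_iff.2 fun x' => ?_
    by_cases hxx : x = x'
    · exact Eventually.of_forall fun y h => absurd hxx h
    · have hd : Disjoint (Metric.closedBall (x : Rn n) (r x))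
          (Metric.closedBall (x' : Rn n) (r x')) :=
        hdisj x.2 x'.2 (fun h => hxx (Subtype.ext h))
      filter_upwards [H.img_disjoint (s := t) (t := t) (isBody_closedBall (x : Rn n) (hrp x))
        (isBody_closedBall (x' : Rn n) (hrp x')) (by rw [hd.inter_eq, measure_empty])] with y hy _
      exact hy
  have hsum_le : ∀ᵐ y, ∑' x, ENNReal.ofReal (f x y) ≤ ENNReal.ofReal (img ζ I t hL y) := by
    filter_upwards [hle, hdis] with y h1 h2
    by_cases h3 : ∃ x, f x y ≠ 0
    · obtain ⟨x, hx⟩ := h3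
      rw [tsum_eq_single x fun x' hx' => by
        rw [(h2 x x' hx'.symm).resolve_left hx, ENNReal.ofReal_zero]]
      exact ENNReal.ofReal_le_ofReal (h1 x)
    · push Not at h3
      simp [h3]
  have hmeas : ∀ x, AEMeasurable (fun y => ENNReal.ofReal (f x y)) := fun x =>
    (H.integrable_img _).aestronglyMeasurable.aemeasurable.ennreal_ofReal
  -- The balls exhaust `L` up to a null set. Their images lie below the image of `L` with disjoint
  -- supports, so equality of total masses forces their sum to be the image of `L`.
  have hvol : volume L ≤ ∑' x : T, volume (Metric.closedBall (x : Rn n) (r x)) := by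
    calc volume L ≤ volume (L \ O) + volume (O \ ⋃ x ∈ T, Metric.closedBall x (r x))
          + volume (⋃ x : T, Metric.closedBall (x : Rn n) (r x)) := by
          refine (measure_mono ?_).trans ((measure_union_le _ _).trans
            (add_le_add_left (measure_union_le _ _) _))
          intro z hz
          by_cases h1 : z ∈ O
          · by_cases h2 : z ∈ ⋃ x ∈ T, Metric.closedBall x (r x)
            · right; simpa using h2
            · exact Or.inl (Or.inr ⟨h1, h2⟩)
          · exact Or.inl (Or.inl ⟨hz, h1⟩)
      _ ≤ _ := by
          rw [hOL, hcov, zero_add, zero_add]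
          exact measure_iUnion_le _
  have heq : ∀ᵐ y, ∑' x, ENNReal.ofReal (f x y) = ENNReal.ofReal (img ζ I t hL y) := by
    refine ae_eq_of_ae_le_of_lintegral_le hsum_le ?_
      (H.integrable_img hL).aestronglyMeasurable.aemeasurable.ennreal_ofReal ?_
    · refine ne_top_of_le_ne_top ?_ (lintegral_mono_ae hsum_le)
      rw [H.lintegral_img]
      exact ENNReal.mul_ne_top ENNReal.ofReal_ne_top hL.compact.measure_lt_top.ne
    · rw [lintegral_tsum hmeas, H.lintegral_img]
      simp_rw [hf, H.lintegral_img]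
      rw [ENNReal.tsum_mul_left]
      gcongr
  have hQ' : ∀ᵐ y, ∀ x : T, 0 < f x y → f x y = img ζ I t hL y → Q y :=
    ae_all_iff.2 fun x => hQ _ _ (hrL x) (hr x x.2).1.2.2
  filter_upwards [hle, hdis, heq, hQ'] with y h1 h2 h3 h4 hpos
  by_cases h5 : ∃ x, f x y ≠ 0
  · obtain ⟨x, hx⟩ := h5
    have hx0 : 0 < f x y := lt_of_le_of_ne (H.img_nonneg _ y) hx.symm
    refine h4 x hx0 ?_
    rw [tsum_eq_single x fun x' hx' => by
      rw [(h2 x x' hx'.symm).resolve_left hx, ENNReal.ofReal_zero]] at h3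
    rwa [ENNReal.ofReal_eq_ofReal_iff hx0.le hpos.le] at h3
  · push Not at h5
    simp only [h5, ENNReal.ofReal_zero, tsum_zero] at h3
    exact absurd (ENNReal.ofReal_eq_zero.1 h3.symm) (not_le.2 hpos)

/-- The image of a smaller body is a restriction of the image of a larger one. -/
theorem img_eq_of_subset (H : Setting n ζ I) (hK : IsBody K) (hL : IsBody L) (hKL : K ⊆ L) :
    ∀ᵐ y, 0 < img ζ I t hK y → img ζ I t hK y = img ζ I t hL y := by
  have hnull : volume (L \ (interior L \ frontier K)) = 0 := by
    refine measure_mono_null (t := frontier L ∪ frontier K) ?_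
      (measure_union_null (hL.convex.addHaar_frontier volume) (hK.convex.addHaar_frontier volume))
    rintro z ⟨hz1, hz2⟩
    by_cases h : z ∈ interior L
    · exact Or.inr (by_contra fun h2 => hz2 ⟨h, h2⟩)
    · exact Or.inl ⟨subset_closure hz1, h⟩
  -- Off the boundary of `K`, small balls lie in `K` or miss it. For those inside, the image of `K`
  -- is squeezed between equal functions; for the others it vanishes where the image of the ball is
  -- positive.
  have h1 := H.ae_of_cover (t := t) hL (O := interior L \ frontier K) sdiff_subset hnull
    (good := fun C => C ⊆ K ∨ Disjoint C K)
    (Q := fun y => 0 < img ζ I t hK y → img ζ I t hK y = img ζ I t hL y) ?_ ?_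
  · filter_upwards [h1, H.img_le hK hL hKL (le_refl t)] with y h2 h3 h4
    exact h2 (h4.trans_le h3) h4
  · rintro x ⟨-, hx⟩
    by_cases hxK : x ∈ K
    · refine ⟨K, ?_, fun C hC => Or.inl hC⟩
      rw [← mem_interior_iff_mem_nhds]
      by_contra h
      exact hx ⟨subset_closure hxK, h⟩
    · exact ⟨Kᶜ, hK.compact.isClosed.isOpen_compl.mem_nhds hxK,
        fun C hC => Or.inr (disjoint_left.2 fun z hz => hC hz)⟩
  · intro C hC hCL hgood
    rcases hgood with hCK | hCK
    · filter_upwards [H.img_le (t := t) hC hK hCK le_rfl, H.img_le (t := t) hK hL hKL le_rfl]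
        with y h1 h2 h3 h4 h5
      linarith
    · filter_upwards [H.img_disjoint (s := t) (t := t) hC hK (by rw [hCK.inter_eq, measure_empty])]
        with y h1 h2 h3 h4
      rcases h1 with h1 | h1 <;> linarith

end Setting

end
end ConvexIsometry

/-! ### The correspondence between points of the images and points of the bodies. -/

namespace ConvexIsometry
noncomputable section

variable {n : ℕ} {ζ : ℝ → ℝ} {u v : Rn n → EReal} {K L : Set (Rn n)}
  {I : CVcn n → CVcn n} {t s : ℝ} {x y : Rn n}

/-- The point `x` corresponds to `y`: the image of each body around `x` has `y` in the closure of
its domain. -/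
def Corresponds (I : CVcn n → CVcn n) (t : ℝ) (y x : Rn n) : Prop :=
  ∀ (K : Set (Rn n)) (hK : IsBody K), x ∈ interior K → y ∈ closure (reg I t hK)

/-- The union of the domains of the images of all functions that equal `t` on a body. -/
def reach (I : CVcn n → CVcn n) (t : ℝ) : Set (Rn n) :=
  {y | ∃ (K : Set (Rn n)) (hK : IsBody K), y ∈ reg I t hK}

theorem isBody_closedBall_inter {A : Set (Rn n)} (hA : Convex ℝ A) (hAc : IsClosed A) {k : ℝ}
    {z : Rn n} (hz : ‖z‖ < k) (hzA : z ∈ interior A) : IsBody (Metric.closedBall 0 k ∩ A) := by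
  refine ⟨(convex_closedBall 0 k).inter hA, (isCompact_closedBall 0 k).inter_right hAc, z, ?_⟩
  rw [interior_inter]
  exact ⟨Metric.ball_subset_interior_closedBall (by simpa using hz), hzA⟩

variable {θ : Rn n →L[ℝ] ℝ} {c : ℝ}

theorem convex_le : Convex ℝ {z | θ z ≤ c} := convex_halfSpace_le θ.isLinear c

theorem convex_ge : Convex ℝ {z | c ≤ θ z} := convex_halfSpace_ge θ.isLinear c

theorem isClosed_le' : IsClosed {z | θ z ≤ c} := isClosed_le θ.continuous continuous_const

theorem isClosed_ge' : IsClosed {z | c ≤ θ z} := isClosed_le continuous_const θ.continuous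

theorem mem_interior_le (h : θ x < c) : x ∈ interior {z | θ z ≤ c} :=
  interior_maximal (fun _ hz => le_of_lt hz) (isOpen_lt θ.continuous continuous_const) h

theorem mem_interior_ge (h : c < θ x) : x ∈ interior {z | c ≤ θ z} :=
  interior_maximal (fun _ hz => le_of_lt hz) (isOpen_lt continuous_const θ.continuous) h

theorem lt_of_mem_interior_le (hθ : θ ≠ 0) (hx : x ∈ interior {z | θ z ≤ c}) : θ x < c := by
  obtain ⟨e, he⟩ : ∃ e, 0 < θ e := by
    by_contra! h
    refine hθ (ContinuousLinearMap.ext fun e => le_antisymm (h e) ?_)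
    have := h (-e)
    simp only [map_neg, Left.neg_nonpos_iff] at this
    exact this
  have hc : ContinuousAt (fun ε : ℝ => x + ε • e) 0 := by fun_prop
  have h1 : ∀ᶠ ε : ℝ in 𝓝 0, x + ε • e ∈ interior {z | θ z ≤ c} :=
    hc.eventually (isOpen_interior.mem_nhds (by simpa using hx))
  have h2 : ∃ᶠ ε : ℝ in 𝓝[>] 0, x + ε • e ∈ interior {z | θ z ≤ c} :=
    (h1.filter_mono nhdsWithin_le_nhds).frequently
  obtain ⟨ε, h3, h4⟩ := (h2.and_eventually self_mem_nhdsWithin).exists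
  have h3 : x + ε • e ∈ {z | θ z ≤ c} := interior_subset h3
  rw [mem_ofPred_eq] at h3
  have h4 : 0 < ε := h4
  simp only [map_add, map_smul, smul_eq_mul] at h3
  nlinarith [mul_pos h4 he]

theorem lt_of_mem_interior_ge (hθ : θ ≠ 0) (hx : x ∈ interior {z | c ≤ θ z}) : c < θ x := by
  have := lt_of_mem_interior_le (θ := -θ) (c := -c) (x := x) (neg_ne_zero.2 hθ) (by simpa using hx)
  simpa using this

theorem volume_hyperplane (hθ : θ ≠ 0) (c : ℝ) : volume {z | θ z = c} = 0 := by
  refine measure_mono_null ?_ ((convex_le (θ := θ) (c := c)).addHaar_frontier volume)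
  intro z hz
  have hz : θ z = c := hz
  exact ⟨subset_closure hz.le, fun hint => (lt_of_mem_interior_le hθ hint).ne hz⟩

theorem splits_halfSpace (hθ : θ ≠ 0) {k : ℝ} {z₁ z₂ : Rn n} (h1 : θ z₁ < c) (h2 : c < θ z₂)
    (hk1 : ‖z₁‖ < k) (hk2 : ‖z₂‖ < k) :
    Splits (Metric.closedBall (0 : Rn n) k) (Metric.closedBall 0 k ∩ {z | θ z ≤ c})
      (Metric.closedBall 0 k ∩ {z | c ≤ θ z}) := by
  refine ⟨isBody_closedBall 0 ((norm_nonneg _).trans_lt hk1),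
    isBody_closedBall_inter convex_le isClosed_le' hk1 (mem_interior_le h1),
    isBody_closedBall_inter convex_ge isClosed_ge' hk2 (mem_interior_ge h2), ?_, ?_⟩
  · rw [← inter_union_distrib_left, inter_eq_left]
    exact fun z _ => le_total (θ z) c
  · refine measure_mono_null ?_ (volume_hyperplane hθ c)
    rintro z ⟨⟨-, h1⟩, -, h2⟩
    exact le_antisymm h1 h2

theorem IsBody.volume_diff_interior (hK : IsBody K) : volume (K \ interior K) = 0 :=
  measure_mono_null (t := frontier K) (fun _ hz => ⟨subset_closure hz.1, hz.2⟩)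
    (hK.convex.addHaar_frontier volume)

theorem exists_map_eq_one (hθ : θ ≠ 0) : ∃ e, θ e = 1 := by
  obtain ⟨e, he⟩ : ∃ e, θ e ≠ 0 := by
    by_contra! h2; exact hθ (ContinuousLinearMap.ext h2)
  exact ⟨(θ e)⁻¹ • e, by simp [he]⟩

theorem exists_ball_superset (hK : IsBody K) (r : ℝ) :
    ∃ k, r < k ∧ 0 < k ∧ K ⊆ Metric.closedBall 0 k := by
  obtain ⟨k, hk⟩ := hK.compact.isBounded.subset_closedBall 0
  exact ⟨max k (|r| + 1), lt_of_lt_of_le (by linarith [le_abs_self r]) (le_max_right _ _),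
    lt_of_lt_of_le (by positivity) (le_max_right _ _),
    hk.trans (Metric.closedBall_subset_closedBall (le_max_left _ _))⟩

namespace Setting

/-- Otherwise each point of `L` has a body around it whose image stays away from `y`. Finitely many
of them cover the compact `L`, so their images cover almost all of the image of `L`, including
points near `y`. -/
theorem exists_corresponds (H : Setting n ζ I) (hL : IsBody L) (hy : y ∈ reg I t hL) :
    ∃ x ∈ L, Corresponds I t y x := by
  by_contra! hcon
  unfold Corresponds at hcon
  push Not at hcon
  choose! K hK hxK hyK using hcon
  obtain ⟨T, hTL, hT⟩ := hL.compact.elim_nhds_subcover (fun x => interior (K x))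
    fun x hx => isOpen_interior.mem_nhds (hxK x hx)
  have hae := H.ae_of_cover (t := t) hL (O := interior L) Subset.rfl
    hL.volume_diff_interior
    (good := fun C => ∃ x ∈ T, C ⊆ K x)
    (Q := fun z => ∃ x ∈ T, ∃ hx : x ∈ L, z ∈ reg I t (hK x hx)) ?_ ?_
  · have hev : ∀ᶠ z in 𝓝 y, z ∈ reg I t hL ∧
        ∀ x ∈ T, ∀ hx : x ∈ L, z ∉ closure (reg I t (hK x hx)) := by
      refine Eventually.and ((isOpen_reg hL).mem_nhds hy) ?_
      refine (Finset.eventually_all T).2 fun x hx => ?_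
      filter_upwards [isClosed_closure.isOpen_compl.mem_nhds (hyK x (hTL x hx))] with z hz _
      exact hz
    obtain ⟨z, h1, h2, h3⟩ := exists_of_ae_of_eventually hae hev
    obtain ⟨x, hx, hxL, hz⟩ := h1 (H.img_pos hL h2)
    exact h3 x hx hxL (subset_closure hz)
  · intro x hx
    obtain ⟨x', hx', hxx'⟩ := mem_iUnion₂.1 (hT (interior_subset hx))
    exact ⟨K x', mem_interior_iff_mem_nhds.1 hxx', fun C hC => ⟨x', hx', hC⟩⟩
  · rintro C hC hCL ⟨x, hx, hCK⟩
    have hxL := hTL x hx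
    filter_upwards [H.img_le (t := t) hC (hK x hxL) hCK le_rfl, H.ae_mem_reg (t := t) (hK x hxL)]
      with z h1 h2 h3 _
    exact ⟨x, hx, hxL, h2 (h3.trans_le h1)⟩

/-- A point corresponding to one in an open half-space lies in the domain of the image of a body in
that half-space. -/
theorem exists_body_of_lt (H : Setting n ζ I) (hy : y ∈ reach I t) (hyx : Corresponds I t y x)
    (hθ : θ x < c) : ∃ (M : Set (Rn n)) (hM : IsBody M), (∀ z ∈ M, θ z ≤ c) ∧ y ∈ reg I t hM := by
  obtain ⟨L₀, hL₀, hyL₀⟩ := hy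
  by_cases hθne : θ = 0
  · subst hθne
    exact ⟨L₀, hL₀, fun z _ => hθ.le, hyL₀⟩
  obtain ⟨e, he⟩ := exists_map_eq_one hθne
  set d := c - θ x with hd
  have hdp : 0 < d := by linarith
  -- The levels `c' < c` cut a large ball into three slabs; `x` lies strictly in the first, `zm` in
  -- the second, `z₃` in the third.
  set c' := θ x + d / 2 with hc'
  set zm := x + (3 / 4 * d) • e with hzm
  set z₃ := x + (2 * d) • e with hz₃
  have hθm : θ zm = θ x + 3 / 4 * d := by simp [hzm, he]
  have hθ3 : θ z₃ = θ x + 2 * d := by simp [hz₃, he]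
  obtain ⟨k, hk, hk0, hL₀k⟩ := exists_ball_superset hL₀ (max ‖x‖ (max ‖zm‖ ‖z₃‖))
  have hkx : ‖x‖ < k := (le_max_left _ _).trans_lt hk
  have hkm : ‖zm‖ < k := ((le_max_left _ _).trans (le_max_right _ _)).trans_lt hk
  have hk3 : ‖z₃‖ < k := ((le_max_right _ _).trans (le_max_right _ _)).trans_lt hk
  have hL : IsBody (Metric.closedBall (0 : Rn n) k) := isBody_closedBall 0 hk0
  have b1 := isBody_closedBall_inter (convex_le (θ := θ) (c := c')) isClosed_le' hkx
    (mem_interior_le (by linarith))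
  have bm := isBody_closedBall_inter ((convex_ge (θ := θ) (c := c')).inter (convex_le (c := c)))
    (isClosed_ge'.inter isClosed_le') hkm (by
      rw [interior_inter]
      exact ⟨mem_interior_ge (by linarith), mem_interior_le (by linarith)⟩)
  have b12 := isBody_closedBall_inter (convex_le (θ := θ) (c := c)) isClosed_le' hkx
    (mem_interior_le hθ)
  have b3 := isBody_closedBall_inter (convex_ge (θ := θ) (c := c)) isClosed_ge' hk3
    (mem_interior_ge (by linarith))
  have b23 := isBody_closedBall_inter (convex_ge (θ := θ) (c := c')) isClosed_ge' hk3
    (mem_interior_ge (by linarith))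
  refine ⟨_, b12, fun z hz => hz.2, ?_⟩
  by_contra hyn
  have hyL : y ∈ reg I t hL := H.reg_mono hL₀ hL hL₀k le_rfl hyL₀
  have hy1 : y ∈ closure (reg I t b1) := by
    refine hyx _ b1 ?_
    rw [interior_inter]
    exact ⟨Metric.ball_subset_interior_closedBall (by simpa using hkx),
      mem_interior_le (by linarith)⟩
  have hsplit := splits_halfSpace hθne hθ (show c < θ z₃ by linarith) hkx hk3
  obtain ⟨f, hf⟩ := geometric_hahn_banach_open_point (convex_reg b12) (isOpen_reg b12) hyn
  obtain ⟨m, hm⟩ := reg_nonempty (I := I) (t := t) bm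
  have hm12 : m ∈ reg I t b12 := H.reg_mono bm b12 (fun z hz => ⟨hz.1, hz.2.2⟩) le_rfl hm
  have hm23 : m ∈ reg I t b23 := H.reg_mono bm b23 (fun z hz => ⟨hz.1, hz.2.1⟩) le_rfl hm
  -- Beyond the hyperplane separating `y` from the image of the first two slabs, only the image of
  -- the third remains.
  have hN : reg I t hL ∩ {z | f y < f z} ⊆ reg I t b3 := by
    refine H.subset_reg b3 ((isOpen_reg hL).inter (isOpen_lt continuous_const f.continuous)) ?_
    filter_upwards [H.img_split (t := t) hsplit, H.ae_mem_reg (t := t) b12] with z h1 h2 h3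
    have hpos := H.img_pos hL h3.1
    rcases h1 with h1 | h1
    · exact h1.2 ▸ hpos
    · have h4 := hf z (h2 (h1.2 ▸ hpos))
      have h5 : f y < f z := h3.2
      exact absurd h4 (not_lt.2 h5.le)
  -- Extending the segment from `m` slightly past `y` crosses that hyperplane. Both ends then lie in
  -- the image of the last two slabs, so `y` does; but `y` also adheres to the disjoint image of the
  -- first slab.
  have hcont : ContinuousAt (fun ε : ℝ => y + ε • (y - m)) 0 := by fun_prop
  have hev : ∀ᶠ ε : ℝ in 𝓝[>] 0, y + ε • (y - m) ∈ reg I t hL :=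
    (hcont.eventually (by simpa using (isOpen_reg hL).mem_nhds hyL)).filter_mono nhdsWithin_le_nhds
  obtain ⟨ε, h1, h2⟩ := (hev.and self_mem_nhdsWithin).exists
  have h2 : 0 < ε := h2
  have hy3 : y + ε • (y - m) ∈ reg I t b23 := by
    refine H.reg_mono b3 b23 (fun z hz => ⟨hz.1, ?_⟩) le_rfl (hN ⟨h1, ?_⟩)
    · have : c ≤ θ z := hz.2
      change c' ≤ θ z
      linarith
    · change f y < f (y + ε • (y - m))
      simp only [map_add, map_smul, map_sub, smul_eq_mul]
      nlinarith [hf m hm12]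
  have hy23 : y ∈ reg I t b23 := by
    have h3 := convex_reg (I := I) (t := t) b23 hy3 hm23 (a := 1 / (1 + ε)) (b := ε / (1 + ε))
      (by positivity) (by positivity) (by field_simp)
    convert h3 using 1
    have : (1 + ε) ≠ 0 := by positivity
    rw [smul_add, smul_smul, smul_sub, add_sub, ← add_smul,
      show 1 / (1 + ε) + 1 / (1 + ε) * ε = 1 by field_simp, one_smul,
      show 1 / (1 + ε) * ε = ε / (1 + ε) by ring, sub_add_cancel]
  obtain ⟨z, hz23, hz1⟩ := mem_closure_iff.1 hy1 _ (isOpen_reg b23) hy23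
  refine disjoint_left.1 (H.reg_disjoint (s := t) (t := t) b1 b23 ?_) hz1 hz23
  refine measure_mono_null ?_ (volume_hyperplane hθne c')
  rintro z ⟨⟨-, h1⟩, -, h2⟩
  exact le_antisymm h1 h2

theorem exists_body_of_gt (H : Setting n ζ I) (hy : y ∈ reach I t) (hyx : Corresponds I t y x)
    (hθ : c < θ x) : ∃ (M : Set (Rn n)) (hM : IsBody M), (∀ z ∈ M, c ≤ θ z) ∧ y ∈ reg I t hM := by
  obtain ⟨M, hM, h1, h2⟩ := H.exists_body_of_lt (θ := -θ) (c := -c) hy hyx (by simpa using hθ)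
  exact ⟨M, hM, fun z hz => by simpa using h1 z hz, h2⟩

theorem notMem_reg_of_disjoint (H : Setting n ζ I) (hK : IsBody K) (hL : IsBody L)
    (hKL : Disjoint K L) (hy : y ∈ reg I t hK) : y ∉ reg I s hL :=
  disjoint_left.1 (H.reg_disjoint hK hL (by rw [hKL.inter_eq, measure_empty])) hy

/-- Two such points could be strictly separated by parallel hyperplanes, and `y` would lie in the
images of two disjoint bodies. -/
theorem corresponds_unique (H : Setting n ζ I) (hy : y ∈ reach I t) {x' : Rn n}
    (hx : Corresponds I t y x) (hx' : Corresponds I t y x') : x = x' := by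
  by_contra hne
  obtain ⟨θ, hθ⟩ := geometric_hahn_banach_point_point hne
  obtain ⟨c₁, h1, h2⟩ := exists_between hθ
  obtain ⟨c₂, h3, h4⟩ := exists_between h2
  obtain ⟨M, hM, hMc, hyM⟩ := H.exists_body_of_lt hy hx h1
  obtain ⟨M', hM', hMc', hyM'⟩ := H.exists_body_of_gt hy hx' h4
  refine H.notMem_reg_of_disjoint hM hM' (disjoint_left.2 fun z hz hz' => ?_) hyM hyM'
  linarith [hMc z hz, hMc' z hz']

theorem mem_of_corresponds (H : Setting n ζ I) (hK : IsBody K) (hy : y ∈ reg I t hK)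
    (hx : Corresponds I t y x) : x ∈ K := by
  obtain ⟨x', hx', h⟩ := H.exists_corresponds hK hy
  rwa [H.corresponds_unique ⟨K, hK, hy⟩ hx h]

theorem isOpen_reach : IsOpen (reach I t) := by
  have : reach I t = ⋃ (K : Set (Rn n)) (hK : IsBody K), reg I t hK := by
    ext y; simp [reach]
  rw [this]
  exact isOpen_iUnion fun K => isOpen_iUnion fun hK => isOpen_reg hK

theorem exists_ball_of_mem_reach (H : Setting n ζ I) {y y' : Rn n} (hy : y ∈ reach I t)
    (hy' : y' ∈ reach I t) : ∃ (k : ℝ) (hk : 0 < k),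
      y ∈ reg I t (isBody_closedBall (0 : Rn n) hk) ∧
      y' ∈ reg I t (isBody_closedBall (0 : Rn n) hk) := by
  obtain ⟨K, hK, h⟩ := hy
  obtain ⟨K', hK', h'⟩ := hy'
  obtain ⟨k, -, hk, hKk⟩ := exists_ball_superset hK 0
  obtain ⟨k', -, hk', hKk'⟩ := exists_ball_superset hK' 0
  refine ⟨max k k', by positivity, ?_, ?_⟩
  · exact H.reg_mono hK _ (hKk.trans (Metric.closedBall_subset_closedBall (le_max_left _ _)))
      le_rfl h
  · exact H.reg_mono hK' _ (hKk'.trans (Metric.closedBall_subset_closedBall (le_max_right _ _)))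
      le_rfl h'

theorem convex_reach (H : Setting n ζ I) : Convex ℝ (reach I t) := by
  intro y hy y' hy' a b ha hb hab
  obtain ⟨k, hk, h1, h2⟩ := H.exists_ball_of_mem_reach hy hy'
  exact ⟨_, _, convex_reg _ h1 h2 ha hb hab⟩

end Setting

open Classical in
/-- The point corresponding to a point in the range. -/
def back (I : CVcn n → CVcn n) (t : ℝ) (y : Rn n) : Rn n :=
  if h : ∃ x, Corresponds I t y x then h.choose else 0

namespace Setting

theorem corresponds_back (H : Setting n ζ I) (hy : y ∈ reach I t) :
    Corresponds I t y (back I t y) := by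
  obtain ⟨K, hK, hyK⟩ := hy
  obtain ⟨x, -, hx⟩ := H.exists_corresponds hK hyK
  have h : ∃ x, Corresponds I t y x := ⟨x, hx⟩
  rw [back, dif_pos h]
  exact h.choose_spec

theorem back_mem (H : Setting n ζ I) (hK : IsBody K) (hy : y ∈ reg I t hK) : back I t y ∈ K :=
  H.mem_of_corresponds hK hy (H.corresponds_back ⟨K, hK, hy⟩)

theorem mem_closure_reg (H : Setting n ζ I) (hK : IsBody K) (hy : y ∈ reach I t)
    (h : back I t y ∈ interior K) : y ∈ closure (reg I t hK) := H.corresponds_back hy K hK h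

/-- Sublevel sets of linear functions of the corresponding point are convex. -/
theorem back_segment_subset (H : Setting n ζ I) {y' z : Rn n} (hy : y ∈ reach I t)
    (hy' : y' ∈ reach I t) (hz : z ∈ segment ℝ y y') :
    back I t z ∈ segment ℝ (back I t y) (back I t y') := by
  have hzr : z ∈ reach I t := H.convex_reach.segment_subset hy hy' hz
  by_contra hn
  have hcl : IsClosed (segment ℝ (back I t y) (back I t y')) := by
    rw [segment_eq_image]
    exact (isCompact_Icc.image (by fun_prop)).isClosed
  -- If `back z` were off the segment, a hyperplane would separate them. The image of a body on the
  -- side of both ends contains `z` by convexity, and so does the image of a body on the other side.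
  obtain ⟨θ, c, h1, h2⟩ := geometric_hahn_banach_closed_point (convex_segment _ _) hcl hn
  obtain ⟨c', h3, h4⟩ := exists_between h2
  obtain ⟨M, hM, hMc, hyM⟩ := H.exists_body_of_lt hy (H.corresponds_back hy)
    (h1 _ (left_mem_segment ..))
  obtain ⟨M', hM', hMc', hyM'⟩ := H.exists_body_of_lt hy' (H.corresponds_back hy')
    (h1 _ (right_mem_segment ..))
  obtain ⟨N, hN, hNc, hzN⟩ := H.exists_body_of_gt hzr (H.corresponds_back hzr) h4
  obtain ⟨k, -, hk, hMk⟩ := exists_ball_superset hM 0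
  obtain ⟨k', -, hk', hMk'⟩ := exists_ball_superset hM' 0
  have hsub : ∀ {A}, A ⊆ Metric.closedBall (0 : Rn n) k ∨ A ⊆ Metric.closedBall (0 : Rn n) k' →
      A ⊆ Metric.closedBall (0 : Rn n) (max k k') := by
    rintro A (h | h)
    · exact h.trans (Metric.closedBall_subset_closedBall (le_max_left _ _))
    · exact h.trans (Metric.closedBall_subset_closedBall (le_max_right _ _))
  have hB : IsBody (Metric.closedBall (0 : Rn n) (max k k') ∩ {z | θ z ≤ c}) :=
    ⟨(convex_closedBall _ _).inter convex_le, (isCompact_closedBall _ _).inter_right isClosed_le',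
      hM.nonempty.mono (interior_mono fun z hz => ⟨hsub (Or.inl hMk) hz, hMc z hz⟩)⟩
  have hzB : z ∈ reg I t hB := (convex_reg hB).segment_subset
    (H.reg_mono hM hB (fun z hz => ⟨hsub (Or.inl hMk) hz, hMc z hz⟩) le_rfl hyM)
    (H.reg_mono hM' hB (fun z hz => ⟨hsub (Or.inr hMk') hz, hMc' z hz⟩) le_rfl hyM') hz
  refine H.notMem_reg_of_disjoint hB hN (disjoint_left.2 fun w hw hw' => ?_) hzB hzN
  have h5 : θ w ≤ c := hw.2
  linarith [hNc w hw']

/-- If `θ (back y) < c`, then `y` is in the open image of a body in a lower half-space, and nearby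
points correspond to points of that body. Applied to plus and minus each coordinate. -/
theorem continuousOn_back (H : Setting n ζ I) : ContinuousOn (back I t) (reach I t) := by
  have key : ∀ θ : Rn n →L[ℝ] ℝ, ∀ y ∈ reach I t, ∀ c, θ (back I t y) < c →
      ∀ᶠ z in 𝓝 y, θ (back I t z) < c := by
    intro θ y hy c hc
    obtain ⟨c', h1, h2⟩ := exists_between hc
    obtain ⟨M, hM, hMc, hyM⟩ := H.exists_body_of_lt hy (H.corresponds_back hy) h1
    filter_upwards [(isOpen_reg hM).mem_nhds hyM] with z hz
    exact (hMc _ (H.back_mem hM hz)).trans_lt h2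
  intro y hy
  refine ContinuousAt.continuousWithinAt ?_
  have hco : ∀ i, ContinuousAt (fun z => back I t z i) y := by
    intro i
    refine tendsto_order.2 ⟨fun c hc => ?_, fun c hc => ?_⟩
    · have := key (-EuclideanSpace.proj i) y hy (-c) (by simpa using hc)
      filter_upwards [this] with z hz
      simpa using hz
    · have := key (EuclideanSpace.proj i) y hy c (by simpa using hc)
      filter_upwards [this] with z hz
      simpa using hz
  have h1 : ContinuousAt (fun z => WithLp.ofLp (back I t z)) y := continuousAt_pi.2 hco
  have h2 := (PiLp.continuous_toLp 2 (fun _ : Fin n => ℝ)).continuousAt.comp h1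
  exact h2

/-- Cover the interior of `K` by balls contained in it; their images make up almost all of the image
of `K`. -/
theorem ae_back_mem_interior (H : Setting n ζ I) (hK : IsBody K) :
    ∀ᵐ y, y ∈ reg I t hK → back I t y ∈ interior K := by
  have h := H.ae_of_cover (t := t) hK (O := interior K) Subset.rfl
    hK.volume_diff_interior (good := fun C => C ⊆ interior K)
    (Q := fun y => back I t y ∈ interior K)
    (fun x hx => ⟨_, isOpen_interior.mem_nhds hx, fun C hC => hC⟩)
    (fun C hC _ hg => by
      filter_upwards [H.ae_mem_reg (t := t) hC] with y h1 h2 _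
      exact hg (H.back_mem hC (h1 h2)))
  filter_upwards [h] with y h1 h2
  exact h1 (H.img_pos hK h2)

/-- The preimage of a hyperplane is a null set. -/
theorem ae_back_ne (H : Setting n ζ I) (hθ : θ ≠ 0) (c : ℝ) :
    ∀ᵐ y, y ∈ reach I t → θ (back I t y) ≠ c := by
  obtain ⟨e, he⟩ := exists_map_eq_one hθ
  set z₁ := (c - 1) • e
  set z₂ := (c + 1) • e
  have h1 : θ z₁ < c := by simp [z₁, he]
  have h2 : c < θ z₂ := by simp [z₂, he]
  set r := max ‖z₁‖ ‖z₂‖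
  have hr : 0 ≤ r := (norm_nonneg _).trans (le_max_left _ _)
  have hk1 : ∀ k : ℕ, ‖z₁‖ < r + k + 1 := fun k => by
    have := le_max_left ‖z₁‖ ‖z₂‖; have : (0 : ℝ) ≤ k := k.cast_nonneg; linarith
  have hk2 : ∀ k : ℕ, ‖z₂‖ < r + k + 1 := fun k => by
    have := le_max_right ‖z₁‖ ‖z₂‖; have : (0 : ℝ) ≤ k := k.cast_nonneg; linarith
  have hs := fun k : ℕ => splits_halfSpace hθ h1 h2 (hk1 k) (hk2 k)
  -- The hyperplane cuts each large ball into two bodies, and almost every point of the image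
  -- corresponds to an interior point of one of them.
  have hae : ∀ᵐ y, ∀ k : ℕ, y ∈ reg I t (hs k).body → θ (back I t y) ≠ c := by
    refine ae_all_iff.2 fun k => ?_
    filter_upwards [H.img_split (t := t) (hs k), H.ae_mem_reg (t := t) (hs k).body_left,
      H.ae_mem_reg (t := t) (hs k).body_right, H.ae_back_mem_interior (t := t) (hs k).body_left,
      H.ae_back_mem_interior (t := t) (hs k).body_right] with y h1 h2 h3 h4 h5 h6
    have hpos := H.img_pos _ h6
    rcases h1 with h1 | h1
    · have := h5 (h3 (h1.2 ▸ hpos))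
      rw [interior_inter] at this
      exact (lt_of_mem_interior_ge hθ this.2).ne'
    · have := h4 (h2 (h1.2 ▸ hpos))
      rw [interior_inter] at this
      exact (lt_of_mem_interior_le hθ this.2).ne
  filter_upwards [hae] with y hy ⟨K, hK, hyK⟩
  obtain ⟨k, -, hk, hKk⟩ := exists_ball_superset hK 0
  obtain ⟨m, hm⟩ := exists_nat_ge k
  refine hy m (H.reg_mono hK _ (hKk.trans (Metric.closedBall_subset_closedBall ?_)) le_rfl hyK)
  linarith

end Setting

end
end ConvexIsometry

/-! ### Injectivity and surjectivity of the correspondence. -/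

namespace ConvexIsometry
noncomputable section

variable {n : ℕ} {ζ : ℝ → ℝ} {u v : Rn n → EReal} {K L : Set (Rn n)}
  {I : CVcn n → CVcn n} {t s : ℝ} {x y : Rn n} {θ : Rn n →L[ℝ] ℝ} {c : ℝ}

namespace Setting

theorem map_back_lt (H : Setting n ζ I) {y y' z : Rn n} (hy : y ∈ reach I t)
    (hy' : y' ∈ reach I t) (hz : z ∈ segment ℝ y y') (h₁ : θ (back I t y) < c)
    (h₂ : θ (back I t y') < c) : θ (back I t z) < c :=
  have hseg := H.back_segment_subset hy hy' hz
  (convex_halfSpace_lt θ.isLinear c).segment_subset h₁ h₂ hseg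

/-- The level sets of linear functions of the corresponding point are sections of the reach by
hyperplanes. -/
theorem exists_normal (H : Setting n ζ I) (hθ : θ ≠ 0) {y₀ : Rn n} (hy₀ : y₀ ∈ reach I t) :
    ∃ ν : Rn n →L[ℝ] ℝ, ∀ y ∈ reach I t,
      (θ (back I t y₀) < θ (back I t y) → ν y₀ < ν y) ∧
      (θ (back I t y) < θ (back I t y₀) → ν y < ν y₀) ∧
      (θ (back I t y) = θ (back I t y₀) → ν y = ν y₀) := by
  set c := θ (back I t y₀)
  have hcont : ContinuousOn (fun y => θ (back I t y)) (reach I t) :=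
    θ.continuous.comp_continuousOn H.continuousOn_back
  have hlt : ∀ {θ' : Rn n →L[ℝ] ℝ} {c'}, Convex ℝ (reach I t ∩ {y | θ' (back I t y) < c'}) := by
    intro θ' c'
    refine convex_iff_segment_subset.2 fun y hy y' hy' z hz => ?_
    exact ⟨H.convex_reach.segment_subset hy.1 hy'.1 hz, H.map_back_lt hy.1 hy'.1 hz hy.2 hy'.2⟩
  have hA : IsOpen (reach I t ∩ {y | θ (back I t y) < c}) :=
    hcont.isOpen_inter_preimage isOpen_reach isOpen_Iio
  have hB : IsOpen (reach I t ∩ {y | c < θ (back I t y)}) :=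
    hcont.isOpen_inter_preimage isOpen_reach isOpen_Ioi
  have hBc : Convex ℝ (reach I t ∩ {y | c < θ (back I t y)}) := by
    simpa using hlt (θ' := -θ) (c' := -c)
  -- The strict sublevel and superlevel sets are open and convex, so `ν` separates them strictly at
  -- height `a`.
  obtain ⟨ν, a, h1, h2⟩ := geometric_hahn_banach_open_open hlt hA hBc hB
    (disjoint_left.2 fun y hy hy' => lt_asymm (mem_ofPred_eq ▸ hy.2) hy'.2)
  have hev : ∀ y ∈ reach I t, ∀ᶠ z in 𝓝 y, z ∈ reach I t ∧ (2 : ℝ) • y - z ∈ reach I t := by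
    intro y hy
    have hc : ContinuousAt (fun z => (2 : ℝ) • y - z) y := by fun_prop
    refine Eventually.and (isOpen_reach.mem_nhds hy) (hc.eventually (isOpen_reach.mem_nhds ?_))
    simpa only [two_smul, add_sub_cancel_right] using hy
  have hae : ∀ y : Rn n, ∀ᵐ z, (z ∈ reach I t → θ (back I t z) ≠ c) ∧
      ((2 : ℝ) • y - z ∈ reach I t → θ (back I t ((2 : ℝ) • y - z)) ≠ c) := by
    intro y
    have h := H.ae_back_ne (t := t) hθ c
    exact h.and
      ((Measure.measurePreserving_sub_left volume ((2 : ℝ) • y)).quasiMeasurePreserving.ae h)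
  have hmid : ∀ y z : Rn n, y ∈ segment ℝ z ((2 : ℝ) • y - z) := by
    intro y z
    refine ⟨1 / 2, 1 / 2, by norm_num, by norm_num, by norm_num, ?_⟩
    rw [← smul_add, add_sub_cancel, smul_smul]; norm_num
  -- If `ν y ≠ a`, choose `z` near `y` with `z` and `2y - z` on the same side of `ν = a` and off the
  -- null level set. Both then lie strictly on the same side of level `c`, and so does their
  -- midpoint `y`.
  have hlevel : ∀ y ∈ reach I t, θ (back I t y) = c → ν y = a := by
    intro y hy hyc
    have hνc : ContinuousAt ν y := ν.continuous.continuousAt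
    have hνc2 : ContinuousAt (fun z => ν ((2 : ℝ) • y - z)) y := by fun_prop
    have hν2 : ν ((2 : ℝ) • y - y) = ν y := by rw [two_smul, add_sub_cancel_right]
    rcases lt_trichotomy (ν y) a with hlt' | heq | hgt
    · exfalso
      obtain ⟨z, ⟨h3, h4⟩, ⟨h5, h6⟩, h7, h8⟩ := exists_of_ae_of_eventually (hae y)
        ((hev y hy).and ((hνc.eventually (gt_mem_nhds hlt')).and
          (hνc2.eventually (gt_mem_nhds (hν2.symm ▸ hlt')))))
      have e1 : θ (back I t z) < c := by
        refine lt_of_le_of_ne (not_lt.1 fun h => ?_) (h3 h5)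
        exact lt_asymm h7 (h2 z ⟨h5, h⟩)
      have e2 : θ (back I t ((2 : ℝ) • y - z)) < c := by
        refine lt_of_le_of_ne (not_lt.1 fun h => ?_) (h4 h6)
        exact lt_asymm h8 (h2 _ ⟨h6, h⟩)
      exact (H.map_back_lt h5 h6 (hmid y z) e1 e2).ne hyc
    · exact heq
    · exfalso
      obtain ⟨z, ⟨h3, h4⟩, ⟨h5, h6⟩, h7, h8⟩ := exists_of_ae_of_eventually (hae y)
        ((hev y hy).and ((hνc.eventually (lt_mem_nhds hgt)).and
          (hνc2.eventually (lt_mem_nhds (hν2.symm ▸ hgt)))))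
      have e1 : c < θ (back I t z) := by
        refine lt_of_le_of_ne (not_lt.1 fun h => ?_) (h3 h5).symm
        exact lt_asymm h7 (h1 z ⟨h5, h⟩)
      have e2 : c < θ (back I t ((2 : ℝ) • y - z)) := by
        refine lt_of_le_of_ne (not_lt.1 fun h => ?_) (h4 h6).symm
        exact lt_asymm h8 (h1 _ ⟨h6, h⟩)
      have := H.map_back_lt (θ := -θ) (c := -c) h5 h6 (hmid y z) (by simpa using e1)
        (by simpa using e2)
      simp [hyc] at this
  have h0 := hlevel y₀ hy₀ rfl
  refine ⟨ν, fun y hy => ⟨fun h => ?_, fun h => ?_, fun h => ?_⟩⟩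
  · rw [h0]; exact h2 y ⟨hy, h⟩
  · rw [h0]; exact h1 y ⟨hy, h⟩
  · rw [h0]; exact hlevel y hy h

/-- The normals `ν i` of the coordinate functions at `y₀` all vanish on `y₁ - y₀`, hence are
linearly dependent. But `back` takes values in every orthant around `back y₀`, so the `ν i` attain
every pattern of strict signs, which a nontrivial linear relation forbids. -/
theorem injOn_back (H : Setting n ζ I) : InjOn (back I t) (reach I t) := by
  intro y₁ hy₁ y₀ hy₀ heq
  by_contra hne
  have hproj : ∀ i : Fin n, (EuclideanSpace.proj i : Rn n →L[ℝ] ℝ) ≠ 0 := by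
    intro i h
    have := congrArg (fun f : Rn n →L[ℝ] ℝ => f (EuclideanSpace.single i 1)) h
    simp at this
  choose ν hν using fun i : Fin n => H.exists_normal (hproj i) hy₀
  let N : Rn n →ₗ[ℝ] (Fin n → ℝ) := LinearMap.pi fun i => (ν i : Rn n →ₗ[ℝ] ℝ)
  have hker : N (y₁ - y₀) = 0 := by
    ext i
    simp only [N, LinearMap.pi_apply, ContinuousLinearMap.coe_coe, map_sub, Pi.zero_apply]
    rw [(hν i y₁ hy₁).2.2 (by rw [heq]), sub_self]
  have hns : LinearMap.range N ≠ ⊤ := by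
    intro htop
    have hinj : Function.Injective N :=
      (LinearMap.injective_iff_surjective_of_finrank_eq_finrank (by simp)).2
        (LinearMap.range_eq_top.1 htop)
    have := hinj (hker.trans (map_zero N).symm)
    exact hne (sub_eq_zero.1 this)
  obtain ⟨f, hf, hfk⟩ := Submodule.exists_le_ker_of_lt_top _ (lt_top_iff_ne_top.2 hns)
  set a : Fin n → ℝ := fun i => f (Pi.single i 1) with ha
  have hfa : ∀ z, ∑ i, a i * ν i z = 0 := by
    intro z
    have h1 : f (N z) = 0 := hfk ⟨z, rfl⟩
    rw [LinearMap.pi_apply_eq_sum_univ f (N z)] at h1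
    rw [← h1]
    refine Finset.sum_congr rfl fun i _ => ?_
    simp only [smul_eq_mul, N, LinearMap.pi_apply, ContinuousLinearMap.coe_coe, ha]
    rw [mul_comm]
    congr 2
    ext j
    simp [Pi.single_apply, eq_comm]
  have hane : ∃ i, a i ≠ 0 := by
    by_contra! h
    refine hf (LinearMap.pi_ext' fun i => LinearMap.ext_ring ?_)
    simpa using h i
  set σ : Fin n → ℝ := fun i => if 0 ≤ a i then 1 else -1 with hσ
  have haσ : ∀ i, a i * σ i = |a i| := by
    intro i
    by_cases h : 0 ≤ a i
    · simp [hσ, h, abs_of_nonneg h]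
    · simp [hσ, h, abs_of_neg (not_le.1 h)]
  have hσ2 : ∀ i, σ i * σ i = 1 := by
    intro i
    by_cases h : 0 ≤ a i <;> simp [hσ, h]
  -- The offset `2` exceeds the radius `1` of the ball, so every coordinate difference from `back
  -- y₀` keeps the sign `σ i`.
  set p : Rn n := back I t y₀ + WithLp.toLp 2 (fun i => 2 * σ i) with hp
  have hK : IsBody (Metric.closedBall p 1) := isBody_closedBall p one_pos
  obtain ⟨y, hy⟩ := reg_nonempty (I := I) (t := t) hK
  have hyr : y ∈ reach I t := ⟨_, hK, hy⟩
  have hball := H.back_mem hK hy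
  have hpos : ∀ i, 0 < σ i * (ν i y - ν i y₀) := by
    intro i
    have h1 : |back I t y i - p i| ≤ 1 := by
      have h2 := PiLp.norm_apply_le (back I t y - p) i
      rw [mem_closedBall_iff_norm] at hball
      simpa using h2.trans hball
    have h3 : p i = back I t y₀ i + 2 * σ i := by simp [hp]
    rw [h3, abs_le] at h1
    have h4 := hν i y hyr
    simp only [PiLp.proj_apply] at h4
    by_cases h : 0 ≤ a i
    · have hs1 : σ i = 1 := by simp [hσ, h]
      rw [hs1] at h1 ⊢
      have := h4.1 (by linarith)
      linarith
    · have hs1 : σ i = -1 := by simp [hσ, h]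
      rw [hs1] at h1 ⊢
      have := h4.2.1 (by linarith)
      linarith
  have hsum : ∑ i, a i * (ν i y - ν i y₀) = 0 := by
    simp only [mul_sub, Finset.sum_sub_distrib, hfa, sub_self]
  have hterm : ∀ i, a i * (ν i y - ν i y₀) = |a i| * (σ i * (ν i y - ν i y₀)) := by
    intro i
    rw [← haσ, ← mul_assoc, mul_assoc (a i), hσ2, mul_one]
  obtain ⟨i, hi⟩ := hane
  have : 0 < ∑ i, a i * (ν i y - ν i y₀) := by
    simp only [hterm]
    refine Finset.sum_pos' (fun j _ => mul_nonneg (abs_nonneg _) (hpos j).le)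
      ⟨i, Finset.mem_univ i, mul_pos (abs_pos.2 hi) (hpos i)⟩
  exact this.ne' hsum

/-- On the segment `back` is continuous with values in the target segment, and a linear function
parametrizes the latter; the intermediate value theorem applies. -/
theorem segment_subset_image (H : Setting n ζ I) {y y' : Rn n} (hy : y ∈ reach I t)
    (hy' : y' ∈ reach I t) :
    segment ℝ (back I t y) (back I t y') ⊆ back I t '' segment ℝ y y' := by
  rintro q ⟨a, b, ha, hb, hab, rfl⟩
  set x := back I t y
  set x' := back I t y'
  rcases eq_or_ne x x' with hxx | hxx
  · refine ⟨y, left_mem_segment ℝ _ _, ?_⟩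
    rw [← hxx, ← add_smul, hab, one_smul]
  set θ : Rn n →L[ℝ] ℝ := innerSL ℝ (x' - x)
  have hseg : segment ℝ y y' ⊆ reach I t := H.convex_reach.segment_subset hy hy'
  have hconn : IsPreconnected (segment ℝ y y') := (convex_segment y y').isPreconnected
  have hcont : ContinuousOn (fun z => θ (back I t z)) (segment ℝ y y') :=
    θ.continuous.comp_continuousOn (H.continuousOn_back.mono hseg)
  have hpos : 0 < θ x' - θ x := by
    rw [← map_sub]
    simp only [θ, innerSL_apply_apply, real_inner_self_eq_norm_sq]
    have : 0 < ‖x' - x‖ := norm_pos_iff.2 (sub_ne_zero.2 hxx.symm)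
    positivity
  have hmem : θ (a • x + b • x') ∈ Icc (θ x) (θ x') := by
    simp only [map_add, map_smul, smul_eq_mul]
    have : a = 1 - b := by linarith
    subst this
    constructor <;> nlinarith
  obtain ⟨z, hz, hzq⟩ := hconn.intermediate_value (left_mem_segment ℝ y y')
    (right_mem_segment ℝ y y') hcont hmem
  refine ⟨z, hz, ?_⟩
  obtain ⟨a', b', ha', hb', hab', hz'⟩ := H.back_segment_subset hy hy' hz
  change a' • x + b' • x' = back I t z at hz'
  simp only [← hz', map_add, map_smul, smul_eq_mul] at hzq
  have e1 : a' = 1 - b' := by linarith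
  have e2 : a = 1 - b := by linarith
  subst e1 e2
  have : (b' - b) * (θ x' - θ x) = 0 := by linarith
  have hbb : b' = b := by
    rcases mul_eq_zero.1 this with h | h
    · linarith
    · exact absurd h hpos.ne'
  rw [← hz', hbb]

/-- The range is convex, and dense because every small ball has a nonempty image. A dense convex set
in finite dimension is the whole space. -/
theorem surjOn_back (H : Setting n ζ I) : SurjOn (back I t) (reach I t) univ := by
  have hconv : Convex ℝ (back I t '' reach I t) := by
    refine convex_iff_segment_subset.2 ?_
    rintro _ ⟨y, hy, rfl⟩ _ ⟨y', hy', rfl⟩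
    exact (H.segment_subset_image hy hy').trans
      (image_mono (H.convex_reach.segment_subset hy hy'))
  have hdense : closure (back I t '' reach I t) = univ := by
    refine eq_univ_of_forall fun x => Metric.mem_closure_iff.2 fun ε hε => ?_
    have hK : IsBody (Metric.closedBall x (ε / 2)) := isBody_closedBall x (by positivity)
    obtain ⟨y, hy⟩ := reg_nonempty (I := I) (t := t) hK
    refine ⟨_, ⟨y, ⟨_, hK, hy⟩, rfl⟩, ?_⟩
    have := H.back_mem hK hy
    rw [Metric.mem_closedBall, dist_comm] at this
    linarith
  have hint : (interior (back I t '' reach I t)).Nonempty := by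
    rw [hconv.interior_nonempty_iff_affineSpan_eq_top]
    rw [← AffineSubspace.coe_eq_univ_iff, ← univ_subset_iff, ← hdense]
    exact closure_minimal (subset_affineSpan ℝ _) (AffineSubspace.closed_of_finiteDimensional _)
  have := hconv.interior_closure_eq_interior_of_nonempty_interior hint
  rw [hdense, interior_univ] at this
  intro x _
  exact interior_subset (this ▸ mem_univ x)

end Setting

end
end ConvexIsometry

/-! ### The reach is the whole space and the height is constant. -/

namespace ConvexIsometry
noncomputable section

variable {n : ℕ} {ζ : ℝ → ℝ} {u v : Rn n → EReal} {K L : Set (Rn n)}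
  {I : CVcn n → CVcn n} {t s : ℝ} {x y : Rn n} {θ : Rn n →L[ℝ] ℝ} {c : ℝ}

open Classical in
/-- The common value at `y` of the images of the functions that equal `t` on a body. -/
def height (I : CVcn n → CVcn n) (t : ℝ) (y : Rn n) : ℝ :=
  if h : y ∈ reach I t then ((I (h.choose_spec.choose.level t) : Rn n → EReal) y).toReal else 0

theorem eq_of_ae_of_continuousAt {f g : Rn n → ℝ} {O : Set (Rn n)} (hO : O ∈ 𝓝 y)
    (hf : ContinuousAt f y) (hg : ContinuousAt g y) (h : ∀ᵐ z, z ∈ O → f z = g z) : f y = g y := by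
  by_contra hne
  have hev : ∀ᶠ z in 𝓝 y, f z - g z ≠ 0 :=
    (hf.sub hg).eventually_ne (sub_ne_zero.2 hne)
  obtain ⟨z, h1, h2, h3⟩ := exists_of_ae_of_eventually h (hev.and hO)
  exact h2 (sub_eq_zero.2 (h1 h3))

/-- The moment condition makes `ζ` integrable at infinity, and the integral test applies. This is
the bound for tubes along which the height grows linearly. -/
theorem summable_zeta (hζ : IsMoment n ζ) (hc : 0 < c) (M : ℝ) :
    Summable fun k : ℕ => ζ (c * k - M) := by
  have hint : ∀ a, IntegrableOn ζ (Ioi a) := by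
    intro a
    have h1 : IntegrableOn ζ (Ioi 1) := by
      refine Integrable.mono' (hζ.moment.mono_set (Ioi_subset_Ioi zero_le_one))
        hζ.continuous.aestronglyMeasurable ?_
      filter_upwards [ae_restrict_mem measurableSet_Ioi] with r hr
      rw [Real.norm_of_nonneg (hζ.pos r).le]
      calc ζ r = ζ r * 1 := (mul_one _).symm
        _ ≤ ζ r * r ^ (n - 1) :=
          mul_le_mul_of_nonneg_left (one_le_pow₀ (le_of_lt hr)) (hζ.pos r).le
    have h2 : IntegrableOn ζ (Icc a 1) := hζ.continuous.continuousOn.integrableOn_Icc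
    refine (h2.union h1).mono_set fun z hz => ?_
    rcases le_or_gt z 1 with h | h
    · exact Or.inl ⟨le_of_lt hz, h⟩
    · exact Or.inr h
  have hg : IntegrableOn (fun r : ℝ => ζ (c * r - M)) (Ioi 0) := by
    have h1 : IntegrableOn (fun r : ℝ => ζ (r - M)) (Ioi 0) := by
      have := (measurePreserving_sub_right volume M).integrableOn_comp_preimage
        (MeasurableEquiv.subRight M).measurableEmbedding (f := ζ) (s := Ioi (0 - M))
      simpa [Function.comp_def] using this.2 (hint _)
    have := (integrableOn_Ioi_comp_mul_left_iff (fun r : ℝ => ζ (r - M)) 0 hc).2 (by simpa using h1)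
    exact this
  have hanti : Antitone fun r : ℝ => ζ (c * r - M) := fun a b hab =>
    hζ.strictAnti.antitone (by nlinarith)
  exact (hanti.antitoneOn _).summable_of_integrableOn_Ioi_zero hg fun r _ => (hζ.pos _).le

namespace Setting

/-- Any two bodies lie in a common ball, and the image of each is a restriction of the image of the
ball; continuity in the interior upgrades almost everywhere equality to equality at `y`. -/
theorem height_eq (H : Setting n ζ I) (hK : IsBody K) (hy : y ∈ reg I t hK) :
    height I t y = ((I (hK.level t) : Rn n → EReal) y).toReal := by
  have key : ∀ {K L : Set (Rn n)} (hK : IsBody K) (hL : IsBody L), K ⊆ L → y ∈ reg I t hK →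
      ((I (hK.level t) : Rn n → EReal) y).toReal = ((I (hL.level t) : Rn n → EReal) y).toReal := by
    intro K L hK hL hKL hyK
    have hyL := H.reg_mono hK hL hKL (le_refl t) hyK
    have h1 : img ζ I t hK y = img ζ I t hL y := by
      refine eq_of_ae_of_continuousAt ((isOpen_reg hK).mem_nhds hyK)
        (IsCVcn.continuousAt_comp H.moment (I _).2 hyK)
        (IsCVcn.continuousAt_comp H.moment (I _).2 hyL) ?_
      filter_upwards [H.img_eq_of_subset (t := t) hK hL hKL] with z hz hzK
      exact hz (H.img_pos hK hzK)
    rw [img, img, comp_of_mem (core_subset_dom hyK), comp_of_mem (core_subset_dom hyL)] at h1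
    exact H.moment.strictAnti.injective h1
  have hr : y ∈ reach I t := ⟨K, hK, hy⟩
  rw [height, dif_pos hr]
  set hK' := hr.choose_spec.choose with hK'def
  have hy' : y ∈ reg I t hK' := hr.choose_spec.choose_spec
  obtain ⟨k, -, hk, hKk⟩ := exists_ball_superset hK 0
  obtain ⟨k', -, hk', hKk'⟩ := exists_ball_superset hK' 0
  have hB : IsBody (Metric.closedBall (0 : Rn n) (max k k')) := isBody_closedBall 0 (by positivity)
  rw [key hK' hB (hKk'.trans (Metric.closedBall_subset_closedBall (le_max_right _ _))) hy',
    key hK hB (hKk.trans (Metric.closedBall_subset_closedBall (le_max_left _ _))) hy]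

theorem img_eq (H : Setting n ζ I) (hK : IsBody K) (hy : y ∈ reg I t hK) :
    img ζ I t hK y = ζ (height I t y) := by
  rw [H.height_eq hK hy, img, comp_of_mem (core_subset_dom hy)]

theorem convexOn_height (H : Setting n ζ I) : ConvexOn ℝ (reach I t) (height I t) := by
  refine ⟨H.convex_reach, fun y hy y' hy' a b ha hb hab => ?_⟩
  obtain ⟨k, hk, h1, h2⟩ := H.exists_ball_of_mem_reach hy hy'
  rw [H.height_eq _ h1, H.height_eq _ h2, H.height_eq _ (convex_reg _ h1 h2 ha hb hab)]
  exact (IsCVcn.convexOn (I _).2).2 (core_subset_dom h1) (core_subset_dom h2) ha hb hab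

theorem continuousOn_height (H : Setting n ζ I) : ContinuousOn (height I t) (reach I t) :=
  H.convexOn_height.continuousOn isOpen_reach

theorem lintegral_reg (H : Setting n ζ I) (hK : IsBody K) :
    ∫⁻ y in reg I t hK, ENNReal.ofReal (ζ (height I t y)) = ENNReal.ofReal (ζ t) * volume K := by
  rw [← H.lintegral_img hK, ← lintegral_indicator (isOpen_reg hK).measurableSet]
  refine lintegral_congr_ae ?_
  filter_upwards [H.ae_mem_reg (t := t) hK] with y hy
  by_cases h : y ∈ reg I t hK
  · rw [indicator_of_mem h, H.img_eq hK h]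
  · rw [indicator_of_notMem h, (H.img_nonneg hK y).antisymm' (not_lt.1 fun h' => h (hy h')),
      ENNReal.ofReal_zero]

/-- A set containing the images of infinitely many disjoint balls of equal radius has infinite
weight. -/
theorem lintegral_eq_top (H : Setting n ζ I) {S : Set (Rn n)} {r : ℝ} (hr : 0 < r) (z : ℕ → Rn n)
    (hz : Pairwise fun i j => Disjoint (Metric.closedBall (z i) r) (Metric.closedBall (z j) r))
    (hS : ∀ i, reg I t (isBody_closedBall (z i) hr) ⊆ S) :
    ∫⁻ y in S, ENNReal.ofReal (ζ (height I t y)) = ⊤ := by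
  rw [eq_top_iff]
  calc ⊤ = ∑' i : ℕ, ENNReal.ofReal (ζ t) * volume (Metric.closedBall (0 : Rn n) r) := by
        rw [ENNReal.tsum_const_eq_top_of_ne_zero]
        exact mul_ne_zero (ENNReal.ofReal_pos.2 (H.moment.pos t)).ne'
          (Metric.measure_closedBall_pos volume _ hr).ne'
    _ = ∑' i : ℕ, ∫⁻ y in reg I t (isBody_closedBall (z i) hr),
          ENNReal.ofReal (ζ (height I t y)) := by
        congr 1; ext i
        rw [H.lintegral_reg, Measure.addHaar_closedBall_center volume (z i) r]
    _ = ∫⁻ y in ⋃ i, reg I t (isBody_closedBall (z i) hr), ENNReal.ofReal (ζ (height I t y)) := by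
        rw [lintegral_iUnion (fun i => (isOpen_reg _).measurableSet)]
        intro i j hij
        exact H.reg_disjoint _ _ (by rw [(hz hij).inter_eq, measure_empty])
    _ ≤ _ := lintegral_mono_set (iUnion_subset hS)

/-- A convex set without interior lies in a hyperplane, but `back` avoids any given hyperplane
almost everywhere. -/
theorem interior_image_back_nonempty (H : Setting n ζ I) {B : Set (Rn n)} (hB : Convex ℝ B)
    (hBr : B ⊆ reach I t) (hBi : (interior B).Nonempty) : (interior (back I t '' B)).Nonempty := by
  have hconv : Convex ℝ (back I t '' B) := by
    refine convex_iff_segment_subset.2 ?_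
    rintro _ ⟨y, hy, rfl⟩ _ ⟨y', hy', rfl⟩
    exact (H.segment_subset_image (hBr hy) (hBr hy')).trans (image_mono (hB.segment_subset hy hy'))
  rw [hconv.interior_nonempty_iff_affineSpan_eq_top]
  by_contra hne
  obtain ⟨y₀, hy₀⟩ := hBi
  have hmem : ∀ y ∈ B, back I t y ∈ affineSpan ℝ (back I t '' B) := fun y hy =>
    subset_affineSpan ℝ _ ⟨y, hy, rfl⟩
  have h0 := hmem y₀ (interior_subset hy₀)
  have hdir : (affineSpan ℝ (back I t '' B)).direction ≠ ⊤ := fun h =>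
    hne ((AffineSubspace.direction_eq_top_iff_of_nonempty ⟨_, h0⟩).1 h)
  obtain ⟨f, hf, hfk⟩ := Submodule.exists_le_ker_of_lt_top _ (lt_top_iff_ne_top.2 hdir)
  have hf' : LinearMap.toContinuousLinearMap f ≠ 0 := fun h => hf (by simpa using h)
  obtain ⟨y, h1, h2⟩ := exists_of_ae_of_eventually
    (H.ae_back_ne (t := t) hf' (f (back I t y₀))) (mem_interior_iff_mem_nhds.1 hy₀)
  refine h1 (hBr h2) ?_
  have := hfk (AffineSubspace.vsub_mem_direction (hmem y h2) h0)
  rw [LinearMap.mem_ker, vsub_eq_sub, map_sub, sub_eq_zero] at this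
  exact this

/-- The part of the reach along a ray has infinite weight. -/
theorem lintegral_tube (H : Setting n ζ I) {y₀ y₁ : Rn n} (hy₀ : y₀ ∈ reach I t)
    (hy₁ : y₁ ∈ reach I t) (hne : y₁ ≠ y₀) {ρ : ℝ} (hρ : 0 < ρ)
    (hB : Metric.closedBall y₀ ρ ⊆ reach I t) :
    ∫⁻ y in {y | y ∈ reach I t ∧ ∃ b ∈ Metric.closedBall y₀ ρ, ∃ r : ℝ, 0 ≤ r ∧
      y₀ + r • (y₁ - y₀) ∈ reach I t ∧ y = b + r • (y₁ - y₀)},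
      ENNReal.ofReal (ζ (height I t y)) = ⊤ := by
  set w := y₁ - y₀ with hw
  set x₀ := back I t y₀ with hx₀
  set v := back I t y₁ - x₀ with hv
  have hv0 : v ≠ 0 := fun h => hne (H.injOn_back hy₁ hy₀ (sub_eq_zero.1 h))
  have hvp : 0 < ‖v‖ := norm_pos_iff.2 hv0
  obtain ⟨z₀, hz₀⟩ := H.interior_image_back_nonempty (convex_closedBall y₀ ρ) hB
    (isBody_closedBall y₀ hρ).nonempty
  obtain ⟨r, hr, hrB⟩ := Metric.nhds_basis_closedBall.mem_iff.1 (mem_interior_iff_mem_nhds.1 hz₀)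
  -- Consecutive centres are then `2 * r` apart, so the balls of radius `r / 2` are disjoint.
  set a := 2 * r / ‖v‖ with ha
  have hap : 0 < a := by positivity
  have hav : a * ‖v‖ = 2 * r := by rw [ha]; field_simp
  refine H.lintegral_eq_top (r := r / 2) (by positivity) (fun i : ℕ => z₀ + ((i + 1) * a) • v) ?_ ?_
  · intro i j hij
    refine Metric.closedBall_disjoint_closedBall ?_
    rw [dist_eq_norm, add_sub_add_left_eq_sub, ← sub_smul, norm_smul, Real.norm_eq_abs,
      show ((i : ℝ) + 1) * a - (j + 1) * a = (i - j) * a by ring, abs_mul, abs_of_pos hap,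
      mul_assoc, hav]
    have h1 : (1 : ℝ) ≤ |(i : ℝ) - j| := by
      have : (1 : ℤ) ≤ |(i : ℤ) - j| := Int.one_le_abs (by omega)
      exact_mod_cast this
    nlinarith
  · intro i z hz
    have hzr : z ∈ reach I t := ⟨_, _, hz⟩
    refine ⟨hzr, ?_⟩
    set q := back I t z with hq
    have hqC := H.back_mem _ hz
    rw [← hq, mem_closedBall_iff_norm] at hqC
    set l := ((i : ℝ) + 1) * a with hl
    have hlp : 0 < l := by positivity
    set q' := q - l • v with hq'
    have hq'n : ‖q' - z₀‖ ≤ r / 2 := by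
      rw [hq', sub_sub, add_comm]; exact hqC
    -- The bound by `l` gives `1 ≤ R` below; the other keeps `q' + ε • (q' - x₀)` in the ball of
    -- radius `r` about `z₀`.
    obtain ⟨ε, hε, hε1, hε2⟩ : ∃ ε : ℝ, 0 < ε ∧ ε ≤ l ∧ ε * (‖z₀ - x₀‖ + r) ≤ r / 2 := by
      refine ⟨min l (r / 2 / (‖z₀ - x₀‖ + r)), by positivity, min_le_left _ _, ?_⟩
      rw [← le_div_iff₀ (by positivity)]
      exact min_le_right _ _
    -- With this `R`, the weights `1 / (1 + ε)` and `ε / (1 + ε)` combine `q' + ε • (q' - x₀)` and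
    -- `x₀ + R • v` into exactly `q = q' + l • v`.
    set R := l * (1 + ε) / ε with hR
    have hR1 : 1 ≤ R := by
      rw [hR, le_div_iff₀ hε]; nlinarith
    -- `q` lies between a point of the image of the ball and a remote point of the ray.
    obtain ⟨b, hb, hbc⟩ : q' + ε • (q' - x₀) ∈ back I t '' Metric.closedBall y₀ ρ := by
      refine hrB ?_
      rw [mem_closedBall_iff_norm, show q' + ε • (q' - x₀) - z₀ = (q' - z₀) + ε • (q' - x₀) by abel]
      refine (norm_add_le _ _).trans ?_
      rw [norm_smul, Real.norm_of_nonneg hε.le]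
      have h1 : ‖q' - x₀‖ ≤ ‖z₀ - x₀‖ + r := by
        have := norm_add_le (q' - z₀) (z₀ - x₀)
        rw [sub_add_sub_cancel] at this
        linarith
      have := mul_le_mul_of_nonneg_left h1 hε.le
      linarith
    obtain ⟨yR, hyR, hyRx⟩ := H.surjOn_back (t := t) (mem_univ (x₀ + R • v))
    have hseg1 : y₁ ∈ segment ℝ y₀ yR := by
      have h1 : back I t y₁ ∈ segment ℝ (back I t y₀) (back I t yR) := by
        refine ⟨1 - 1 / R, 1 / R, ?_, by positivity, by ring, ?_⟩
        · rw [sub_nonneg, div_le_one (by positivity)]; exact hR1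
        · rw [hyRx, ← hx₀, smul_add, smul_smul, one_div, inv_mul_cancel₀ (by positivity), one_smul,
            ← add_assoc, ← add_smul, sub_add_cancel, one_smul, hv]
          abel
      obtain ⟨y', hy', hy'x⟩ := H.segment_subset_image hy₀ hyR h1
      rwa [← H.injOn_back (H.convex_reach.segment_subset hy₀ hyR hy') hy₁ hy'x]
    obtain ⟨σ, hσ, hyRσ⟩ : ∃ σ : ℝ, 0 ≤ σ ∧ yR = y₀ + σ • w := by
      obtain ⟨α, β, hα, hβ, hαβ, h⟩ := hseg1
      have hw2 : w = β • (yR - y₀) := by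
        rw [hw, ← h, show α = 1 - β by linarith, sub_smul, smul_sub, one_smul]; abel
      have hβ0 : β ≠ 0 := by
        rintro rfl
        rw [zero_smul, hw] at hw2
        exact hne (sub_eq_zero.1 hw2)
      refine ⟨β⁻¹, by positivity, ?_⟩
      rw [hw2, smul_smul, inv_mul_cancel₀ hβ0, one_smul]; abel
    have hseg2 : q ∈ segment ℝ (back I t b) (back I t yR) := by
      refine ⟨1 / (1 + ε), ε / (1 + ε), by positivity, by positivity, by field_simp, ?_⟩
      rw [hbc, hyRx]
      have e1 : (1 / (1 + ε)) • (q' + ε • (q' - x₀)) + (ε / (1 + ε)) • (x₀ + R • v)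
          = ((1 / (1 + ε)) * (1 + ε)) • q' + (ε / (1 + ε) * R) • v := by
        rw [div_eq_inv_mul ε, ← one_div]
        module
      rw [e1, one_div, inv_mul_cancel₀ (by positivity), one_smul, hR,
        show ε / (1 + ε) * (l * (1 + ε) / ε) = l by field_simp, hq', sub_add_cancel]
    -- By injectivity `z` lies on the segment from `b` to `yR`; since `yR` is on the ray from `y₀`,
    -- this places `z` in the tube.
    have hbr : b ∈ reach I t := hB hb
    obtain ⟨z', hz', hz'q⟩ := H.segment_subset_image hbr hyR hseg2
    have hzz : z' = z := H.injOn_back (H.convex_reach.segment_subset hbr hyR hz') hzr hz'q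
    rw [hzz] at hz'
    obtain ⟨α, β, hα, hβ, hαβ, h⟩ := hz'
    refine ⟨α • b + β • y₀, convex_closedBall y₀ ρ hb (Metric.mem_closedBall_self hρ.le) hα hβ hαβ,
      β * σ, by positivity, ?_, ?_⟩
    · have := H.convex_reach hy₀ hyR hα hβ hαβ
      convert this using 1
      rw [hyRσ, show α = 1 - β by linarith]
      module
    · rw [← h, hyRσ]
      module

/-- The height is bounded below on bounded parts of the reach. -/
theorem height_bddBelow (H : Setting n ζ I) {y₀ : Rn n} (hy₀ : y₀ ∈ reach I t) {R : ℝ}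
    (hR : 0 < R) : ∃ M, ∀ z ∈ reach I t, ‖z - y₀‖ ≤ R → -M ≤ height I t z := by
  obtain ⟨ρ, hρ, hB⟩ := Metric.nhds_basis_closedBall.mem_iff.1 (isOpen_reach.mem_nhds hy₀)
  obtain ⟨M₀, hM₀⟩ := (isCompact_closedBall y₀ ρ).bddAbove_image (H.continuousOn_height.mono hB)
  set ε := ρ / R with hε
  have hεp : 0 < ε := by positivity
  refine ⟨-(((1 + ε) * height I t y₀ - M₀) / ε), fun z hz hzR => ?_⟩
  rw [neg_neg, div_le_iff₀ hεp]
  -- The point opposite to `z` lies in a ball where the height is bounded above; as `y₀` is between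
  -- the two, convexity bounds the height at `z` from below.
  have hz'B : y₀ - ε • (z - y₀) ∈ Metric.closedBall y₀ ρ := by
    rw [mem_closedBall_iff_norm, sub_sub_cancel_left, norm_neg, norm_smul,
      Real.norm_of_nonneg hεp.le]
    calc ε * ‖z - y₀‖ ≤ ε * R := by gcongr
      _ = ρ := by rw [hε]; field_simp
  have h1 := hM₀ ⟨_, hz'B, rfl⟩
  have h2 := H.convexOn_height.2 (hB hz'B) hz (show 0 ≤ 1 / (1 + ε) by positivity)
    (show 0 ≤ ε / (1 + ε) by positivity) (by field_simp)
  have h3 : (1 / (1 + ε)) • (y₀ - ε • (z - y₀)) + (ε / (1 + ε)) • z = y₀ := by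
    have : (1 / (1 + ε)) • (y₀ - ε • (z - y₀)) + (ε / (1 + ε)) • z
        = ((1 / (1 + ε)) * (1 + ε)) • y₀ := by
      rw [div_eq_inv_mul ε, ← one_div]; module
    rw [this, one_div, inv_mul_cancel₀ (by positivity), one_smul]
  rw [h3, smul_eq_mul, smul_eq_mul, div_mul_eq_mul_div, div_mul_eq_mul_div, ← add_div,
    le_div_iff₀ (by positivity)] at h2
  linarith

theorem lintegral_le_of_height_ge (H : Setting n ζ I) {S A : Set (Rn n)} {M : ℝ}
    (hS : ∀ z ∈ S, z ∈ reach I t ∧ z ∈ A ∧ M ≤ height I t z) (hA : MeasurableSet A) :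
    ∫⁻ y in S, ENNReal.ofReal (ζ (height I t y)) ≤ ENNReal.ofReal (ζ M) * volume A := by
  set T := (A ∩ reach I t) \ (reach I t ∩ height I t ⁻¹' Iio M) with hT
  have hTm : MeasurableSet T := (hA.inter isOpen_reach.measurableSet).diff
    (H.continuousOn_height.isOpen_inter_preimage isOpen_reach isOpen_Iio).measurableSet
  calc ∫⁻ y in S, ENNReal.ofReal (ζ (height I t y))
      ≤ ∫⁻ y in T, ENNReal.ofReal (ζ (height I t y)) :=
        lintegral_mono_set fun z hz => ⟨⟨(hS z hz).2.1, (hS z hz).1⟩,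
          fun h => not_lt.2 (hS z hz).2.2 h.2⟩
    _ ≤ ∫⁻ _ in T, ENNReal.ofReal (ζ M) := by
        refine setLIntegral_mono' hTm fun z hz => ENNReal.ofReal_le_ofReal
          (H.moment.strictAnti.antitone (not_lt.1 fun h => hz.2 ⟨hz.1.2, h⟩))
    _ = ENNReal.ofReal (ζ M) * volume T := setLIntegral_const _ _
    _ ≤ _ := by gcongr; exact fun z hz => hz.1.1

/-- The tube towards a missing point `y` stops before `y`, so it is bounded. The height is bounded
below on it, so its weight is finite, against `lintegral_tube`. -/
theorem reach_eq_univ (H : Setting n ζ I) : reach I t = univ := by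
  obtain ⟨y₀, hy₀'⟩ := reg_nonempty (I := I) (t := t) (isBody_closedBall (0 : Rn n) one_pos)
  have hy₀ : y₀ ∈ reach I t := ⟨_, _, hy₀'⟩
  refine eq_univ_of_forall fun y => by_contra fun hy => ?_
  have hyne : y ≠ y₀ := fun h => hy (h ▸ hy₀)
  have hcont : ContinuousAt (fun ε : ℝ => y₀ + ε • (y - y₀)) 0 := by fun_prop
  have hev : ∀ᶠ ε : ℝ in 𝓝[>] 0, y₀ + ε • (y - y₀) ∈ reach I t :=
    (hcont.eventually (by simpa using isOpen_reach.mem_nhds hy₀)).filter_mono nhdsWithin_le_nhds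
  obtain ⟨ε, h1, h2⟩ := (hev.and self_mem_nhdsWithin).exists
  have h2 : 0 < ε := h2
  obtain ⟨ρ, hρ, hB⟩ := Metric.nhds_basis_closedBall.mem_iff.1 (isOpen_reach.mem_nhds hy₀)
  have hne : y₀ + ε • (y - y₀) ≠ y₀ := by
    simp [h2.ne', sub_eq_zero, hyne]
  have htop := H.lintegral_tube hy₀ h1 hne hρ hB
  have hR : 0 < ρ + ‖y - y₀‖ := by positivity
  obtain ⟨M, hM⟩ := H.height_bddBelow hy₀ hR
  refine absurd htop (ne_top_of_le_ne_top ?_ (H.lintegral_le_of_height_ge (M := -M)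
    (A := Metric.closedBall y₀ (ρ + ‖y - y₀‖)) ?_ Metric.isClosed_closedBall.measurableSet))
  · exact ENNReal.mul_ne_top ENNReal.ofReal_ne_top measure_closedBall_lt_top.ne
  · rintro z ⟨hz, b, hb, r, hr, hyr, rfl⟩
    rw [add_sub_cancel_left, smul_smul] at hyr hz ⊢
    have hr1 : r * ε < 1 := by
      by_contra! h
      refine hy (H.convex_reach.segment_subset hy₀ hyr
        ⟨1 - 1 / (r * ε), 1 / (r * ε), ?_, by positivity, by ring, ?_⟩)
      · rw [sub_nonneg, div_le_one (by linarith)]; exact h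
      · rw [smul_add, smul_smul, one_div, inv_mul_cancel₀ (by linarith)]
        module
    have hzR : ‖b + (r * ε) • (y - y₀) - y₀‖ ≤ ρ + ‖y - y₀‖ := by
      rw [add_sub_right_comm]
      refine (norm_add_le _ _).trans (add_le_add (mem_closedBall_iff_norm.1 hb) ?_)
      rw [norm_smul, Real.norm_of_nonneg (by positivity)]
      exact mul_le_of_le_one_left (norm_nonneg _) hr1.le
    exact ⟨hz, mem_closedBall_iff_norm.2 hzR, hM _ hz hzR⟩

theorem mem_reach (H : Setting n ζ I) (y : Rn n) : y ∈ reach I t := H.reach_eq_univ ▸ mem_univ y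

/-- If the convex height increased from `y₀` to `y₁`, it would grow at least linearly along all
parallel rays from a small ball about `y₀`. Cutting the tube into unit pieces would bound its weight
by a convergent series of values of `ζ`, against `lintegral_tube`. -/
theorem height_le (H : Setting n ζ I) (y₀ y₁ : Rn n) : height I t y₁ ≤ height I t y₀ := by
  by_contra! hlt
  have hconv : ConvexOn ℝ univ (height I t) := H.reach_eq_univ ▸ H.convexOn_height
  have hcont : Continuous (height I t) := by
    rw [← continuousOn_univ, ← H.reach_eq_univ (t := t)]; exact H.continuousOn_height
  have hne : y₁ ≠ y₀ := fun h => hlt.ne (h ▸ rfl)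
  set w := y₁ - y₀ with hw
  set c := (height I t y₁ - height I t y₀) / 2 with hc
  have hcp : 0 < c := by rw [hc]; linarith
  obtain ⟨ρ, hρ, hB⟩ : ∃ ρ > 0, ∀ b ∈ Metric.closedBall y₀ ρ,
      height I t b + c < height I t (b + w) := by
    have h1 : Continuous fun b => height I t b + c := by fun_prop
    have h2 : Continuous fun b => height I t (b + w) := by fun_prop
    have h3 : ∀ᶠ b in 𝓝 y₀, height I t b + c < height I t (b + w) := by
      refine (isOpen_lt h1 h2).mem_nhds ?_
      change height I t y₀ + c < height I t (y₀ + w)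
      rw [hw, add_sub_cancel, hc]
      linarith
    exact Metric.nhds_basis_closedBall.mem_iff.1 h3
  set R := ρ + ‖w‖ with hR
  obtain ⟨M, hM⟩ := H.height_bddBelow (t := t) (H.mem_reach y₀) (R := R) (by positivity)
  have hlow : ∀ b ∈ Metric.closedBall y₀ ρ, ∀ r : ℝ, 0 ≤ r →
      c * r - (M + c) ≤ height I t (b + r • w) := by
    intro b hb r hr
    have hbn := mem_closedBall_iff_norm.1 hb
    rcases le_or_gt 1 r with h | h
    · have h0 : -M ≤ height I t b := hM b (H.mem_reach b) (hbn.trans (by rw [hR]; simp))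
      have h1 := hconv.2 (mem_univ b) (mem_univ (b + r • w))
        (show 0 ≤ 1 - 1 / r by rw [sub_nonneg, div_le_one (by linarith)]; exact h)
        (show 0 ≤ 1 / r by positivity) (by ring)
      have h2 : (1 - 1 / r) • b + (1 / r) • (b + r • w) = b + w := by
        rw [smul_add, smul_smul, one_div, inv_mul_cancel₀ (by linarith)]
        module
      rw [h2, smul_eq_mul, smul_eq_mul] at h1
      have h3 := hB b hb
      have h4 : r * ((1 - 1 / r) * height I t b + 1 / r * height I t (b + r • w))
          = (r - 1) * height I t b + height I t (b + r • w) := by field_simp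
      have h5 := mul_le_mul_of_nonneg_left (h3.le.trans h1) hr
      rw [h4] at h5
      linarith
    · have h0 : -M ≤ height I t (b + r • w) := by
        refine hM _ (H.mem_reach _) ?_
        rw [add_sub_right_comm]
        refine (norm_add_le _ _).trans (add_le_add hbn ?_)
        rw [norm_smul, Real.norm_of_nonneg hr]
        exact mul_le_of_le_one_left (norm_nonneg _) h.le
      nlinarith
  have htop := H.lintegral_tube (H.mem_reach y₀) (H.mem_reach y₁) hne hρ
    (fun z _ => H.mem_reach z) (t := t)
  -- The piece of the tube with parameter in `[k, k + 1)` lies in a ball of radius `R` about `y₀ + k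
  -- • w`.
  set S : ℕ → Set (Rn n) := fun k =>
    {z | z ∈ Metric.closedBall (y₀ + (k : ℝ) • w) R ∧ c * k - (M + c) ≤ height I t z} with hS
  refine absurd htop (ne_top_of_le_ne_top ?_ ((lintegral_mono_set (t := ⋃ k, S k) ?_).trans
    ((lintegral_iUnion_le _ _).trans (ENNReal.tsum_le_tsum fun k =>
      H.lintegral_le_of_height_ge (M := c * k - (M + c)) (fun z hz => ⟨H.mem_reach z, hz⟩)
        Metric.isClosed_closedBall.measurableSet))))
  · simp_rw [Measure.addHaar_closedBall_center volume _ R]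
    rw [ENNReal.tsum_mul_right]
    exact ENNReal.mul_ne_top (summable_zeta H.moment hcp _).tsum_ofReal_ne_top
      measure_closedBall_lt_top.ne
  · rintro z ⟨-, b, hb, r, hr, -, rfl⟩
    have h1 : (⌊r⌋₊ : ℝ) ≤ r := Nat.floor_le hr
    have h2 : r < ⌊r⌋₊ + 1 := Nat.lt_floor_add_one r
    refine mem_iUnion.2 ⟨⌊r⌋₊, ?_, ?_⟩
    · rw [mem_closedBall_iff_norm, ← hw, show b + r • w - (y₀ + (⌊r⌋₊ : ℝ) • w)
        = (b - y₀) + (r - ⌊r⌋₊) • w by module]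
      refine (norm_add_le _ _).trans (add_le_add (mem_closedBall_iff_norm.1 hb) ?_)
      rw [norm_smul, Real.norm_of_nonneg (by linarith)]
      exact mul_le_of_le_one_left (norm_nonneg _) (by linarith)
    · exact le_trans (by nlinarith) (hlow b hb r hr)

end Setting

end
end ConvexIsometry

/-! ### Images of general functions and preservation of midpoints. -/

namespace ConvexIsometry
noncomputable section

variable {n : ℕ} {ζ : ℝ → ℝ} {u v : Rn n → EReal} {K L : Set (Rn n)}
  {I : CVcn n → CVcn n} {t s : ℝ} {x y : Rn n} {θ : Rn n →L[ℝ] ℝ} {c : ℝ}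

/-- The point map of an isometry. -/
def pointMap (I : CVcn n → CVcn n) : Rn n → Rn n := back I 0

/-- The value to which an isometry sends the value `t`. -/
def levelMap (I : CVcn n → CVcn n) (t : ℝ) : ℝ := height I t 0

/-- The factor by which an isometry rescales `ζ`. -/
def ratio (ζ : ℝ → ℝ) (I : CVcn n → CVcn n) : ℝ := ζ (levelMap I 0) / ζ 0

theorem closure_subset_of_ae {O C : Set (Rn n)} (hO : IsOpen O) (hC : IsClosed C)
    (h : ∀ᵐ z, z ∈ O → z ∈ C) : closure O ⊆ C := by
  refine closure_minimal (fun z hz => by_contra fun hzC => ?_) hC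
  obtain ⟨w, h1, h2, h3⟩ := exists_of_ae_of_eventually (y := z) h
    (inter_mem (hO.mem_nhds hz) (hC.isOpen_compl.mem_nhds hzC))
  exact h3 (h1 h2)

theorem volume_closure_reg (hK : IsBody K) :
    volume (closure (reg I t hK)) = volume (reg I t hK) := by
  refine le_antisymm ?_ (measure_mono subset_closure)
  rw [closure_eq_self_union_frontier]
  refine (measure_union_le _ _).trans ?_
  rw [(convex_reg hK).addHaar_frontier volume, add_zero]

namespace Setting

theorem height_eq_levelMap (H : Setting n ζ I) (y : Rn n) : height I t y = levelMap I t :=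
  le_antisymm (H.height_le 0 y) (H.height_le y 0)

/-- Raising the level shrinks the images of bodies, so correspondence at a higher level implies
correspondence at a lower one; uniqueness identifies the points. -/
theorem back_eq (H : Setting n ζ I) (y : Rn n) : back I t y = pointMap I y := by
  have key : ∀ {s t : ℝ}, s ≤ t → back I t y = back I s y := fun {s t} hst =>
    H.corresponds_unique (t := s) (H.mem_reach y)
      (fun K hK hx => closure_mono (H.reg_mono hK hK Subset.rfl hst)
        (H.corresponds_back (H.mem_reach y) K hK hx))
      (H.corresponds_back (H.mem_reach y))
  rcases le_total t 0 with h | h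
  · exact (key h).symm
  · exact key h

theorem volume_reg (H : Setting n ζ I) (hK : IsBody K) :
    ENNReal.ofReal (ζ (levelMap I t)) * volume (reg I t hK) = ENNReal.ofReal (ζ t) * volume K := by
  rw [← H.lintegral_reg hK]
  simp_rw [H.height_eq_levelMap, setLIntegral_const]

theorem pointMap_mem (H : Setting n ζ I) (hK : IsBody K) (hy : y ∈ reg I t hK) :
    pointMap I y ∈ K := H.back_eq (t := t) y ▸ H.back_mem hK hy

theorem mem_closure_of_pointMap (H : Setting n ζ I) (hK : IsBody K)
    (h : pointMap I y ∈ interior K) (t : ℝ) : y ∈ closure (reg I t hK) :=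
  H.mem_closure_reg hK (H.mem_reach y) (H.back_eq (t := t) y ▸ h)

/-- Up to null sets, the image domain is the preimage of `K` under the point map, whatever the
level. -/
theorem volume_reg_eq (H : Setting n ζ I) (hK : IsBody K) (s t : ℝ) :
    volume (reg I s hK) = volume (reg I t hK) := by
  have key : ∀ s t, volume (reg I s hK) ≤ volume (reg I t hK) := by
    intro s t
    rw [← volume_closure_reg (t := t) hK]
    refine measure_mono_ae ?_
    filter_upwards [H.ae_back_mem_interior (t := s) hK] with y h1 h2
    exact H.mem_closure_of_pointMap hK (H.back_eq (t := s) y ▸ h1 h2) t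
  exact le_antisymm (key s t) (key t s)

theorem ratio_pos (H : Setting n ζ I) : 0 < ratio ζ I := div_pos (H.moment.pos _) (H.moment.pos _)

/-- The mass of the image of a ball is `ζ (levelMap t)` times a volume independent of `t`, and it
equals `ζ t` times the volume of the ball. -/
theorem zeta_levelMap (H : Setting n ζ I) (t : ℝ) : ζ (levelMap I t) = ratio ζ I * ζ t := by
  have hK : IsBody (Metric.closedBall (0 : Rn n) 1) := isBody_closedBall 0 one_pos
  have h : ∀ t, ζ (levelMap I t) * volume.real (reg I 0 hK) = ζ t *
      volume.real (Metric.closedBall (0 : Rn n) 1) := by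
    intro t
    have h1 := congrArg ENNReal.toReal (H.volume_reg (t := t) hK)
    rwa [ENNReal.toReal_mul, ENNReal.toReal_mul, ENNReal.toReal_ofReal (H.moment.pos _).le,
      ENNReal.toReal_ofReal (H.moment.pos _).le, H.volume_reg_eq hK t 0] at h1
  have h0 := h 0
  have hV := hK.volume_pos
  have hR : volume.real (reg I 0 hK) ≠ 0 := by
    intro h1
    rw [h1, mul_zero] at h0
    exact (mul_pos (H.moment.pos 0) hV).ne h0
  have hz := (H.moment.pos 0).ne'
  rw [ratio, div_mul_eq_mul_div, eq_div_iff hz]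
  refine mul_right_cancel₀ (mul_ne_zero hR hV.ne') ?_
  linear_combination h t * ζ 0 * volume.real (Metric.closedBall (0 : Rn n) 1)
    - h0 * ζ t * volume.real (Metric.closedBall (0 : Rn n) 1)

theorem strictMono_levelMap (H : Setting n ζ I) : StrictMono (levelMap I) := by
  intro s t hst
  rw [← H.moment.strictAnti.lt_iff_gt, H.zeta_levelMap, H.zeta_levelMap]
  exact mul_lt_mul_of_pos_left (H.moment.strictAnti hst) H.ratio_pos

theorem img_of_mem (H : Setting n ζ I) (hK : IsBody K) (hy : y ∈ reg I t hK) :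
    img ζ I t hK y = ratio ζ I * ζ t := by
  rw [H.img_eq hK hy, H.height_eq_levelMap, H.zeta_levelMap]

theorem continuous_pointMap (H : Setting n ζ I) : Continuous (pointMap I) := by
  rw [← continuousOn_univ, ← H.reach_eq_univ (t := 0)]
  exact H.continuousOn_back

theorem bijective_pointMap (H : Setting n ζ I) : Function.Bijective (pointMap I) := by
  refine ⟨fun y y' h => H.injOn_back (H.mem_reach y) (H.mem_reach y') h, fun x => ?_⟩
  obtain ⟨y, -, hy⟩ := H.surjOn_back (t := 0) (mem_univ x)
  exact ⟨y, hy⟩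

/-- Order preservation compares `u` with the function equal to `t` on a small ball; closed
superlevel sets carry the bound to `y`, which is only in the closure of the image domain. -/
theorem le_comp_of_le (H : Setting n ζ I) (u : CVcn n)
    (h : ∀ᶠ x in 𝓝 (pointMap I y), (u : Rn n → EReal) x ≤ t) :
    ratio ζ I * ζ t ≤ comp ζ (I u : Rn n → EReal) y := by
  obtain ⟨r, hr, hrt⟩ := Metric.nhds_basis_closedBall.mem_iff.1 h
  have hK := isBody_closedBall (pointMap I y) hr
  refine closure_subset_of_ae (isOpen_reg (I := I) (t := t) hK)
    (IsCVcn.isClosed_superlevel H.moment (I u).2) ?_ (H.mem_closure_of_pointMap hK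
      (Metric.ball_subset_interior_closedBall (Metric.mem_ball_self hr)) t)
  have h1 := H.ae_le_of_le (u := hK.level t) (v := u) fun z => by
    by_cases hz : z ∈ Metric.closedBall (pointMap I y) r
    · simp only [IsBody.level, bodyFun_of_mem hz]
      exact hrt hz
    · simp only [IsBody.level, bodyFun_of_not_mem hz, le_top]
  filter_upwards [h1] with z hz hzr
  rw [← H.img_of_mem hK hzr]
  exact hz

theorem mul_comp_le (H : Setting n ζ I) (u : CVcn n) (hy : pointMap I y ∈ core (u : Rn n → EReal)) :
    ratio ζ I * comp ζ (u : Rn n → EReal) (pointMap I y) ≤ comp ζ (I u : Rn n → EReal) y := by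
  rw [comp_of_mem (core_subset_dom hy)]
  set a := ((u : Rn n → EReal) (pointMap I y)).toReal with ha
  have h1 : Tendsto (fun t => ratio ζ I * ζ t) (𝓝[>] a) (𝓝 (ratio ζ I * ζ a)) :=
    ((continuous_const.mul H.moment.continuous).tendsto a).mono_left nhdsWithin_le_nhds
  refine le_of_tendsto h1 ?_
  filter_upwards [self_mem_nhdsWithin] with t ht
  have hc := (IsCVcn.continuousOn_toReal u.2).continuousAt (isOpen_core.mem_nhds hy)
  refine H.le_comp_of_le u ?_
  filter_upwards [hc.eventually (gt_mem_nhds ht), isOpen_core.mem_nhds hy] with z hz hzc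
  rw [← IsCVcn.coe_toReal u.2 (core_subset_dom hzc)]
  exact_mod_cast hz.le

theorem preimage_core_subset (H : Setting n ζ I) (u : CVcn n) :
    pointMap I ⁻¹' core (u : Rn n → EReal) ⊆ core (I u : Rn n → EReal) := by
  refine interior_maximal (fun y hy => ?_) (isOpen_core.preimage H.continuous_pointMap)
  exact (comp_pos_iff H.moment).1 ((mul_pos H.ratio_pos
    ((comp_pos_iff H.moment).2 (core_subset_dom hy))).trans_le (H.mul_comp_le u hy))

/-- Where `u ≥ t` on a ball, the minimum of `ζ ∘ u` with the level function of the ball is the same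
at levels `t` and `t - 1`. As integrals of minima are preserved, the image of `u` cannot exceed the
image level of `t` anywhere near `y`. -/
theorem comp_le_of_ge (H : Setting n ζ I) (u : CVcn n)
    (hy : pointMap I y ∈ core (u : Rn n → EReal))
    (h : ∀ᶠ x in 𝓝 (pointMap I y), (t : EReal) ≤ (u : Rn n → EReal) x) :
    comp ζ (I u : Rn n → EReal) y ≤ ratio ζ I * ζ t := by
  obtain ⟨r, hr, hrt⟩ := Metric.nhds_basis_closedBall.mem_iff.1 h
  have hK := isBody_closedBall (pointMap I y) hr
  have hcl := H.mem_closure_of_pointMap hK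
    (Metric.ball_subset_interior_closedBall (Metric.mem_ball_self hr)) t
  have hmin : ∀ s ≤ t, ∀ x, min (comp ζ (u : Rn n → EReal) x) (comp ζ (hK.level s : Rn n → EReal) x)
      = (Metric.closedBall (pointMap I y) r).indicator (comp ζ (u : Rn n → EReal)) x := by
    intro s hs x
    rw [comp_level]
    by_cases hx : x ∈ Metric.closedBall (pointMap I y) r
    · rw [indicator_of_mem hx, indicator_of_mem hx, min_eq_left]
      have h1 : (t : EReal) ≤ (u : Rn n → EReal) x := hrt hx
      have h2 := zetaExt_anti H.moment (EReal.coe_ne_bot t) h1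
      have h3 : zetaExt ζ (t : EReal) = ζ t := by simp [zetaExt]
      rw [h3] at h2
      exact h2.trans (H.moment.strictAnti.antitone hs)
    · rw [indicator_of_notMem hx, indicator_of_notMem hx, min_eq_right (comp_nonneg H.moment x)]
  have hst : t - 1 ≤ t := by linarith
  have hle := H.img_le hK hK Subset.rfl hst
  have heq := ae_eq_of_le_of_integral_eq (H.integrable_min (I u) (I (hK.level t)))
    (H.integrable_min (I u) (I (hK.level (t - 1))))
    (by filter_upwards [hle] with z hz using min_le_min_left _ hz)
    (by
      rw [H.integral_min, H.integral_min]
      simp_rw [hmin t le_rfl, hmin (t - 1) hst]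
      exact le_rfl)
  by_contra! hlt
  have hev := (IsCVcn.continuousAt_comp H.moment (I u).2 (H.preimage_core_subset u hy)).eventually
    (lt_mem_nhds hlt)
  obtain ⟨O, hO, hOo, hyO⟩ := eventually_nhds_iff.1 hev
  obtain ⟨p, hp, hpr⟩ := mem_closure_iff.1 hcl O hOo hyO
  obtain ⟨z, h1, h2, h3⟩ := exists_of_ae_of_eventually heq
    (inter_mem (hOo.mem_nhds hp) ((isOpen_reg hK).mem_nhds hpr))
  have h4 : comp ζ (I (hK.level t) : Rn n → EReal) z = ratio ζ I * ζ t := H.img_of_mem hK h3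
  have h5 : comp ζ (I (hK.level (t - 1)) : Rn n → EReal) z = ratio ζ I * ζ (t - 1) :=
    H.img_of_mem hK (H.reg_mono hK hK Subset.rfl hst h3)
  rw [h4, h5, min_eq_right (hO z h2).le] at h1
  have h6 : ratio ζ I * ζ t < ratio ζ I * ζ (t - 1) :=
    mul_lt_mul_of_pos_left (H.moment.strictAnti (by linarith)) H.ratio_pos
  exact (lt_min (hO z h2) h6).ne h1

/-- The image of a function in terms of the point map and the ratio. -/
theorem comp_eq_of_mem_core (H : Setting n ζ I) (u : CVcn n)
    (hy : pointMap I y ∈ core (u : Rn n → EReal)) :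
    comp ζ (I u : Rn n → EReal) y = ratio ζ I * comp ζ (u : Rn n → EReal) (pointMap I y) := by
  refine le_antisymm ?_ (H.mul_comp_le u hy)
  rw [comp_of_mem (core_subset_dom hy)]
  set a := ((u : Rn n → EReal) (pointMap I y)).toReal with ha
  have h1 : Tendsto (fun t => ratio ζ I * ζ t) (𝓝[<] a) (𝓝 (ratio ζ I * ζ a)) :=
    ((continuous_const.mul H.moment.continuous).tendsto a).mono_left nhdsWithin_le_nhds
  refine ge_of_tendsto h1 ?_
  filter_upwards [self_mem_nhdsWithin] with t ht
  have hc := (IsCVcn.continuousOn_toReal u.2).continuousAt (isOpen_core.mem_nhds hy)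
  refine H.comp_le_of_ge u hy ?_
  filter_upwards [hc.eventually (lt_mem_nhds ht), isOpen_core.mem_nhds hy] with z hz hzc
  rw [← IsCVcn.coe_toReal u.2 (core_subset_dom hzc)]
  exact_mod_cast hz.le

/-- A small ball missing the domain of `u` has an image disjoint from that of `u`, but `y` adheres
to the image of the ball. -/
theorem core_subset_preimage (H : Setting n ζ I) (u : CVcn n) :
    core (I u : Rn n → EReal) ⊆ pointMap I ⁻¹' closure (dom (u : Rn n → EReal)) := by
  intro y hy
  by_contra hn
  obtain ⟨r, hr, hrt⟩ := Metric.nhds_basis_closedBall.mem_iff.1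
    (isClosed_closure.isOpen_compl.mem_nhds hn)
  have hK := isBody_closedBall (pointMap I y) hr
  have hcl := H.mem_closure_of_pointMap hK
    (Metric.ball_subset_interior_closedBall (Metric.mem_ball_self hr)) 0
  obtain ⟨p, hp, hpr⟩ := mem_closure_iff.1 hcl _ isOpen_core hy
  refine disjoint_left.1 ((core_disjoint_iff_ae H.moment (I u).2 (I (hK.level 0)).2).2
    (H.ae_disjoint (Eventually.of_forall fun x => ?_))) hp hpr
  by_cases hx : x ∈ Metric.closedBall (pointMap I y) r
  · exact Or.inl (comp_of_not_mem fun h => hrt hx (subset_closure h))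
  · right
    rw [comp_level, indicator_of_notMem hx]

/-- Convexity of the image of a function that is affine on a large ball. -/
theorem levelMap_affine_le (H : Setting n ζ I) (y₀ y₁ : Rn n) {a b : ℝ} (ha : 0 ≤ a) (hb : 0 ≤ b)
    (hab : a + b = 1) (θ : Rn n →L[ℝ] ℝ) (c : ℝ) :
    levelMap I (θ (pointMap I (a • y₀ + b • y₁)) + c)
      ≤ a * levelMap I (θ (pointMap I y₀) + c) + b * levelMap I (θ (pointMap I y₁) + c) := by
  set y := a • y₀ + b • y₁ with hy
  -- All three points are interior to this ball, where the formula for the image is available.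
  set r := max ‖pointMap I y‖ (max ‖pointMap I y₀‖ ‖pointMap I y₁‖) + 1 with hr
  have hrp : 0 < r := by positivity
  have hK : IsBody (Metric.closedBall (0 : Rn n) r) := isBody_closedBall 0 hrp
  let u : CVcn n := ⟨bodyFun (Metric.closedBall (0 : Rn n) r) fun x => θ x + c, hK.isCVcn
    ((θ.toLinearMap.convexOn convex_univ).add_const c) (by fun_prop)⟩
  have key : ∀ z, ‖pointMap I z‖ < r → z ∈ dom (I u : Rn n → EReal) ∧
      ((I u : Rn n → EReal) z).toReal = levelMap I (θ (pointMap I z) + c) := by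
    intro z hz
    have hzc : pointMap I z ∈ core (u : Rn n → EReal) := by
      change _ ∈ interior (dom (bodyFun _ _))
      rw [dom_bodyFun]
      exact Metric.ball_subset_interior_closedBall (by simpa using hz)
    have hd := core_subset_dom (H.preimage_core_subset u hzc)
    refine ⟨hd, H.moment.strictAnti.injective ?_⟩
    rw [← comp_of_mem (ζ := ζ) hd, H.comp_eq_of_mem_core u hzc, H.zeta_levelMap]
    congr 1
    exact comp_bodyFun_of_mem (by simpa using hz.le)
  obtain ⟨-, h⟩ := key y (by rw [hr]; exact (le_max_left _ _).trans_lt (lt_add_one _))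
  obtain ⟨hd₀, h₀⟩ := key y₀ (by
    rw [hr]; exact ((le_max_left _ _).trans (le_max_right _ _)).trans_lt (lt_add_one _))
  obtain ⟨hd₁, h₁⟩ := key y₁ (by
    rw [hr]; exact ((le_max_right _ _).trans (le_max_right _ _)).trans_lt (lt_add_one _))
  rw [← h, ← h₀, ← h₁]
  exact (IsCVcn.convexOn (I u).2).2 hd₀ hd₁ ha hb hab

end Setting

/-- If `q < p`, steps shrinking by the factor `q / p` have a convergent sum, while the increments of
`f` along them never decrease; so `f` would be unbounded below the limit point, against
monotonicity. -/
theorem le_of_increments_le {f : ℝ → ℝ} (hf : StrictMono f) {p q : ℝ} (hq : 0 ≤ q)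
    (h : ∀ s k, 0 ≤ k → 2 * f s ≤ f (s - k * p) + f (s + k * q)) : p ≤ q := by
  by_contra! hqp
  have hp : 0 < p := hq.trans_lt hqp
  set r := q / p with hr
  have hr0 : 0 ≤ r := by positivity
  have hr1 : r < 1 := (div_lt_one hp).2 hqp
  have hrp : p * r = q := by rw [hr]; field_simp
  have h1r : 0 < 1 - r := by linarith
  set σ : ℕ → ℝ := fun j => p * (1 - r ^ j) / (1 - r) with hσ
  have hstep : ∀ j, σ (j + 1) = σ j + r ^ j * p := by
    intro j
    simp only [hσ]
    field_simp
    ring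
  have hinc : ∀ j, f (σ 1) - f (σ 0) ≤ f (σ (j + 1)) - f (σ j) := by
    intro j
    induction j with
    | zero => exact le_rfl
    | succ j ih =>
      have h2 := h (σ (j + 1)) (r ^ j) (by positivity)
      have e1 : σ (j + 1) - r ^ j * p = σ j := by rw [hstep]; ring
      have e2 : σ (j + 1) + r ^ j * q = σ (j + 1 + 1) := by
        rw [hstep (j + 1), ← hrp]; ring
      rw [e1, e2] at h2
      linarith
  have hd : 0 < f (σ 1) - f (σ 0) := by
    rw [sub_pos]
    refine hf ?_
    have := hstep 0
    rw [this]
    simpa using hp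
  have hlin : ∀ j : ℕ, f (σ 0) + j * (f (σ 1) - f (σ 0)) ≤ f (σ j) := by
    intro j
    induction j with
    | zero => simp
    | succ j ih =>
      have := hinc j
      push_cast
      linarith
  obtain ⟨j, hj⟩ := exists_nat_gt ((f (p / (1 - r)) - f (σ 0)) / (f (σ 1) - f (σ 0)))
  rw [div_lt_iff₀ hd] at hj
  have h3 : f (σ j) ≤ f (p / (1 - r)) := by
    refine hf.monotone ?_
    simp only [hσ]
    gcongr
    have : 0 ≤ r ^ j := by positivity
    nlinarith
  linarith [hlin j]

namespace Setting

/-- The image of the midpoint divides the segment with weights `p` and `q`. Testing convexity on all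
multiples and shifts of a linear function gives an inequality for `levelMap` which, with its strict
monotonicity, yields `p ≤ q` and, with the sign reversed, `q ≤ p`. -/
theorem pointMap_midpoint (H : Setting n ζ I) (y₀ y₁ : Rn n) :
    pointMap I (midpoint ℝ y₀ y₁) = midpoint ℝ (pointMap I y₀) (pointMap I y₁) := by
  rcases eq_or_ne y₀ y₁ with rfl | hne
  · simp
  have hxne : pointMap I y₁ - pointMap I y₀ ≠ 0 := sub_ne_zero.2 fun h =>
    hne (H.bijective_pointMap.1 h).symm
  obtain ⟨θ, hθ⟩ := SeparatingDual.exists_eq_one (R := ℝ) hxne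
  have hm : midpoint ℝ y₀ y₁ = (1 / 2 : ℝ) • y₀ + (1 / 2 : ℝ) • y₁ := by
    rw [midpoint_eq_smul_add]; simp
  obtain ⟨p, q, hp, hq, hpq, hseg⟩ : pointMap I (midpoint ℝ y₀ y₁) ∈
      segment ℝ (pointMap I y₁) (pointMap I y₀) := by
    rw [segment_symm]
    exact H.back_segment_subset (H.mem_reach y₀) (H.mem_reach y₁) (midpoint_mem_segment _ _)
  rw [map_sub] at hθ
  have hθm : θ (pointMap I (midpoint ℝ y₀ y₁))
      = p * θ (pointMap I y₁) + q * θ (pointMap I y₀) := by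
    rw [← hseg]; simp
  have key : ∀ s k : ℝ, 2 * levelMap I s ≤ levelMap I (s - k * p) + levelMap I (s + k * q) := by
    intro s k
    have h := H.levelMap_affine_le y₀ y₁ (show (0 : ℝ) ≤ 1 / 2 by norm_num)
      (show (0 : ℝ) ≤ 1 / 2 by norm_num) (by norm_num) (k • θ)
      (s - k * θ (pointMap I (midpoint ℝ y₀ y₁)))
    rw [← hm] at h
    simp only [smul_apply, smul_eq_mul] at h
    rw [show k * θ (pointMap I (midpoint ℝ y₀ y₁)) + (s - k * θ (pointMap I (midpoint ℝ y₀ y₁))) = s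
        by ring,
      show k * θ (pointMap I y₀) + (s - k * θ (pointMap I (midpoint ℝ y₀ y₁))) = s - k * p by
        rw [hθm]; linear_combination (-k * p) * hθ + (-k * θ (pointMap I y₀)) * hpq,
      show k * θ (pointMap I y₁) + (s - k * θ (pointMap I (midpoint ℝ y₀ y₁))) = s + k * q by
        rw [hθm]; linear_combination (k * q) * hθ + (-k * θ (pointMap I y₁)) * hpq] at h
    linarith
  have hpq1 : p ≤ q := le_of_increments_le H.strictMono_levelMap hq fun s k _ => key s k
  have hpq2 : q ≤ p := le_of_increments_le H.strictMono_levelMap hp fun s k _ => by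
    have := key s (-k)
    rw [show s - -k * p = s + k * p by ring, show s + -k * q = s - k * q by ring] at this
    linarith
  obtain rfl : p = q := le_antisymm hpq1 hpq2
  have hp2 : p = 1 / 2 := by linarith
  rw [← hseg, midpoint_eq_smul_add, hp2]
  simp [add_comm]

end Setting

end
end ConvexIsometry

/-! ### The affinity, its determinant, and the equivalence. -/

namespace ConvexIsometry
noncomputable section

variable {n : ℕ} {ζ : ℝ → ℝ} {u v : Rn n → EReal} {K L : Set (Rn n)}
  {I : CVcn n → CVcn n} {t s : ℝ} {x y : Rn n} {θ : Rn n →L[ℝ] ℝ} {c : ℝ}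

/-- Comparison of two functions at the ends of segments along which they compare. -/
theorem comp_le_of_segment (hζ : IsMoment n ζ) (hu : IsCVcn u) (hv : IsCVcn v) (hc : 0 < c)
    {p b q d : Rn n} (hp : p ∈ dom u) (hb : b ∈ dom u)
    (h : ∀ ε : ℝ, 0 < ε → ε ≤ 1 →
      c * comp ζ u ((1 - ε) • p + ε • b) ≤ comp ζ v ((1 - ε) • q + ε • d)) :
    c * comp ζ u p ≤ comp ζ v q := by
  refine le_of_forall_lt_imp_le_of_dense fun a ha => ?_
  have h1 : Tendsto (fun ε : ℝ => (1 - ε) • q + ε • d) (𝓝[>] 0) (𝓝 q) := by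
    have : ContinuousAt (fun ε : ℝ => (1 - ε) • q + ε • d) 0 := by fun_prop
    have h2 := this.tendsto
    simp only [sub_zero, one_smul, zero_smul, add_zero] at h2
    exact h2.mono_left nhdsWithin_le_nhds
  refine (hv.isClosed_superlevel hζ).mem_of_tendsto h1 ?_
  set g : ℝ → ℝ := fun ε => c * ζ ((1 - ε) * (u p).toReal + ε * (u b).toReal) with hg
  have h3 : Continuous g :=
    continuous_const.mul (hζ.continuous.comp (by fun_prop))
  have h4 : ∀ᶠ ε in 𝓝[>] (0 : ℝ), a < g ε := by
    have : a < g 0 := by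
      simp only [hg, sub_zero, one_mul, zero_mul, add_zero]
      rwa [comp_of_mem hp] at ha
    exact (h3.continuousAt.eventually (lt_mem_nhds this)).filter_mono nhdsWithin_le_nhds
  filter_upwards [h4, Ioo_mem_nhdsGT (show (0 : ℝ) < 1 by norm_num)] with ε h5 h6
  refine h5.le.trans (le_trans ?_ (h ε h6.1 h6.2.le))
  have h7 := hu.convexOn.2 hp hb (sub_nonneg.2 h6.2.le) h6.1.le (by ring)
  rw [comp_of_mem (hu.convex_dom hp hb (sub_nonneg.2 h6.2.le) h6.1.le (by ring))]
  exact mul_le_mul_of_nonneg_left (hζ.strictAnti.antitone h7) hc.le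

theorem absDet_pos (φ : Rn n ≃ₗ[ℝ] Rn n) : 0 < absDet φ :=
  abs_pos.2 (LinearEquiv.isUnit_det' φ).ne_zero

theorem lintegral_comp_affinity (φ : Rn n ≃ₗ[ℝ] Rn n) (x₀ : Rn n) (g : Rn n → ENNReal) :
    ∫⁻ y, g ((affinity φ x₀).symm y) = ENNReal.ofReal (absDet φ) * ∫⁻ x, g x := by
  have hdet : LinearMap.det (φ.symm : Rn n →ₗ[ℝ] Rn n) ≠ 0 := (LinearEquiv.isUnit_det' _).ne_zero
  have hmap := Measure.map_linearMap_addHaar_eq_smul_addHaar (volume : Measure (Rn n)) hdet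
  have hinv : |(LinearMap.det (φ.symm : Rn n →ₗ[ℝ] Rn n))⁻¹| = absDet φ := by
    rw [absDet, ← LinearEquiv.det_coe_symm, LinearEquiv.symm_symm]
  rw [hinv] at hmap
  have he : ∫⁻ y, g (φ.symm y) = ∫⁻ y, g y ∂(Measure.map (φ.symm : Rn n →ₗ[ℝ] Rn n) volume) :=
    (lintegral_map_equiv g φ.symm.toContinuousLinearEquiv.toHomeomorph.toMeasurableEquiv).symm
  calc ∫⁻ y, g ((affinity φ x₀).symm y) = ∫⁻ y, g (φ.symm (y - x₀)) := rfl
    _ = ∫⁻ y, g (φ.symm y) := lintegral_sub_right_eq_self (fun y => g (φ.symm y)) x₀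
    _ = _ := by rw [he, hmap, lintegral_smul_measure, smul_eq_mul]

theorem zetaExt_extendTop_rescale {φ : Rn n ≃ₗ[ℝ] Rn n} (hφ : ∀ t, ζ t / absDet φ ∈ range ζ)
    (a : EReal) : zetaExt ζ (extendTop (rescale ζ φ) a) = zetaExt ζ a / absDet φ := by
  by_cases ha : a = ⊤
  · simp [extendTop, zetaExt, ha]
  · simp only [extendTop, zetaExt, ha, if_false, EReal.coe_ne_top, EReal.toReal_coe]
    exact Function.invFun_eq (hφ _)

theorem isIsometry_of_eq {φ : Rn n ≃ₗ[ℝ] Rn n} (hφ : φ ∈ Phi ζ) {x₀ : Rn n}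
    (h : ∀ u : CVcn n, (I u : Rn n → EReal) = fun x =>
      extendTop (rescale ζ φ) ((u : Rn n → EReal) ((affinity φ x₀).symm x))) : IsIsometry ζ I := by
  intro u v
  have hpos := absDet_pos φ
  simp only [delta, h, zetaExt_extendTop_rescale hφ.1]
  rw [lintegral_comp_affinity φ x₀ fun x => ENNReal.ofReal
    |zetaExt ζ ((u : Rn n → EReal) x) / absDet φ - zetaExt ζ ((v : Rn n → EReal) x) / absDet φ|,
    ← lintegral_const_mul' _ _ ENNReal.ofReal_ne_top]
  refine lintegral_congr fun x => ?_
  rw [← ENNReal.ofReal_mul hpos.le, ← sub_div, abs_div, abs_of_pos hpos, mul_div_cancel₀ _ hpos.ne']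

namespace Setting

/-- A continuous map preserving midpoints is affine. As `pointMap` plays the role of `α⁻¹`, its
linear part is inverted to obtain `φ`. -/
theorem exists_affinity (H : Setting n ζ I) :
    ∃ (φ : Rn n ≃ₗ[ℝ] Rn n) (x₀ : Rn n), pointMap I = (affinity φ x₀).symm := by
  let A : Rn n →ᵃ[ℝ] Rn n :=
    AffineMap.ofMapMidpoint (pointMap I) H.pointMap_midpoint H.continuous_pointMap
  have hA : ∀ y, A y = pointMap I y := fun _ => rfl
  have hinj : Function.Injective A.linear :=
    A.linear_injective_iff.2 H.bijective_pointMap.1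
  let φ := (LinearEquiv.ofInjectiveEndo A.linear hinj).symm
  refine ⟨φ, -φ (A 0), funext fun y => ?_⟩
  change pointMap I y = φ.symm (y - -φ (A 0))
  rw [sub_neg_eq_add, map_add, LinearEquiv.symm_apply_apply, ← hA]
  conv_lhs => rw [A.decomp]
  simp [φ]

/-- The affine point map can be followed along a line on which `θ` is the parameter, so
`levelMap_affine_le` becomes convexity of `levelMap`. -/
theorem convexOn_levelMap (H : Setting n ζ I) {φ : Rn n ≃ₗ[ℝ] Rn n} {x₀ : Rn n}
    (h : pointMap I = (affinity φ x₀).symm) : ConvexOn ℝ univ (levelMap I) := by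
  have : Nonempty (Fin n) := ⟨⟨0, H.one_le⟩⟩
  obtain ⟨e, he⟩ := exists_ne (0 : Rn n)
  obtain ⟨θ, hθ⟩ := SeparatingDual.exists_eq_one (R := ℝ) he
  refine ⟨convex_univ, fun s _ t _ a b ha hb hab => ?_⟩
  have hp : ∀ z, pointMap I (φ z + x₀) = z := fun z => by
    rw [h]; exact (affinity φ x₀).symm_apply_apply z
  have h1 := H.levelMap_affine_le (φ (s • e) + x₀) (φ (t • e) + x₀) ha hb hab θ 0
  have h2 : a • (φ (s • e) + x₀) + b • (φ (t • e) + x₀) = φ ((a * s + b * t) • e) + x₀ := by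
    rw [show a = 1 - b by linarith]
    simp only [map_smul]
    module
  rw [h2, hp, hp, hp] at h1
  simpa [hθ] using h1

/-- The image domain of the unit ball is, up to a null set, its preimage under the point map, of
volume `|det φ|` times as large; mass preservation at level `0` gives the ratio. -/
theorem ratio_mul_absDet (H : Setting n ζ I) {φ : Rn n ≃ₗ[ℝ] Rn n} {x₀ : Rn n}
    (h : pointMap I = (affinity φ x₀).symm) : ratio ζ I * absDet φ = 1 := by
  have hK : IsBody (Metric.closedBall (0 : Rn n) 1) := isBody_closedBall 0 one_pos
  have hvol : ∀ S : Set (Rn n), MeasurableSet S →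
      volume (pointMap I ⁻¹' S) = ENNReal.ofReal (absDet φ) * volume S := by
    intro S hS
    rw [← lintegral_indicator_one (hS.preimage H.continuous_pointMap.measurable),
      ← lintegral_indicator_one hS, ← lintegral_comp_affinity φ x₀]
    rw [h]
    rfl
  have hKi : volume (interior (Metric.closedBall (0 : Rn n) 1))
      = volume (Metric.closedBall (0 : Rn n) 1) := by
    refine le_antisymm (measure_mono interior_subset) ?_
    rw [← measure_inter_add_sdiff _ isOpen_interior.measurableSet, hK.volume_diff_interior,
      add_zero]
    exact measure_mono inter_subset_right
  have h1 : volume (reg I 0 hK) = ENNReal.ofReal (absDet φ) *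
      volume (Metric.closedBall (0 : Rn n) 1) := by
    refine le_antisymm ?_ ?_
    · rw [← hvol _ hK.measurableSet]
      exact measure_mono fun y hy => H.pointMap_mem hK hy
    · rw [← hKi, ← hvol _ isOpen_interior.measurableSet, ← volume_closure_reg]
      exact measure_mono fun y hy => H.mem_closure_of_pointMap hK hy 0
  have h2 := congrArg ENNReal.toReal (H.volume_reg (t := 0) hK)
  rw [h1, ENNReal.toReal_mul, ENNReal.toReal_mul, ENNReal.toReal_mul,
    ENNReal.toReal_ofReal (H.moment.pos _).le, ENNReal.toReal_ofReal (H.moment.pos _).le,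
    ENNReal.toReal_ofReal (absDet_pos φ).le, ← mul_assoc] at h2
  have h3 := mul_right_cancel₀ hK.volume_pos.ne' h2
  have h4 := (H.moment.pos 0).ne'
  rw [ratio, div_mul_eq_mul_div, h3, div_self h4]

/-- The image of a function in terms of the point map and the ratio, at every point. -/
theorem comp_eq (H : Setting n ζ I) {φ : Rn n ≃ₗ[ℝ] Rn n} {x₀ : Rn n}
    (h : pointMap I = (affinity φ x₀).symm) (u : CVcn n) (y : Rn n) :
    comp ζ (I u : Rn n → EReal) y = ratio ζ I * comp ζ (u : Rn n → EReal) (pointMap I y) := by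
  have hcombo : ∀ (ε : ℝ) (p d : Rn n), pointMap I ((1 - ε) • p + ε • d)
      = (1 - ε) • pointMap I p + ε • pointMap I d := by
    intro ε p d
    rw [h]
    change φ.symm _ = _ • φ.symm _ + _ • φ.symm _
    rw [← map_smul, ← map_smul, ← map_add]
    congr 1
    module
  -- Points moved towards an interior point enter the core, where the identity is known; since the
  -- point map is affine, both sides move along corresponding segments and the limit gives both
  -- inequalities.
  obtain ⟨b, hb⟩ := IsCVcn.core_nonempty u.2
  obtain ⟨d, rfl⟩ := H.bijective_pointMap.2 b
  have hd := H.preimage_core_subset u hb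
  have hpos := H.ratio_pos
  apply le_antisymm
  · by_cases hy : y ∈ dom (I u : Rn n → EReal)
    · have hcl : pointMap I y ∈ closure (dom (u : Rn n → EReal)) :=
        closure_minimal (H.core_subset_preimage u)
          (isClosed_closure.preimage H.continuous_pointMap)
          (IsCVcn.dom_subset_closure_core (I u).2 hy)
      have h1 := comp_le_of_segment H.moment (I u).2 u.2 (inv_pos.2 hpos) hy (core_subset_dom hd)
        (q := pointMap I y) (d := pointMap I d) fun ε h0 h1 => by
          have h2 := IsCVcn.combo_mem_core u.2 hcl hb h0 h1
          rw [← hcombo] at h2 ⊢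
          rw [H.comp_eq_of_mem_core u h2, inv_mul_cancel_left₀ hpos.ne']
      rwa [inv_mul_le_iff₀ hpos] at h1
    · rw [comp_of_not_mem hy]
      exact mul_nonneg hpos.le (comp_nonneg H.moment _)
  · by_cases hy : pointMap I y ∈ dom (u : Rn n → EReal)
    · refine comp_le_of_segment H.moment u.2 (I u).2 hpos hy (core_subset_dom hb)
        (d := d) fun ε h0 h1 => ?_
      have h2 := IsCVcn.combo_mem_core u.2 (subset_closure hy) hb h0 h1
      rw [← hcombo] at h2 ⊢
      rw [H.comp_eq_of_mem_core u h2]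
    · rw [comp_of_not_mem hy, mul_zero]
      exact comp_nonneg H.moment _

theorem exists_eq (H : Setting n ζ I) :
    ∃ φ ∈ Phi (n := n) ζ, ∃ x₀ : Rn n, ∀ u : CVcn n, (I u : Rn n → EReal) = fun x =>
      extendTop (rescale ζ φ) ((u : Rn n → EReal) ((affinity φ x₀).symm x)) := by
  obtain ⟨φ, x₀, h⟩ := H.exists_affinity
  have hdet := absDet_pos φ
  have hratio : ratio ζ I = 1 / absDet φ := eq_div_of_mul_eq hdet.ne' (H.ratio_mul_absDet h)
  have hlev : ∀ t, ζ t / absDet φ = ζ (levelMap I t) := fun t => by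
    rw [H.zeta_levelMap, hratio]; ring
  have hinv := Function.leftInverse_invFun H.moment.strictAnti.injective
  have hresc : rescale ζ φ = levelMap I := funext fun t => by
    rw [rescale, hlev]; exact hinv _
  refine ⟨φ, ⟨fun t => ⟨_, (hlev t).symm⟩, hresc ▸ H.convexOn_levelMap h⟩, x₀, fun u =>
    funext fun y => ?_⟩
  have hc := H.comp_eq h u y
  rw [← h]
  by_cases hy : pointMap I y ∈ dom (u : Rn n → EReal)
  · have hyd : y ∈ dom (I u : Rn n → EReal) := (comp_pos_iff H.moment).1 (by
      rw [hc]; exact mul_pos H.ratio_pos ((comp_pos_iff H.moment).2 hy))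
    rw [comp_of_mem hyd, comp_of_mem hy, ← H.zeta_levelMap] at hc
    rw [extendTop, if_neg (ne_of_lt hy), hresc, ← H.moment.strictAnti.injective hc,
      IsCVcn.coe_toReal (I u).2 hyd]
  · have hyd : y ∉ dom (I u : Rn n → EReal) := fun hyd => by
      have := (comp_pos_iff H.moment).2 hyd
      rw [hc, comp_of_not_mem hy, mul_zero] at this
      exact lt_irrefl _ this
    have e1 : (u : Rn n → EReal) (pointMap I y) = ⊤ := by simpa [dom] using hy
    have e2 : (I u : Rn n → EReal) y = ⊤ := by simpa [dom] using hyd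
    rw [extendTop, if_pos e1, e2]

end Setting

end
end ConvexIsometry

theorem theorem2 (n : ℕ) (hn : 1 ≤ n) (ζ : ℝ → ℝ) (hζ : ConvexIsometry.IsMoment n ζ)
    (I : ConvexIsometry.CVcn n → ConvexIsometry.CVcn n) :
    ConvexIsometry.IsIsometry ζ I ↔
      ∃ φ ∈ ConvexIsometry.Phi (n := n) ζ, ∃ x₀ : ConvexIsometry.Rn n,
        ∀ u : ConvexIsometry.CVcn n,
          (I u : ConvexIsometry.Rn n → EReal) = fun x =>
            ConvexIsometry.extendTop (ConvexIsometry.rescale ζ φ)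
              ((u : ConvexIsometry.Rn n → EReal) ((ConvexIsometry.affinity φ x₀).symm x)) := by
  refine ⟨fun h => ConvexIsometry.Setting.exists_eq ⟨hζ, hn, h⟩, ?_⟩
  rintro ⟨φ, hφ, x₀, h⟩
  exact ConvexIsometry.isIsometry_of_eq hφ h
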